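/- Throughout, $G$ is a fixed discrete group. An \emph{algebra} $(A,\alpha)$ is a discrete, not necessarily unital algebra over $\mathbb C$ with an action $\alpha$ of $G$ by algebra automorphisms; algebra homomorphisms are $G$-equivariant. An \emph{approximate unit} of $A$ is a net $(x_i)_{i\in I}$ in $A$ such that for every $a\in A$ there is $j\in I$ with $x_ia=ax_i=a$ for all $i\ge j$. A \emph{functional $A$-module} $(\mathcal E,S,\Theta_A(\mathcal E))$ is a complex vector space $\mathcal E$ with a right $A$-module structure, a $G$-action $S$ with $S_g(\xi a)=S_g(\xi)\alpha_g(a)$, and a $G$-invariant left $A$-submodule $\Theta_A(\mathcal E)\subseteq \mathrm{Hom}_A(\mathcal E,A)$, where $(a\phi)(\xi)=a\phi(\xi)$ and $g(\phi)=\alpha_g\circ\phi\circ S_{g^{-1}}$. It is \emph{cofull} if every element of $\mathcal E$ is a finite sum of elements $\xi\phi(\eta)$, and $\Theta_A(\mathcal E)$ is \emph{cofull} if each of its elements is a finite sum of functionals $\phi(\xi)\tau$, with $\xi,\eta\in\mathcal E$, $\phi,\tau\in\Theta_A(\mathcal E)$. $\mathcal K_A(\mathcal E)$ is the algebra of finite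 sums of the operators $\theta_{\eta,\phi}(\xi)=\eta\phi(\xi)$ on $\mathcal E$, with $G$-action $T\mapsto S_gTS_{g^{-1}}$. For a set $n$, $A^n=\bigoplus_{i\in n}A$ carries the functionals $\xi\mapsto\sum_i b_i\xi_i$ with $b\in A^n$. For a linear $G$-action $\mu$ on $\mathbb C^n$ (finitely supported functions) leaving the space of finitely supported row functionals invariant, $(A\otimes\mathbb C^n,\alpha\otimes\mu)$ is called a plain module $A^n$. A \emph{functional extension} $\mathcal E\to\mathcal F$ is a pair $(U,U^*)$ consisting of an injective $G$-equivariant $A$-module homomorphism $U:\mathcal E\to\mathcal F$ and a $G$-equivariant left $A$-module homomorphism $U^*:\Theta_A(\mathcal E)\to\Theta_A(\mathcal F)$ such that $U^*(\phi)(U\xi)=\phi(\xi)$ for all $\phi,\xi$, and such that for all $\phi_1,\dots,\phi_k\in\Theta_A(\mathcal E)$ and $\eta\in\mathcal F$ there is $\xi\in\mathcal E$ with $U^*(\phi_i)(\eta)=\phi_i(\xi)$ for all $i$. Let $C$ be the class of all functional modules $\mathcal E$ over algebras $A$ with approximate units such that $\mathcal E$ and $\Theta_A(\mathcal E)$ are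 cofull, $\mathcal K_A(\mathcal E)$ has an approximate unit, and $\mathcal E$ has a functional extension into some plain module $(A\otimes\mathbb C^n,\alpha\otimes\mu)$, $n$ of any cardinality. \textbf{Theorem.} Let $A$, $B$ denote algebras with approximate units. \begin{enumerate} \item $C$ contains all plain modules $(A\otimes\mathbb C^n,\alpha\otimes\mu)$, $n$ of any cardinality. \item If $G$ is finite, $C$ contains all $(A^n,\gamma)$ with an arbitrary $G$-action $\gamma$ for which $A^n$ with its standard functionals is a functional $(A,\alpha)$-module. \item If $\mathcal E_i\in C$ ($i\in I$, $I$ any set) are $A$-modules, then $\bigoplus_{i\in I}\mathcal E_i\in C$, with the functional space $\bigoplus_{i\in I}\Theta_A(\mathcal E_i)$. \item If $\mathcal E\in C$ is an $A$-module and $\pi:A\to B$ is an algebra homomorphism, then $C$ contains the $B$-module $\mathcal E\otimes_\pi B=\mathcal E\otimes B/\mathrm{span}\{\xi a\otimes b-\xi\otimes\pi(a)b\}$ with action $S\otimes\beta$ ($\beta$ the action on $B$) and functional space spanned by $(\phi\otimes c)(\xi\otimes b)=c\,\pi(\phi(\xi))\,b$, $\phi\in\Theta_A(\mathcal E)$,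 $c\in B$. \item If $\mathcal E\in C$ is an $A$-module and $\mathcal G\in C$ is a $B$-module, then the external tensor product $\mathcal E\otimes\mathcal G$, an $A\otimes B$-module with diagonal action and functional space spanned by the $\phi\otimes\psi$, is in $C$. \item Let $\mathcal E\in C$ be an $A$-module, $K=\mathcal K_A(\mathcal E\oplus A)$ (with $A$ having the functionals given by left multiplication by elements of $A$), and let $\mathcal F\in C$ be a $K$-module. Let $M_A=\{m_a: a\in A\}\subseteq K$ with $m_a(\xi\oplus b)=0\oplus ab$, so that $A\cong M_A$. Then $\mathcal F\cdot M_A$, an $A$-module via $A\cong M_A$ with the restricted action and with functional space $\{m_b\,\phi|_{\mathcal F\cdot M_A}: b\in A,\ \phi\in\Theta_K(\mathcal F)\}$, whose values lie in $M_A\cong A$, is in $C$. \end{enumerate} -/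

import Mathlib

open scoped TensorProduct

universe u v

/-- A (discrete, not necessarily unital) algebra over `ℂ` with a `G`-action by algebra
automorphisms. -/
structure GAlgebra (G : Type v) [Group G] where
  carrier : Type u
  [ring : NonUnitalRing carrier]
  [module : Module ℂ carrier]
  [tower : IsScalarTower ℂ carrier carrier]
  [comm : SMulCommClass ℂ carrier carrier]
  act : Representation ℂ G carrier
  act_mul : ∀ g a b, act g (a * b) = act g a * act g b

namespace GAlgebra

instance (G : Type v) [Group G] : CoeSort (GAlgebra.{u, v} G) (Type u) := ⟨GAlgebra.carrier⟩

attribute [instance] GAlgebra.ring GAlgebra.module GAlgebra.tower GAlgebra.comm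

variable {G : Type v} [Group G]

/-- A two-sided approximate unit of a discrete algebra: a net which is eventually a unit for each
element. -/
def HasApproxUnit (A : GAlgebra.{u, v} G) : Prop :=
  ∃ (I : Type u) (_ : Preorder I) (_ : IsDirected I (· ≤ ·)) (_ : Nonempty I) (x : I → A),
    ∀ a : A, ∃ j, ∀ i, j ≤ i → x i * a = a ∧ a * x i = a

theorem HasApproxUnit.exists_unit {A : GAlgebra.{u, v} G} (h : A.HasApproxUnit) (a b : A) :
    ∃ e : A, (e * a = a ∧ a * e = a) ∧ (e * b = b ∧ b * e = b) := by
  obtain ⟨I, _, _, _, x, hx⟩ := h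
  obtain ⟨j, hj⟩ := hx a
  obtain ⟨k, hk⟩ := hx b
  obtain ⟨l, h1, h2⟩ := exists_ge_ge j k
  exact ⟨x l, hj l h1, hk l h2⟩

/-- A local unit for all coordinates of a finitely supported family. -/
theorem HasApproxUnit.exists_unit_finsupp {A : GAlgebra.{u, v} G} (h : A.HasApproxUnit)
    {n : Type u} (ξ : n →₀ A) : ∃ e : A, ∀ i, ξ i * e = ξ i := by
  classical
  obtain ⟨I, _, _, _, x, hx⟩ := h
  choose j hj using hx
  obtain ⟨M, hM⟩ := (ξ.support.image (fun i => j (ξ i))).exists_le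
  refine ⟨x M, fun i => ?_⟩
  by_cases hi : ξ i = 0
  · simp [hi]
  · exact (hj (ξ i) M (hM _ (Finset.mem_image_of_mem _ (Finsupp.mem_support_iff.2 hi)))).2

/-- A `G`-equivariant algebra homomorphism. -/
structure Hom (A B : GAlgebra.{u, v} G) where
  toFun : A →ₙₐ[ℂ] B
  map_act : ∀ g a, toFun (A.act g a) = B.act g (toFun a)

/-- The algebra `A ⊗ B` with the diagonal `G`-action. -/
noncomputable def tensor (A B : GAlgebra.{u, v} G) : GAlgebra.{u, v} G where
  carrier := A ⊗[ℂ] B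
  act := A.act.tprod B.act
  act_mul g x y := by
    induction x with
    | zero => simp
    | add x₁ x₂ h₁ h₂ => simp only [add_mul, map_add, h₁, h₂]
    | tmul a b =>
      induction y with
      | zero => simp
      | add x₁ x₂ h₁ h₂ => simp only [mul_add, map_add, h₁, h₂]
      | tmul c d => simp [Representation.tprod, A.act_mul, B.act_mul]

end GAlgebra

/-- A right functional `A`-module: a complex vector space with a right multiplication by the
`G`-algebra `A`, a compatible `G`-action, and a distinguished space of right `A`-linear maps into
`A` which is a `G`-invariant left `A`-submodule. (If every element is a sum of products `ξ a`, then
additive `A`-linear maps and additive `G`-actions are automatically complex linear.) -/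
structure FunctionalModule {G : Type v} [Group G] (A : GAlgebra.{u, v} G) where
  carrier : Type u
  [addCommGroup : AddCommGroup carrier]
  [module : Module ℂ carrier]
  /-- The right multiplication `(ξ, a) ↦ ξ a`. -/
  rmul : carrier →ₗ[ℂ] A →ₗ[ℂ] carrier
  rmul_mul : ∀ ξ a b, rmul ξ (a * b) = rmul (rmul ξ a) b
  act : Representation ℂ G carrier
  act_rmul : ∀ g ξ a, act g (rmul ξ a) = rmul (act g ξ) (A.act g a)
  /-- The functional space `Θ_A`. -/
  functionals : Submodule ℂ (carrier →ₗ[ℂ] A)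
  functional_rmul : ∀ φ ∈ functionals, ∀ ξ a, φ (rmul ξ a) = φ ξ * a
  lmul_mem : ∀ a : A, ∀ φ ∈ functionals, LinearMap.mulLeft ℂ a ∘ₗ φ ∈ functionals
  act_mem : ∀ g, ∀ φ ∈ functionals, A.act g ∘ₗ φ ∘ₗ act g⁻¹ ∈ functionals

namespace FunctionalModule

variable {G : Type v} [Group G]

attribute [instance] FunctionalModule.addCommGroup FunctionalModule.module

instance (A : GAlgebra.{u, v} G) : CoeSort (FunctionalModule A) (Type u) :=
  ⟨FunctionalModule.carrier⟩

variable {A : GAlgebra.{u, v} G}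

/-- The left multiplication on the functional space, `(a φ)(ξ) = a φ(ξ)`. -/
noncomputable def lmul (E : FunctionalModule A) (a : A) (φ : E.functionals) : E.functionals :=
  ⟨LinearMap.mulLeft ℂ a ∘ₗ φ.1, E.lmul_mem a φ.1 φ.2⟩

/-- The `G`-action on the functional space, `g(φ) = α_g ∘ φ ∘ S_{g⁻¹}`. -/
def dualAct (E : FunctionalModule A) (g : G) (φ : E.functionals) : E.functionals :=
  ⟨A.act g ∘ₗ φ.1 ∘ₗ E.act g⁻¹, E.act_mem g φ.1 φ.2⟩

/-- Every element is a finite sum of elements `ξ φ(η)`. -/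
def Cofull (E : FunctionalModule A) : Prop :=
  ∀ ζ : E, ζ ∈ AddSubmonoid.closure
    {x : E | ∃ ξ : E, ∃ φ : E.functionals, ∃ η : E, x = E.rmul ξ (φ.1 η)}

/-- Every functional is a finite sum of functionals `φ(ξ) τ`. -/
def DualCofull (E : FunctionalModule A) : Prop :=
  ∀ ψ : E.functionals, ψ ∈ AddSubmonoid.closure
    {x : E.functionals | ∃ φ : E.functionals, ∃ ξ : E, ∃ τ : E.functionals,
      x = E.lmul (φ.1 ξ) τ}

/-- The elementary compact operator `ξ ↦ η φ(ξ)`. -/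
def theta (E : FunctionalModule A) (η : E) (φ : E →ₗ[ℂ] A) : Module.End ℂ E := E.rmul η ∘ₗ φ

theorem theta_mul (E : FunctionalModule A) (η η' : E) (φ φ' : E →ₗ[ℂ] A)
    (hφ : φ ∈ E.functionals) :
    E.theta η φ * E.theta η' φ' = E.theta (E.rmul η (φ η')) φ' := by
  ext ξ
  simp [theta, E.functional_rmul φ hφ, E.rmul_mul]

/-- The finite sums of elementary compact operators, as a subalgebra of the endomorphisms. -/
def compactSubalgebra (E : FunctionalModule A) : NonUnitalSubalgebra ℂ (Module.End ℂ E) where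
  __ := Submodule.span ℂ {T | ∃ η : E, ∃ φ ∈ E.functionals, T = E.theta η φ}
  mul_mem' {S T} hS hT := by
    change S * T ∈ Submodule.span ℂ _
    induction hS using Submodule.span_induction with
    | zero => simp
    | add _ _ _ _ h₁ h₂ => rw [add_mul]; exact Submodule.add_mem _ h₁ h₂
    | smul c _ _ h => rw [smul_mul_assoc]; exact Submodule.smul_mem _ c h
    | mem _ hS =>
      obtain ⟨η, φ, hφ, rfl⟩ := hS
      induction hT using Submodule.span_induction with
      | zero => simp
      | add _ _ _ _ h₁ h₂ => rw [mul_add]; exact Submodule.add_mem _ h₁ h₂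
      | smul c _ _ h => rw [mul_smul_comm]; exact Submodule.smul_mem _ c h
      | mem _ hT =>
        obtain ⟨η', φ', hφ', rfl⟩ := hT
        exact Submodule.subset_span ⟨_, φ', hφ', E.theta_mul η η' φ φ' hφ⟩

theorem conj_mem_compact (E : FunctionalModule A) (g : G) (T : Module.End ℂ E)
    (hT : T ∈ E.compactSubalgebra) : E.act g * T * E.act g⁻¹ ∈ E.compactSubalgebra := by
  change _ ∈ Submodule.span ℂ _
  change T ∈ Submodule.span ℂ _ at hT
  induction hT using Submodule.span_induction with
  | zero => simp
  | add _ _ _ _ h₁ h₂ => rw [mul_add, add_mul]; exact Submodule.add_mem _ h₁ h₂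
  | smul c _ _ h => rw [mul_smul_comm, smul_mul_assoc]; exact Submodule.smul_mem _ c h
  | mem _ hT =>
    obtain ⟨η, φ, hφ, rfl⟩ := hT
    refine Submodule.subset_span ⟨E.act g η, _, E.act_mem g φ hφ, ?_⟩
    ext ξ
    simp [theta, E.act_rmul]

theorem compact_rmul (E : FunctionalModule A) (T : Module.End ℂ E)
    (hT : T ∈ E.compactSubalgebra) (ξ : E) (a : A) : T (E.rmul ξ a) = E.rmul (T ξ) a := by
  change T ∈ Submodule.span ℂ _ at hT
  induction hT using Submodule.span_induction with
  | zero => simp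
  | add _ _ _ _ h₁ h₂ => simp only [LinearMap.add_apply, h₁, h₂, map_add]
  | smul c _ _ h => simp only [LinearMap.smul_apply, h, map_smul]
  | mem _ hT =>
    obtain ⟨η, φ, hφ, rfl⟩ := hT
    simp [theta, E.functional_rmul φ hφ, E.rmul_mul]

/-- The `G`-algebra `𝒦_A(E)` of compact operators, with the action `T ↦ S_g ∘ T ∘ S_{g⁻¹}`. -/
def compact (E : FunctionalModule A) : GAlgebra.{u, v} G where
  carrier := E.compactSubalgebra
  act :=
    { toFun := fun g =>
        { toFun := fun T => ⟨E.act g * T.1 * E.act g⁻¹, E.conj_mem_compact g T.1 T.2⟩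
          map_add' := fun S T => Subtype.ext (by simp [mul_add, add_mul])
          map_smul' := fun c T => Subtype.ext (by simp) }
      map_one' := by ext T; simp
      map_mul' := fun g h => by
        ext T
        simp [mul_assoc] }
  act_mul g S T := Subtype.ext (by
    have h : E.act g⁻¹ * E.act g = 1 := by rw [← map_mul]; simp
    change E.act g * (S.1 * T.1) * E.act g⁻¹
      = (E.act g * S.1 * E.act g⁻¹) * (E.act g * T.1 * E.act g⁻¹)
    rw [show (E.act g * S.1 * E.act g⁻¹) * (E.act g * T.1 * E.act g⁻¹)
      = E.act g * S.1 * (E.act g⁻¹ * E.act g) * T.1 * E.act g⁻¹ by simp only [mul_assoc], h]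
    simp only [mul_assoc, one_mul])

/-- A homomorphism `(U, U^*)` of functional modules. -/
structure Hom (E F : FunctionalModule A) where
  toFun : E →ₗ[ℂ] F
  map_rmul : ∀ ξ a, toFun (E.rmul ξ a) = F.rmul (toFun ξ) a
  map_act : ∀ g ξ, toFun (E.act g ξ) = F.act g (toFun ξ)
  dual : E.functionals →ₗ[ℂ] F.functionals
  dual_lmul : ∀ a φ, dual (E.lmul a φ) = F.lmul a (dual φ)
  dual_act : ∀ g φ, dual (E.dualAct g φ) = F.dualAct g (dual φ)
  pairing : ∀ φ ξ, (dual φ).1 (toFun ξ) = φ.1 ξ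

/-- A functional extension: an injective homomorphism such that, against finitely many functionals
of `E`, each element of `F` can be replaced by an element of `E`. -/
def Hom.IsExtension {E F : FunctionalModule A} (U : Hom E F) : Prop :=
  Function.Injective U.toFun ∧
    ∀ (s : Finset E.functionals) (η : F), ∃ ξ : E, ∀ φ ∈ s, (U.dual φ).1 η = φ.1 ξ

/-! ### The modules `A^n` -/

/-- The functional `ξ ↦ ∑ i, b i * ξ i` on `A^n`, as a function of `b`. -/
noncomputable def row (A : GAlgebra.{u, v} G) (n : Type u) :
    (n →₀ A) →ₗ[ℂ] (n →₀ A) →ₗ[ℂ] A :=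
  Finsupp.lsum ℂ fun i => LinearMap.lcomp ℂ A (Finsupp.lapply i) ∘ₗ LinearMap.mul ℂ A

theorem row_single (n : Type u) (i : n) (b : A) (ξ : n →₀ A) :
    row A n (Finsupp.single i b) ξ = b * ξ i := by
  simp [row]

/-- The coordinatewise right multiplication on `A^n`. -/
noncomputable def freeMul (A : GAlgebra.{u, v} G) (n : Type u) :
    (n →₀ A) →ₗ[ℂ] A →ₗ[ℂ] (n →₀ A) :=
  LinearMap.mk₂ ℂ (fun ξ a => Finsupp.mapRange.linearMap (LinearMap.mulRight ℂ a) ξ)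
    (fun _ _ _ => map_add _ _ _) (fun _ _ _ => map_smul _ _ _)
    (fun _ _ _ => by ext; simp [mul_add]) (fun _ _ _ => by ext; simp [mul_smul_comm])

@[simp] theorem freeMul_apply (n : Type u) (ξ : n →₀ A) (a : A) (i : n) :
    freeMul A n ξ a i = ξ i * a := by
  simp [freeMul]

/-- The standard functional module `A^n` (`n` an arbitrary index set), whose functionals are the
finitely supported rows, with an arbitrary `G`-action for which it is a functional module. -/
noncomputable def free (A : GAlgebra.{u, v} G) (n : Type u) (S : Representation ℂ G (n →₀ A))
    (hS : ∀ g ξ a, S g (freeMul A n ξ a) = freeMul A n (S g ξ) (A.act g a))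
    (hrow : ∀ g, ∀ φ ∈ LinearMap.range (row A n),
      A.act g ∘ₗ φ ∘ₗ S g⁻¹ ∈ LinearMap.range (row A n)) :
    FunctionalModule A where
  carrier := n →₀ A
  rmul := freeMul A n
  rmul_mul ξ a b := by ext; simp [mul_assoc]
  act := S
  act_rmul := hS
  functionals := LinearMap.range (row A n)
  functional_rmul := by
    rintro _ ⟨b, rfl⟩ ξ a
    induction b using Finsupp.induction_linear with
    | zero => simp
    | add b c hb hc => simp only [map_add, LinearMap.add_apply, hb, hc, add_mul]
    | single i b => simp [row_single, mul_assoc]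
  lmul_mem := by
    rintro a _ ⟨b, rfl⟩
    refine ⟨Finsupp.mapRange.linearMap (LinearMap.mulLeft ℂ a) b, ?_⟩
    induction b using Finsupp.induction_linear with
    | zero => simp
    | add b c hb hc => rw [map_add, map_add, hb, hc, map_add, LinearMap.comp_add]
    | single i b =>
      refine LinearMap.ext fun ξ => ?_
      rw [Finsupp.mapRange.linearMap_apply, Finsupp.mapRange_single, row_single]
      simp only [LinearMap.comp_apply, row_single, LinearMap.mulLeft_apply, mul_assoc]
  act_mem := hrow

open scoped Classical in
/-- The action `α ⊗ μ` on `A ⊗ ℂ^n`, transported to `A^n`. -/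
noncomputable def tensorAct (A : GAlgebra.{u, v} G) {n : Type u}
    (μ : Representation ℂ G (n →₀ ℂ)) : Representation ℂ G (n →₀ A) where
  toFun g := (TensorProduct.finsuppScalarRight ℂ ℂ A n).toLinearMap ∘ₗ
    (A.act.tprod μ) g ∘ₗ (TensorProduct.finsuppScalarRight ℂ ℂ A n).symm.toLinearMap
  map_one' := by ext; simp [Finsupp.single_apply]
  map_mul' g h := by ext; simp

theorem tensorAct_single {n : Type u} (μ : Representation ℂ G (n →₀ ℂ)) (g : G) (j : n) (a : A)
    (i : n) : tensorAct A μ g (Finsupp.single j a) i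
      = μ g (Finsupp.single j 1) i • A.act g a := by
  simp [tensorAct, Representation.tprod, TensorProduct.finsuppScalarRight_apply_tmul_apply]

/-- The matrices of `μ` have finite rows, that is, the standard functional space `ℂ^n` of the
vector space `ℂ^n` of finitely supported functions is `μ`-invariant. (Finite columns are
automatic.) This is what makes `(A ⊗ ℂ^n, α ⊗ μ)` a functional module. -/
def RowFinite {n : Type u} (μ : Representation ℂ G (n →₀ ℂ)) : Prop :=
  ∀ g i, {j | μ g (Finsupp.single j 1) i ≠ 0}.Finite

theorem tensorAct_freeMul {n : Type u} (μ : Representation ℂ G (n →₀ ℂ)) (g : G) (ξ : n →₀ A)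
    (a : A) : tensorAct A μ g (freeMul A n ξ a)
      = freeMul A n (tensorAct A μ g ξ) (A.act g a) := by
  induction ξ using Finsupp.induction_linear with
  | zero => simp
  | add b c hb hc => simp only [map_add, LinearMap.add_apply, hb, hc]
  | single j b =>
    have h : freeMul A n (Finsupp.single j b) a = Finsupp.single j (b * a) := by
      simp [freeMul]
    ext i
    rw [h, freeMul_apply, tensorAct_single, tensorAct_single, A.act_mul, smul_mul_assoc]

theorem tensorAct_row {n : Type u} (μ : Representation ℂ G (n →₀ ℂ)) (hμ : RowFinite μ) (g : G)
    (φ : (n →₀ A) →ₗ[ℂ] A) (hφ : φ ∈ LinearMap.range (row A n)) :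
    A.act g ∘ₗ φ ∘ₗ tensorAct A μ g⁻¹ ∈ LinearMap.range (row A n) := by
  obtain ⟨b, rfl⟩ := hφ
  induction b using Finsupp.induction_linear with
  | zero => simp
  | add b c hb hc =>
    rw [map_add, LinearMap.add_comp, LinearMap.comp_add]
    exact Submodule.add_mem _ hb hc
  | single i b =>
    refine ⟨Finsupp.ofSupportFinite (fun j => μ g⁻¹ (Finsupp.single j 1) i • A.act g b)
      ((hμ g⁻¹ i).subset fun j hj h => hj (by simp [h])), ?_⟩
    refine Finsupp.lhom_ext fun j x => ?_
    have key : ∀ c : n →₀ A, row A n c (Finsupp.single j x) = c j * x := by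
      intro c
      induction c using Finsupp.induction_linear with
      | zero => simp
      | add b c hb hc => simp only [map_add, LinearMap.add_apply, hb, hc, Finsupp.add_apply, add_mul]
      | single k c =>
        classical
        rw [row_single, Finsupp.single_apply, Finsupp.single_apply]
        by_cases h : k = j
        · simp [h]
        · simp [h, Ne.symm h]
    rw [key]
    simp [row_single, tensorAct_single, A.act_mul, Finsupp.ofSupportFinite_coe, smul_mul_assoc,
      mul_smul_comm]

/-- The plain module `A^n = (A ⊗ ℂ^n, α ⊗ μ)`. -/
noncomputable def plain (A : GAlgebra.{u, v} G) (n : Type u) (μ : Representation ℂ G (n →₀ ℂ))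
    (hμ : RowFinite μ) : FunctionalModule A :=
  free A n (tensorAct A μ) (tensorAct_freeMul μ) (tensorAct_row μ hμ)

/-- A `G`-action `γ` on `A^n` by additive maps, compatible with the module structure; it is
automatically complex linear if `A` has an approximate unit. -/
noncomputable def linearAction (hA : A.HasApproxUnit) {n : Type u}
    (γ : G →* AddMonoid.End (n →₀ A))
    (hγ : ∀ g ξ a, γ g (freeMul A n ξ a) = freeMul A n (γ g ξ) (A.act g a)) :
    Representation ℂ G (n →₀ A) where
  toFun g :=
    { toFun := γ g
      map_add' := map_add (γ g)
      map_smul' := fun c ξ => by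
        obtain ⟨e, he⟩ := hA.exists_unit_finsupp ξ
        have h1 : freeMul A n ξ e = ξ := by ext i; simp [he i]
        have h2 : c • ξ = freeMul A n ξ (c • e) := by rw [map_smul, h1]
        rw [h2, hγ, map_smul, map_smul, ← hγ, h1]
        rfl }
  map_one' := LinearMap.ext fun ξ => by simp
  map_mul' g h := LinearMap.ext fun ξ => by simp

/-! ### Operations on functional modules -/

/-- The algebra `A` as a functional module over itself. -/
noncomputable def self (A : GAlgebra.{u, v} G) : FunctionalModule A where
  carrier := A
  rmul := LinearMap.mul ℂ A
  rmul_mul ξ a b := by simp [mul_assoc]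
  act := A.act
  act_rmul g ξ a := by simp [A.act_mul]
  functionals := LinearMap.range (LinearMap.mul ℂ A)
  functional_rmul := by
    rintro _ ⟨b, rfl⟩ ξ a
    simp [mul_assoc]
  lmul_mem := by
    rintro a _ ⟨b, rfl⟩
    exact ⟨a * b, by ext; simp [mul_assoc]⟩
  act_mem := by
    rintro g _ ⟨b, rfl⟩
    exact ⟨A.act g b, by ext; simp [A.act_mul]⟩

/-- The direct sum of two functional modules. -/
def prod (E F : FunctionalModule A) : FunctionalModule A where
  carrier := E × F
  rmul := LinearMap.mk₂ ℂ (fun ξ a => (E.rmul ξ.1 a, F.rmul ξ.2 a))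
    (by simp) (by simp) (by simp) (by simp)
  rmul_mul ξ a b := by simp [E.rmul_mul, F.rmul_mul]
  act :=
    { toFun := fun g => (E.act g).prodMap (F.act g)
      map_one' := by ext <;> simp
      map_mul' := fun g h => by ext <;> simp }
  act_rmul g ξ a := by simp [E.act_rmul, F.act_rmul]
  functionals := E.functionals.map (LinearMap.lcomp ℂ A (LinearMap.fst ℂ E F)) ⊔
    F.functionals.map (LinearMap.lcomp ℂ A (LinearMap.snd ℂ E F))
  functional_rmul χ hχ ξ a := by
    obtain ⟨_, ⟨φ, hφ, rfl⟩, _, ⟨ψ, hψ, rfl⟩, rfl⟩ := Submodule.mem_sup.1 hχ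
    simp [E.functional_rmul φ hφ, F.functional_rmul ψ hψ, add_mul]
  lmul_mem a χ hχ := by
    obtain ⟨_, ⟨φ, hφ, rfl⟩, _, ⟨ψ, hψ, rfl⟩, rfl⟩ := Submodule.mem_sup.1 hχ
    exact Submodule.mem_sup.2 ⟨_, ⟨_, E.lmul_mem a φ hφ, rfl⟩, _, ⟨_, F.lmul_mem a ψ hψ, rfl⟩,
      by ext <;> simp⟩
  act_mem g χ hχ := by
    obtain ⟨_, ⟨φ, hφ, rfl⟩, _, ⟨ψ, hψ, rfl⟩, rfl⟩ := Submodule.mem_sup.1 hχ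
    exact Submodule.mem_sup.2 ⟨_, ⟨_, E.act_mem g φ hφ, rfl⟩, _, ⟨_, F.act_mem g ψ hψ, rfl⟩,
      by ext <;> simp⟩

theorem snd_mem_prod (E F : FunctionalModule A) (ψ : F →ₗ[ℂ] A) (hψ : ψ ∈ F.functionals) :
    (show E.prod F →ₗ[ℂ] A from ψ ∘ₗ LinearMap.snd ℂ E F) ∈ (E.prod F).functionals := by
  have h : ψ ∘ₗ LinearMap.snd ℂ E F ∈
      E.functionals.map (LinearMap.lcomp ℂ A (LinearMap.fst ℂ E F)) ⊔
        F.functionals.map (LinearMap.lcomp ℂ A (LinearMap.snd ℂ E F)) :=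
    Submodule.mem_sup_right ⟨ψ, hψ, rfl⟩
  exact h

/-- The direct sum of an arbitrary family of functional modules; its functionals are the finite
sums of functionals on the summands. -/
noncomputable def directSum {I : Type u} (E : I → FunctionalModule A) : FunctionalModule A where
  carrier := Π₀ i, E i
  rmul := LinearMap.mk₂ ℂ
    (fun ξ a => DFinsupp.mapRange.linearMap (fun i => (E i).rmul.flip a) ξ)
    (fun _ _ _ => map_add _ _ _) (fun _ _ _ => map_smul _ _ _)
    (fun _ _ _ => by ext; simp) (fun _ _ _ => by ext; simp)
  rmul_mul ξ a b := by ext i; simp [(E i).rmul_mul]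
  act :=
    { toFun := fun g => DFinsupp.mapRange.linearMap (fun i => (E i).act g)
      map_one' := by ext1 ξ; ext i; simp
      map_mul' := fun g h => by ext1 ξ; ext i; simp }
  act_rmul g ξ a := by ext i; simp [(E i).act_rmul]
  functionals := ⨆ i, (E i).functionals.map (LinearMap.lcomp ℂ A (DFinsupp.lapply i))
  functional_rmul φ hφ ξ a := by
    induction hφ using Submodule.iSup_induction' with
    | zero => simp
    | add _ _ _ _ h₁ h₂ => simp only [LinearMap.add_apply, h₁, h₂, add_mul]
    | mem i φ hφ =>
      obtain ⟨φ, hφ, rfl⟩ := hφ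
      simp [(E i).functional_rmul φ hφ]
  lmul_mem a φ hφ := by
    induction hφ using Submodule.iSup_induction' with
    | zero => simp
    | add _ _ _ _ h₁ h₂ => rw [LinearMap.comp_add]; exact Submodule.add_mem _ h₁ h₂
    | mem i φ hφ =>
      obtain ⟨φ, hφ, rfl⟩ := hφ
      exact Submodule.mem_iSup_of_mem i ⟨_, (E i).lmul_mem a φ hφ, by ext; simp⟩
  act_mem g φ hφ := by
    induction hφ using Submodule.iSup_induction' with
    | zero => simp
    | add _ _ _ _ h₁ h₂ =>
      rw [LinearMap.add_comp, LinearMap.comp_add]; exact Submodule.add_mem _ h₁ h₂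
    | mem i φ hφ =>
      obtain ⟨φ, hφ, rfl⟩ := hφ
      exact Submodule.mem_iSup_of_mem i ⟨_, (E i).act_mem g φ hφ, by ext1 ξ; simp⟩

theorem map₂_mul {B : GAlgebra.{u, v} G} (E : FunctionalModule A) (F : FunctionalModule B)
    (ξ : E ⊗[ℂ] F) (a b : A ⊗[ℂ] B) :
    TensorProduct.map₂ E.rmul F.rmul ξ (a * b)
      = TensorProduct.map₂ E.rmul F.rmul (TensorProduct.map₂ E.rmul F.rmul ξ a) b := by
  induction ξ with
  | zero => simp
  | add x y hx hy => simp only [map_add, LinearMap.add_apply, hx, hy]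
  | tmul x y =>
    induction a with
    | zero => simp
    | add a a' h h' => simp only [add_mul, map_add, LinearMap.add_apply, h, h']
    | tmul a a' =>
      induction b with
      | zero => simp
      | add b b' h h' => simp only [mul_add, map_add, h, h']
      | tmul b b' => simp [E.rmul_mul, F.rmul_mul]

theorem map_map₂ {B : GAlgebra.{u, v} G} (E : FunctionalModule A) (F : FunctionalModule B)
    (φ : E →ₗ[ℂ] A) (hφ : φ ∈ E.functionals) (ψ : F →ₗ[ℂ] B) (hψ : ψ ∈ F.functionals)
    (ξ : E ⊗[ℂ] F) (a : A ⊗[ℂ] B) :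
    TensorProduct.map φ ψ (TensorProduct.map₂ E.rmul F.rmul ξ a)
      = TensorProduct.map φ ψ ξ * a := by
  induction ξ with
  | zero => simp
  | add x y hx hy => simp only [map_add, LinearMap.add_apply, add_mul, hx, hy]
  | tmul x y =>
    induction a with
    | zero => simp
    | add a a' h h' => simp only [mul_add, map_add, h, h']
    | tmul a a' => simp [E.functional_rmul φ hφ, F.functional_rmul ψ hψ]

theorem act_map₂ {B : GAlgebra.{u, v} G} (E : FunctionalModule A) (F : FunctionalModule B)
    (g : G) (ξ : E ⊗[ℂ] F) (a : A ⊗[ℂ] B) :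
    TensorProduct.map (E.act g) (F.act g) (TensorProduct.map₂ E.rmul F.rmul ξ a)
      = TensorProduct.map₂ E.rmul F.rmul (TensorProduct.map (E.act g) (F.act g) ξ)
        (TensorProduct.map (A.act g) (B.act g) a) := by
  induction ξ with
  | zero => simp
  | add x y hx hy => simp only [map_add, LinearMap.add_apply, hx, hy]
  | tmul x y =>
    induction a with
    | zero => simp
    | add a a' h h' => simp only [map_add, h, h']
    | tmul a a' => simp [E.act_rmul, F.act_rmul]

/-- The external tensor product `E ⊗ F`, a functional module over `A ⊗ B`, with functional space
spanned by the `φ ⊗ ψ`. -/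
noncomputable def tensor {B : GAlgebra.{u, v} G} (E : FunctionalModule A)
    (F : FunctionalModule B) : FunctionalModule (A.tensor B) where
  carrier := E ⊗[ℂ] F
  rmul := TensorProduct.map₂ E.rmul F.rmul
  rmul_mul := map₂_mul E F
  act := E.act.tprod F.act
  act_rmul := act_map₂ E F
  functionals := Submodule.span ℂ
    {χ | ∃ φ ∈ E.functionals, ∃ ψ ∈ F.functionals, χ = TensorProduct.map φ ψ}
  functional_rmul χ hχ ξ a := by
    induction hχ using Submodule.span_induction with
    | zero => simp
    | add _ _ _ _ h₁ h₂ => simp only [LinearMap.add_apply, h₁, h₂, add_mul]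
    | smul c _ _ h => simp only [LinearMap.smul_apply, h, smul_mul_assoc]
    | mem _ h =>
      obtain ⟨φ, hφ, ψ, hψ, rfl⟩ := h
      exact map_map₂ E F φ hφ ψ hψ ξ a
  lmul_mem a χ hχ := by
    change A ⊗[ℂ] B at a
    induction hχ using Submodule.span_induction with
    | zero => simp
    | add _ _ _ _ h₁ h₂ => rw [LinearMap.comp_add]; exact Submodule.add_mem _ h₁ h₂
    | smul c _ _ h => rw [LinearMap.comp_smul]; exact Submodule.smul_mem _ c h
    | mem _ h =>
      obtain ⟨φ, hφ, ψ, hψ, rfl⟩ := h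
      change LinearMap.mul ℂ (A ⊗[ℂ] B) a ∘ₗ TensorProduct.map φ ψ ∈ _
      induction a with
      | zero =>
        rw [map_zero, LinearMap.zero_comp]
        exact Submodule.zero_mem _
      | add a b h h' =>
        rw [map_add, LinearMap.add_comp]
        exact Submodule.add_mem _ h h'
      | tmul a b =>
        refine Submodule.subset_span ⟨_, E.lmul_mem a φ hφ, _, F.lmul_mem b ψ hψ, ?_⟩
        exact TensorProduct.ext' fun x y => Algebra.TensorProduct.tmul_mul_tmul _ _ _ _
  act_mem g χ hχ := by
    induction hχ using Submodule.span_induction with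
    | zero => simp
    | add _ _ _ _ h₁ h₂ =>
      rw [LinearMap.add_comp, LinearMap.comp_add]; exact Submodule.add_mem _ h₁ h₂
    | smul c _ _ h =>
      rw [LinearMap.smul_comp, LinearMap.comp_smul]; exact Submodule.smul_mem _ c h
    | mem _ h =>
      obtain ⟨φ, hφ, ψ, hψ, rfl⟩ := h
      exact Submodule.subset_span ⟨_, E.act_mem g φ hφ, _, F.act_mem g ψ hψ,
        TensorProduct.ext' fun x y => rfl⟩

/-- The kernel of `E ⊗ B → E ⊗_π B`. -/
def changeRel {B : GAlgebra.{u, v} G} (π : A.Hom B) (E : FunctionalModule A) :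
    Submodule ℂ (E ⊗[ℂ] B) :=
  Submodule.span ℂ {x | ∃ ξ a b, x = E.rmul ξ a ⊗ₜ[ℂ] b - ξ ⊗ₜ[ℂ] (π.toFun a * b)}

theorem lTensor_mem_changeRel {B : GAlgebra.{u, v} G} (π : A.Hom B) (E : FunctionalModule A)
    (c : B) : changeRel π E ≤ (changeRel π E).comap (LinearMap.lTensor E (LinearMap.mulRight ℂ c)) := by
  refine Submodule.span_le.2 ?_
  rintro _ ⟨ξ, a, b, rfl⟩
  exact Submodule.subset_span ⟨ξ, a, b * c, by simp [mul_assoc]⟩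

theorem act_mem_changeRel {B : GAlgebra.{u, v} G} (π : A.Hom B) (E : FunctionalModule A)
    (g : G) : changeRel π E ≤ (changeRel π E).comap (TensorProduct.map (E.act g) (B.act g)) := by
  refine Submodule.span_le.2 ?_
  rintro _ ⟨ξ, a, b, rfl⟩
  exact Submodule.subset_span ⟨E.act g ξ, A.act g a, B.act g b,
    by simp [E.act_rmul, B.act_mul, π.map_act]⟩

/-- The right multiplication `(ξ ⊗ b) c = ξ ⊗ b c` on `E ⊗_π B`. -/
noncomputable def changeMul {B : GAlgebra.{u, v} G} (π : A.Hom B) (E : FunctionalModule A) :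
    (E ⊗[ℂ] B) ⧸ changeRel π E →ₗ[ℂ] B →ₗ[ℂ] (E ⊗[ℂ] B) ⧸ changeRel π E :=
  LinearMap.mk₂ ℂ
    (fun x c => (changeRel π E).mapQ _ (LinearMap.lTensor E (LinearMap.mulRight ℂ c))
      (lTensor_mem_changeRel π E c) x)
    (fun _ _ _ => map_add _ _ _) (fun _ _ _ => map_smul _ _ _)
    (fun x c d => by
      obtain ⟨x, rfl⟩ := Submodule.Quotient.mk_surjective _ x
      induction x with
      | zero => simp
      | add x y hx hy =>
        simp only [Submodule.Quotient.mk_add, map_add, hx, hy]; abel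
      | tmul ξ b =>
        simp [mul_add, TensorProduct.tmul_add])
    (fun t x c => by
      obtain ⟨x, rfl⟩ := Submodule.Quotient.mk_surjective _ x
      induction x with
      | zero => simp
      | add x y hx hy => simp only [Submodule.Quotient.mk_add, map_add, hx, hy, smul_add]
      | tmul ξ b => simp [mul_smul_comm])

/-- The class of `ξ ⊗ b` in `E ⊗_π B`. -/
def changeMk {B : GAlgebra.{u, v} G} (π : A.Hom B) (E : FunctionalModule A) (ξ : E) (b : B) :
    (E ⊗[ℂ] B) ⧸ changeRel π E :=
  (changeRel π E).mkQ (ξ ⊗ₜ[ℂ] b)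

theorem changeMul_mk {B : GAlgebra.{u, v} G} (π : A.Hom B) (E : FunctionalModule A) (ξ : E)
    (b c : B) : changeMul π E (changeMk π E ξ b) c = changeMk π E ξ (b * c) := by
  simp [changeMul, changeMk]

theorem change_induction {B : GAlgebra.{u, v} G} {π : A.Hom B} {E : FunctionalModule A}
    {p : (E ⊗[ℂ] B) ⧸ changeRel π E → Prop} (x : (E ⊗[ℂ] B) ⧸ changeRel π E) (h0 : p 0)
    (hadd : ∀ x y, p x → p y → p (x + y)) (hmk : ∀ ξ b, p (changeMk π E ξ b)) : p x := by
  obtain ⟨x, rfl⟩ := Submodule.Quotient.mk_surjective _ x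
  induction x with
  | zero => exact h0
  | add x y hx hy => exact hadd _ _ hx hy
  | tmul ξ b => exact hmk ξ b

/-- The functional `(φ ⊗ c)(ξ ⊗ b) = c π(φ(ξ)) b` on `E ⊗_π B`. -/
noncomputable def changeFunctional {B : GAlgebra.{u, v} G} (π : A.Hom B) (E : FunctionalModule A)
    (φ : E.functionals) (c : B) : (E ⊗[ℂ] B) ⧸ changeRel π E →ₗ[ℂ] B :=
  (changeRel π E).liftQ
    (TensorProduct.lift (LinearMap.mk₂ ℂ (fun ξ b => c * π.toFun (φ.1 ξ) * b)
      (fun _ _ _ => by simp [mul_add, add_mul]) (fun _ _ _ => by simp [mul_smul_comm, smul_mul_assoc])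
      (fun _ _ _ => mul_add _ _ _) (fun _ _ _ => mul_smul_comm _ _ _)))
    (by
      refine Submodule.span_le.2 ?_
      rintro _ ⟨ξ, a, b, rfl⟩
      simp [E.functional_rmul φ.1 φ.2, mul_assoc])

theorem changeFunctional_mk {B : GAlgebra.{u, v} G} (π : A.Hom B) (E : FunctionalModule A)
    (φ : E.functionals) (c : B) (ξ : E) (b : B) :
    changeFunctional π E φ c (changeMk π E ξ b) = c * π.toFun (φ.1 ξ) * b := by
  simp only [changeFunctional, changeMk, Submodule.mkQ_apply]
  rfl

/-- The `G`-action `S ⊗ β` on `E ⊗_π B`. -/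
noncomputable def changeAct {B : GAlgebra.{u, v} G} (π : A.Hom B) (E : FunctionalModule A) :
    Representation ℂ G ((E ⊗[ℂ] B) ⧸ changeRel π E) where
  toFun g := (changeRel π E).mapQ (changeRel π E) (TensorProduct.map (E.act g) (B.act g))
    (act_mem_changeRel π E g)
  map_one' := by
    refine LinearMap.ext fun x => ?_
    induction x using change_induction with
    | h0 => simp
    | hadd x y hx hy => rw [map_add, hx, hy, map_add]
    | hmk ξ b => simp [changeMk]
  map_mul' g h := by
    refine LinearMap.ext fun x => ?_
    induction x using change_induction with
    | h0 => simp
    | hadd x y hx hy => rw [map_add, hx, hy, map_add]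
    | hmk ξ b => simp [changeMk]

theorem changeAct_mk {B : GAlgebra.{u, v} G} (π : A.Hom B) (E : FunctionalModule A) (g : G) (ξ : E)
    (b : B) : changeAct π E g (changeMk π E ξ b) = changeMk π E (E.act g ξ) (B.act g b) := by
  simp [changeAct, changeMk]

/-- The change of coefficient algebra `E ⊗_π B`. -/
noncomputable def change {B : GAlgebra.{u, v} G} (π : A.Hom B) (E : FunctionalModule A) :
    FunctionalModule B where
  carrier := (E ⊗[ℂ] B) ⧸ changeRel π E
  rmul := changeMul π E
  rmul_mul x c d := by
    induction x using change_induction with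
    | h0 => simp
    | hadd x y hx hy => simp only [map_add, LinearMap.add_apply, hx, hy]
    | hmk ξ b => simp only [changeMul_mk, mul_assoc]
  act := changeAct π E
  act_rmul g x c := by
    induction x using change_induction with
    | h0 => simp
    | hadd x y hx hy => simp only [map_add, LinearMap.add_apply, hx, hy]
    | hmk ξ b => simp only [changeMul_mk, changeAct_mk, B.act_mul]
  functionals := Submodule.span ℂ {χ | ∃ φ c, χ = changeFunctional π E φ c}
  functional_rmul χ hχ x d := by
    induction hχ using Submodule.span_induction with
    | zero => simp
    | add _ _ _ _ h₁ h₂ => simp only [LinearMap.add_apply, h₁, h₂, add_mul]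
    | smul c _ _ h => simp only [LinearMap.smul_apply, h, smul_mul_assoc]
    | mem _ h =>
      obtain ⟨φ, c, rfl⟩ := h
      induction x using change_induction with
      | h0 => simp
      | hadd x y hx hy => simp only [map_add, LinearMap.add_apply, hx, hy, add_mul]
      | hmk ξ b => simp only [changeMul_mk, changeFunctional_mk, mul_assoc]
  lmul_mem d χ hχ := by
    induction hχ using Submodule.span_induction with
    | zero => simp
    | add _ _ _ _ h₁ h₂ => rw [LinearMap.comp_add]; exact Submodule.add_mem _ h₁ h₂
    | smul c _ _ h => rw [LinearMap.comp_smul]; exact Submodule.smul_mem _ c h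
    | mem _ h =>
      obtain ⟨φ, c, rfl⟩ := h
      refine Submodule.subset_span ⟨φ, d * c, LinearMap.ext fun x => ?_⟩
      induction x using change_induction with
      | h0 => simp
      | hadd x y hx hy => rw [map_add, hx, hy, map_add]
      | hmk ξ b => simp [changeFunctional_mk, mul_assoc]
  act_mem g χ hχ := by
    induction hχ using Submodule.span_induction with
    | zero => simp
    | add _ _ _ _ h₁ h₂ =>
      rw [LinearMap.add_comp, LinearMap.comp_add]; exact Submodule.add_mem _ h₁ h₂
    | smul c _ _ h =>
      rw [LinearMap.smul_comp, LinearMap.comp_smul]; exact Submodule.smul_mem _ c h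
    | mem _ h =>
      obtain ⟨φ, c, rfl⟩ := h
      refine Submodule.subset_span ⟨E.dualAct g φ, B.act g c, LinearMap.ext fun x => ?_⟩
      induction x using change_induction with
      | h0 => simp
      | hadd x y hx hy => rw [map_add, hx, hy, map_add]
      | hmk ξ b =>
        simp [changeFunctional_mk, changeAct_mk, dualAct, B.act_mul, π.map_act, mul_assoc]

/-! ### Corner modules -/

/-- The coordinate `ξ ⊕ b ↦ b` of `E ⊕ A`. -/
noncomputable def toAlg (E : FunctionalModule A) : E.prod (self A) →ₗ[ℂ] A := LinearMap.snd ℂ E A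

/-- The inclusion `b ↦ 0 ⊕ b` into `E ⊕ A`. -/
noncomputable def ofAlg (E : FunctionalModule A) : A →ₗ[ℂ] E.prod (self A) := LinearMap.inr ℂ E A

@[simp] theorem toAlg_ofAlg (E : FunctionalModule A) (a : A) : toAlg E (ofAlg E a) = a := rfl

theorem ofAlg_mul (E : FunctionalModule A) (a b : A) :
    ofAlg E (a * b) = (E.prod (self A)).rmul (ofAlg E a) b := by
  change ((0 : E), a * b) = (E.rmul 0 b, a * b)
  simp

theorem toAlg_rmul (E : FunctionalModule A) (x : E.prod (self A)) (a : A) :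
    toAlg E ((E.prod (self A)).rmul x a) = toAlg E x * a := rfl

theorem ofAlg_act (E : FunctionalModule A) (g : G) (a : A) :
    (E.prod (self A)).act g (ofAlg E a) = ofAlg E (A.act g a) := by
  change (E.act g (0 : E), A.act g a) = ((0 : E), A.act g a)
  simp

theorem toAlg_act (E : FunctionalModule A) (g : G) (x : E.prod (self A)) :
    toAlg E ((E.prod (self A)).act g x) = A.act g (toAlg E x) := rfl

/-- The operator `m_a (ξ ⊕ b) = 0 ⊕ a b` on `E ⊕ A`. -/
noncomputable def cornerOp (E : FunctionalModule A) (a : A) : Module.End ℂ (E.prod (self A)) :=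
  ofAlg E ∘ₗ LinearMap.mulLeft ℂ a ∘ₗ toAlg E

theorem cornerOp_apply (E : FunctionalModule A) (a : A) (x : E.prod (self A)) :
    cornerOp E a x = ofAlg E (a * toAlg E x) := rfl

theorem cornerOp_mem (hA : A.HasApproxUnit) (E : FunctionalModule A) (a : A) :
    cornerOp E a ∈ (E.prod (self A)).compactSubalgebra := by
  obtain ⟨e, ⟨-, he⟩, -⟩ := hA.exists_unit a a
  refine Submodule.subset_span ⟨ofAlg E a, LinearMap.mul ℂ A e ∘ₗ toAlg E, ?_, ?_⟩
  · have h : LinearMap.mul ℂ A e ∈ (self A).functionals := ⟨e, rfl⟩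
    exact snd_mem_prod E (self A) _ h
  · refine LinearMap.ext fun x => ?_
    rw [cornerOp_apply, theta, LinearMap.comp_apply, ← ofAlg_mul, LinearMap.comp_apply,
      LinearMap.mul_apply', ← mul_assoc, he]

/-- The corner embedding `a ↦ m_a` of `A` into `𝒦_A(E ⊕ A)`, with image `M_A`. -/
noncomputable def cornerEmb (hA : A.HasApproxUnit) (E : FunctionalModule A) :
    A →ₗ[ℂ] (E.prod (self A)).compact where
  toFun a := (⟨cornerOp E a, cornerOp_mem hA E a⟩ : (E.prod (self A)).compactSubalgebra)
  map_add' a b := Subtype.ext <| LinearMap.ext fun x => by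
    change ofAlg E ((a + b) * toAlg E x) = ofAlg E (a * toAlg E x) + ofAlg E (b * toAlg E x)
    rw [add_mul, map_add]
  map_smul' c a := Subtype.ext <| LinearMap.ext fun x => by
    change ofAlg E ((c • a) * toAlg E x) = c • ofAlg E (a * toAlg E x)
    rw [smul_mul_assoc, map_smul]

theorem cornerEmb_mul (hA : A.HasApproxUnit) (E : FunctionalModule A) (a b : A) :
    cornerEmb hA E (a * b) = cornerEmb hA E a * cornerEmb hA E b :=
  Subtype.ext <| LinearMap.ext fun x => by
    change ofAlg E ((a * b) * toAlg E x) = ofAlg E (a * toAlg E (ofAlg E (b * toAlg E x)))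
    rw [mul_assoc, toAlg_ofAlg]

theorem cornerEmb_act (hA : A.HasApproxUnit) (E : FunctionalModule A) (g : G) (a : A) :
    (E.prod (self A)).compact.act g (cornerEmb hA E a) = cornerEmb hA E (A.act g a) :=
  Subtype.ext <| LinearMap.ext fun x => by
    change (E.prod (self A)).act g (ofAlg E (a * toAlg E ((E.prod (self A)).act g⁻¹ x)))
      = ofAlg E (A.act g a * toAlg E x)
    rw [ofAlg_act, toAlg_act, A.act_mul, ← Module.End.mul_apply (A.act g) (A.act g⁻¹), ← map_mul]
    simp

theorem cornerEmb_injective (hA : A.HasApproxUnit) (E : FunctionalModule A) :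
    Function.Injective (cornerEmb hA E) := by
  refine (injective_iff_map_eq_zero _).2 fun a ha => ?_
  obtain ⟨e, ⟨-, he⟩, -⟩ := hA.exists_unit a a
  have h : toAlg E (cornerOp E a (ofAlg E e)) = 0 :=
    congrArg (fun T : (E.prod (self A)).compactSubalgebra => toAlg E (T.1 (ofAlg E e))) ha
  rwa [cornerOp_apply, toAlg_ofAlg, toAlg_ofAlg, he] at h

/-- `M_A 𝒦_A(E ⊕ A) M_A ⊆ M_A`. -/
theorem cornerEmb_mul_mul (hA : A.HasApproxUnit) (E : FunctionalModule A) (b c : A)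
    (k : (E.prod (self A)).compact) :
    cornerEmb hA E b * k * cornerEmb hA E c ∈ LinearMap.range (cornerEmb hA E) := by
  refine ⟨b * toAlg E (k.1 (ofAlg E c)), Subtype.ext <| LinearMap.ext fun x => ?_⟩
  change ofAlg E ((b * toAlg E (k.1 (ofAlg E c))) * toAlg E x)
    = ofAlg E (b * toAlg E (k.1 (ofAlg E (c * toAlg E x))))
  rw [ofAlg_mul E c, compact_rmul _ k.1 k.2, toAlg_rmul, mul_assoc]

/-- The subspace `F · M_A` of a `𝒦_A(E ⊕ A)`-module `F`. -/
noncomputable def cornerCarrier (hA : A.HasApproxUnit) (E : FunctionalModule A)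
    (F : FunctionalModule (E.prod (self A)).compact) : Submodule ℂ F :=
  Submodule.span ℂ {x | ∃ ξ a, x = F.rmul ξ (cornerEmb hA E a)}

theorem rmul_mem_corner (hA : A.HasApproxUnit) (E : FunctionalModule A)
    (F : FunctionalModule (E.prod (self A)).compact) (ξ : F) (a : A) :
    F.rmul ξ (cornerEmb hA E a) ∈ cornerCarrier hA E F :=
  Submodule.subset_span ⟨ξ, a, rfl⟩

theorem act_mem_corner (hA : A.HasApproxUnit) (E : FunctionalModule A)
    (F : FunctionalModule (E.prod (self A)).compact) (g : G) (x : F)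
    (hx : x ∈ cornerCarrier hA E F) : F.act g x ∈ cornerCarrier hA E F := by
  induction hx using Submodule.span_induction with
  | zero => simp
  | add _ _ _ _ h₁ h₂ => rw [map_add]; exact Submodule.add_mem _ h₁ h₂
  | smul c _ _ h => rw [map_smul]; exact Submodule.smul_mem _ c h
  | mem _ h =>
    obtain ⟨ξ, a, rfl⟩ := h
    rw [F.act_rmul, cornerEmb_act]
    exact rmul_mem_corner hA E F _ _

theorem mul_functional_mem (hA : A.HasApproxUnit) (E : FunctionalModule A)
    (F : FunctionalModule (E.prod (self A)).compact) (b : A) (φ : F.functionals)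
    (x : cornerCarrier hA E F) :
    cornerEmb hA E b * φ.1 x.1 ∈ LinearMap.range (cornerEmb hA E) := by
  obtain ⟨x, hx⟩ := x
  induction hx using Submodule.span_induction with
  | zero => simp
  | add _ _ _ _ h₁ h₂ =>
    simp only [map_add, mul_add]
    exact Submodule.add_mem _ h₁ h₂
  | smul c _ _ h =>
    simp only [map_smul, mul_smul_comm]
    exact Submodule.smul_mem _ c h
  | mem _ h =>
    obtain ⟨ξ, a, rfl⟩ := h
    rw [F.functional_rmul φ.1 φ.2, ← mul_assoc]
    exact cornerEmb_mul_mul hA E b a _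

/-- The functional `m_b φ` restricted to `F · M_A`, with values in `M_A ≅ A`. -/
noncomputable def cornerFunctional (hA : A.HasApproxUnit) (E : FunctionalModule A)
    (F : FunctionalModule (E.prod (self A)).compact) (b : A) (φ : F.functionals) :
    cornerCarrier hA E F →ₗ[ℂ] A :=
  (LinearEquiv.ofInjective (cornerEmb hA E) (cornerEmb_injective hA E)).symm.toLinearMap ∘ₗ
    LinearMap.codRestrict (LinearMap.range (cornerEmb hA E))
      (LinearMap.mulLeft ℂ (cornerEmb hA E b) ∘ₗ φ.1 ∘ₗ (cornerCarrier hA E F).subtype)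
      (mul_functional_mem hA E F b φ)

theorem cornerFunctional_spec (hA : A.HasApproxUnit) (E : FunctionalModule A)
    (F : FunctionalModule (E.prod (self A)).compact) (b : A) (φ : F.functionals)
    (x : cornerCarrier hA E F) :
    cornerEmb hA E (cornerFunctional hA E F b φ x) = cornerEmb hA E b * φ.1 x.1 := by
  have h := LinearEquiv.apply_symm_apply
    (LinearEquiv.ofInjective (cornerEmb hA E) (cornerEmb_injective hA E))
    ⟨cornerEmb hA E b * φ.1 x.1, mul_functional_mem hA E F b φ x⟩
  exact congrArg Subtype.val h

/-- The corner module `F · M_A`, a functional `A`-module via `A ≅ M_A ⊆ 𝒦_A(E ⊕ A)`, with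
functional space spanned by the `m_b φ`. -/
noncomputable def corner (hA : A.HasApproxUnit) (E : FunctionalModule A)
    (F : FunctionalModule (E.prod (self A)).compact) : FunctionalModule A where
  carrier := cornerCarrier hA E F
  rmul := LinearMap.mk₂ ℂ
    (fun x a => ⟨F.rmul x.1 (cornerEmb hA E a), rmul_mem_corner hA E F x.1 a⟩)
    (fun _ _ _ => Subtype.ext (by simp)) (fun _ _ _ => Subtype.ext (by simp))
    (fun _ _ _ => Subtype.ext (by simp)) (fun _ _ _ => Subtype.ext (by simp))
  rmul_mul x a b := Subtype.ext (by simp [cornerEmb_mul, F.rmul_mul])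
  act :=
    { toFun := fun g => (F.act g).restrict (act_mem_corner hA E F g)
      map_one' := LinearMap.ext fun x => Subtype.ext (by simp)
      map_mul' := fun g h => LinearMap.ext fun x => Subtype.ext (by simp) }
  act_rmul g x a := Subtype.ext (by simp [F.act_rmul, cornerEmb_act])
  functionals := Submodule.span ℂ {χ | ∃ b φ, χ = cornerFunctional hA E F b φ}
  functional_rmul χ hχ x a := by
    induction hχ using Submodule.span_induction with
    | zero => simp
    | add _ _ _ _ h₁ h₂ => simp only [LinearMap.add_apply, h₁, h₂, add_mul]
    | smul c _ _ h => simp only [LinearMap.smul_apply, h, smul_mul_assoc]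
    | mem _ h =>
      obtain ⟨b, φ, rfl⟩ := h
      apply cornerEmb_injective hA E
      rw [cornerEmb_mul, cornerFunctional_spec, cornerFunctional_spec, mul_assoc,
        ← F.functional_rmul φ.1 φ.2]
      rfl
  lmul_mem a χ hχ := by
    induction hχ using Submodule.span_induction with
    | zero => simp
    | add _ _ _ _ h₁ h₂ => rw [LinearMap.comp_add]; exact Submodule.add_mem _ h₁ h₂
    | smul c _ _ h => rw [LinearMap.comp_smul]; exact Submodule.smul_mem _ c h
    | mem _ h =>
      obtain ⟨b, φ, rfl⟩ := h
      refine Submodule.subset_span ⟨a * b, φ, LinearMap.ext fun x => ?_⟩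
      apply cornerEmb_injective hA E
      rw [cornerFunctional_spec, LinearMap.comp_apply, LinearMap.mulLeft_apply, cornerEmb_mul,
        cornerFunctional_spec, cornerEmb_mul, mul_assoc]
  act_mem g χ hχ := by
    induction hχ using Submodule.span_induction with
    | zero => simp
    | add _ _ _ _ h₁ h₂ =>
      rw [LinearMap.add_comp, LinearMap.comp_add]; exact Submodule.add_mem _ h₁ h₂
    | smul c _ _ h =>
      rw [LinearMap.smul_comp, LinearMap.comp_smul]; exact Submodule.smul_mem _ c h
    | mem _ h =>
      obtain ⟨b, φ, rfl⟩ := h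
      refine Submodule.subset_span ⟨A.act g b, F.dualAct g φ, LinearMap.ext fun x => ?_⟩
      apply cornerEmb_injective hA E
      rw [cornerFunctional_spec, LinearMap.comp_apply, ← cornerEmb_act, LinearMap.comp_apply,
        cornerFunctional_spec, GAlgebra.act_mul, cornerEmb_act]
      rfl

/-! ### The class `C` -/

/-- The class `C`: the cofull functional modules with cofull functional space, over algebras with
approximate unit, such that `𝒦_A(E)` has an approximate unit and `E` has a functional extension
into some `A^n = (A ⊗ ℂ^n, α ⊗ μ)`. -/
structure InClassC (E : FunctionalModule A) : Prop where
  approxUnit : A.HasApproxUnit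
  cofull : E.Cofull
  dualCofull : E.DualCofull
  compact_approxUnit : E.compact.HasApproxUnit
  exists_extension : ∃ (n : Type u) (μ : Representation ℂ G (n →₀ ℂ)) (hμ : RowFinite μ)
    (U : Hom E (plain A n μ hμ)), U.IsExtension

end FunctionalModule

/-! Membership in `C` splits into two separate problems.

The first is algebraic. Cofullness of `E`, cofullness of its functionals and the approximate unit of
`𝒦_A(E)` are together equivalent to one condition, `LocallyUnital`: each vector satisfies Tξ = ξ,
and each functional φ ∘ T = φ, for some compact T. One direction rests on ξ φ(η) = θ_{ξ,φ}(η) and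
φ(ξ) τ = φ ∘ θ_{ξ,τ} (`InClassC.locallyUnital`). For the other, a compact operator applied to a
vector or a functional yields exactly the sums required, and T θ_{η,φ} = θ_{Tη,φ}, θ_{η,φ} T =
θ_{η,φ∘T}. Because 1 − (S + T − TS) = (1 − T)(1 − S), units for single elements combine into units
for finite sets (`exists_forall_mem_fixed`). Hence only generators have to be fixed, and in each
construction this is done by transporting compact operators of the given modules, inserting local
units of the coefficient algebra where an identity is missing.

The second is the functional extension. Over an algebra with approximate unit a row is determined by
its coefficients, so an extension is a coordinate map E → A^n together with a coefficient map on
functionals (`RowExtension`). The approximation property does most of the work: it shows finitely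
many rows any vector of A^n through one vector of E, so every linear relation between functionals on
E persists between their rows. It therefore suffices to prescribe rows for a spanning family of
functionals and to approximate vectors with one nonzero coordinate
(`RowExtension.exists_of_family`). Left A-linearity of the dual map follows from approximation, and
injectivity from local units.

The extensions are as follows. A plain module uses the identity. For finite G, the orbit map ξ ↦ ∑_h
(α_h ⊗ 1) S_{h⁻¹} ξ ⊗ δ_h lands in a plain module with G translating the new index; averaging gives
an equivariant left inverse R, and U^*(φ) = φ ∘ R. Direct sums use block sums, change of
coefficients applies π to coordinates, external tensor products use tensor products of coordinates.
For the corner, an extension of F into 𝒦^n sends F · M_A into (𝒦 M_A)^n, and 𝒦 M_A lies in a copy of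
E ⊕ A inside 𝒦 (`linkEmb`). Following it coordinatewise by an extension of E ⊕ A into A^m gives one
into A^{n × m}. The local units of F · M_A come from the factorisation of elementary operators of 𝒦
through M_A (`theta_eq_linkEmb_mul`). -/

/-! ### Local units -/

/-- If every element of `M` is fixed by some member of a family of additive endomorphisms which is
closed under `(S, T) ↦ S + T - T S`, then finitely many elements have a common fixing member. -/
theorem exists_forall_mem_fixed {ι M : Type*} [AddCommGroup M] (ρ : ι → M → M)
    (hsub : ∀ i x y, ρ i (x - y) = ρ i x - ρ i y)
    (hcomb : ∀ i j, ∃ k, ∀ x, ρ k x = ρ i x + ρ j x - ρ j (ρ i x))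
    (h : ∀ x, ∃ i, ρ i x = x) (s : Finset M) : ∃ i, ∀ x ∈ s, ρ i x = x := by
  classical
  induction s using Finset.induction_on with
  | empty => exact ⟨(h 0).choose, by simp⟩
  | insert b s hb ih =>
    obtain ⟨i, hi⟩ := ih
    -- It is the defect b − ρ_i b that is to be fixed, not b: since 1 − ρ_k = (1 − ρ_j)(1 − ρ_i),
    -- the combination kills the defect of b and still fixes everything fixed by ρ_i.
    obtain ⟨j, hj⟩ := h (b - ρ i b)
    obtain ⟨k, hk⟩ := hcomb i j
    refine ⟨k, fun x hx => ?_⟩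
    rw [hsub] at hj
    rcases Finset.mem_insert.1 hx with rfl | hx
    · rw [hk, add_sub_assoc, hj]; abel
    · rw [hk, hi x hx]; abel

/-- Common fixing members for finite subsets of a spanning set yield fixing members for all
elements. -/
theorem exists_fixed_of_span {ι M : Type*} [AddCommGroup M] [Module ℂ M] (ρ : ι → M →ₗ[ℂ] M)
    {X : Set M} (h : ∀ s : Finset M, ↑s ⊆ X → ∃ i, ∀ x ∈ s, ρ i x = x) {x : M}
    (hx : x ∈ Submodule.span ℂ X) : ∃ i, ρ i x = x := by
  obtain ⟨s, hs, hx'⟩ := Submodule.mem_span_finite_of_mem_span hx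
  obtain ⟨i, hi⟩ := h s hs
  refine ⟨i, ?_⟩
  clear * - hi hx'
  induction hx' using Submodule.span_induction with
  | zero => simp
  | add x y _ _ h₁ h₂ => rw [map_add, h₁, h₂]
  | smul c x _ h => rw [map_smul, h]
  | mem x h => exact hi x h

namespace GAlgebra

variable {G : Type v} [Group G] {A : GAlgebra.{u, v} G}

theorem exists_left_unit_finset (h : ∀ a : A, ∃ e : A, e * a = a) (s : Finset A) :
    ∃ e : A, ∀ a ∈ s, e * a = a :=
  exists_forall_mem_fixed (fun e a : A => e * a) (fun _ _ _ => mul_sub _ _ _)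
    (fun e f => ⟨e + f - f * e, fun x => by rw [sub_mul, add_mul, mul_assoc]⟩) h s

theorem exists_right_unit_finset (h : ∀ a : A, ∃ e : A, a * e = a) (s : Finset A) :
    ∃ e : A, ∀ a ∈ s, a * e = a :=
  exists_forall_mem_fixed (fun e a : A => a * e) (fun _ _ _ => sub_mul _ _ _)
    (fun e f => ⟨e + f - e * f, fun x => by rw [mul_sub, mul_add, mul_assoc]⟩) h s

/-- One-sided local units for single elements already give an approximate unit. -/
theorem HasApproxUnit.of_local (hl : ∀ a : A, ∃ e : A, e * a = a)
    (hr : ∀ a : A, ∃ e : A, a * e = a) : A.HasApproxUnit := by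
  classical
  have h : ∀ s : Finset A, ∃ e : A, ∀ a ∈ s, e * a = a ∧ a * e = a := by
    intro s
    obtain ⟨e, he⟩ := exists_left_unit_finset hl s
    obtain ⟨f, hf⟩ := exists_right_unit_finset hr s
    -- With e a left and f a right unit, the order f e matters: (f e) a = f a cancels on the left,
    -- and a (f e) = a e cancels on the right.
    refine ⟨e + f - f * e, fun a ha => ⟨?_, ?_⟩⟩
    · rw [sub_mul, add_mul, mul_assoc, he a ha]; abel
    · rw [mul_sub, mul_add, ← mul_assoc, hf a ha]; abel
  choose x hx using h
  -- The net is indexed by the finite subsets of A ordered by inclusion; a is fixed from {a}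
  -- onwards.
  exact ⟨Finset A, inferInstance, inferInstance, inferInstance, x, fun a =>
    ⟨{a}, fun s hs => hx s a (hs (Finset.mem_singleton_self a))⟩⟩

theorem HasApproxUnit.exists_unit_finset (h : A.HasApproxUnit) (s : Finset A) :
    ∃ e : A, ∀ a ∈ s, e * a = a ∧ a * e = a := by
  classical
  obtain ⟨I, _, _, _, x, hx⟩ := h
  choose j hj using hx
  obtain ⟨M, hM⟩ := (s.image j).exists_le
  exact ⟨x M, fun a ha => hj a M (hM _ (Finset.mem_image_of_mem _ ha))⟩

end GAlgebra

/-! ### Compact operators as local units for vectors and functionals. -/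

namespace FunctionalModule

variable {G : Type v} [Group G] {A : GAlgebra.{u, v} G}

theorem theta_apply (E : FunctionalModule A) (η : E) (φ : E →ₗ[ℂ] A) (ξ : E) :
    E.theta η φ ξ = E.rmul η (φ ξ) := rfl

theorem theta_mem_compact (E : FunctionalModule A) (η : E) (φ : E →ₗ[ℂ] A)
    (hφ : φ ∈ E.functionals) : E.theta η φ ∈ E.compactSubalgebra :=
  Submodule.subset_span ⟨η, φ, hφ, rfl⟩

/-- Scalars need no case of their own, because c θ_{η,φ} = θ_{cη,φ}. -/
theorem compact_induction {E : FunctionalModule A}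
    {p : ∀ T : Module.End ℂ E, T ∈ E.compactSubalgebra → Prop} (h0 : p 0 (zero_mem _))
    (hadd : ∀ S T hS hT, p S hS → p T hT → p (S + T) (add_mem hS hT))
    (htheta : ∀ η φ hφ, p (E.theta η φ) (E.theta_mem_compact η φ hφ))
    {T : Module.End ℂ E} (hT : T ∈ E.compactSubalgebra) : p T hT := by
  suffices H : ∃ h, p T h from H.2
  change T ∈ Submodule.span ℂ _ at hT
  induction hT using Submodule.closure_induction with
  | zero => exact ⟨_, h0⟩
  | add _ _ _ _ h₁ h₂ => exact ⟨_, hadd _ _ _ _ h₁.2 h₂.2⟩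
  | smul_mem c T h =>
    obtain ⟨η, φ, hφ, rfl⟩ := h
    have : c • E.theta η φ = E.theta (c • η) φ := by ext; simp [theta]
    rw [this]
    exact ⟨_, htheta _ _ hφ⟩

/-- φ ∘ θ_{η,ψ} = φ(η) ψ, so the functional space is a right module over the compact operators. -/
theorem functional_comp_compact (E : FunctionalModule A) {φ : E →ₗ[ℂ] A} (hφ : φ ∈ E.functionals)
    {T : Module.End ℂ E} (hT : T ∈ E.compactSubalgebra) : φ ∘ₗ T ∈ E.functionals := by
  induction hT using compact_induction with
  | h0 => rw [LinearMap.comp_zero]; exact Submodule.zero_mem _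
  | hadd S T _ _ hS hT => rw [LinearMap.comp_add]; exact Submodule.add_mem _ hS hT
  | htheta η ψ hψ =>
    have : φ ∘ₗ E.theta η ψ = LinearMap.mulLeft ℂ (φ η) ∘ₗ ψ := by
      ext ξ
      simp [theta, E.functional_rmul φ hφ]
    rw [this]
    exact E.lmul_mem _ _ hψ

theorem theta_comp_compact (E : FunctionalModule A) {T : Module.End ℂ E}
    (hT : T ∈ E.compactSubalgebra) (η : E) (φ : E →ₗ[ℂ] A) :
    T * E.theta η φ = E.theta (T η) φ := by
  ext ξ
  simp [theta, E.compact_rmul T hT]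

/-- Every vector and every functional is fixed by a compact operator. -/
structure LocallyUnital (E : FunctionalModule A) : Prop where
  left : ∀ ξ : E, ∃ T ∈ E.compactSubalgebra, T ξ = ξ
  right : ∀ φ ∈ E.functionals, ∃ T ∈ E.compactSubalgebra, φ ∘ₗ T = φ

/-- It suffices to fix finite families of generators. -/
theorem LocallyUnital.of_span {E : FunctionalModule A} {X : Set E} {Y : Set (E →ₗ[ℂ] A)}
    (hX : ∀ ξ, ξ ∈ Submodule.span ℂ X) (hY : E.functionals ≤ Submodule.span ℂ Y)
    (left : ∀ s : Finset E, ↑s ⊆ X → ∃ T ∈ E.compactSubalgebra, ∀ ξ ∈ s, T ξ = ξ)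
    (right : ∀ s : Finset (E →ₗ[ℂ] A), ↑s ⊆ Y →
      ∃ T ∈ E.compactSubalgebra, ∀ φ ∈ s, φ ∘ₗ T = φ) : E.LocallyUnital where
  left ξ := by
    obtain ⟨T, hT⟩ := exists_fixed_of_span (fun T : E.compactSubalgebra => T.1)
      (fun s hs => by simpa using left s hs) (hX ξ)
    exact ⟨T.1, T.2, hT⟩
  right φ hφ := by
    obtain ⟨T, hT⟩ := exists_fixed_of_span
      (fun T : E.compactSubalgebra => LinearMap.lcomp ℂ A T.1)
      (fun s hs => by
        obtain ⟨T, hT, h⟩ := right s hs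
        exact ⟨⟨T, hT⟩, h⟩) (hY hφ)
    exact ⟨T.1, T.2, hT⟩

theorem LocallyUnital.exists_left_finset {E : FunctionalModule A} (h : E.LocallyUnital)
    (s : Finset E) : ∃ T ∈ E.compactSubalgebra, ∀ ξ ∈ s, T ξ = ξ := by
  obtain ⟨T, hT⟩ := exists_forall_mem_fixed (fun (T : E.compactSubalgebra) (ξ : E) => T.1 ξ)
    (fun T ξ η => map_sub T.1 ξ η) (fun S T => ⟨S + T - T * S, fun _ => rfl⟩)
    (fun ξ => by simpa using h.left ξ) s
  exact ⟨T.1, T.2, hT⟩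

/-- Compact operators act on functionals from the right, so the combining operator is S + T − ST
instead of the S + T − TS used for vectors. -/
theorem LocallyUnital.exists_right_finset {E : FunctionalModule A} (h : E.LocallyUnital)
    (s : Finset E.functionals) : ∃ T ∈ E.compactSubalgebra, ∀ φ ∈ s, φ.1 ∘ₗ T = φ.1 := by
  obtain ⟨T, hT⟩ := exists_forall_mem_fixed
    (fun (T : E.compactSubalgebra) (φ : E.functionals) =>
      (⟨φ.1 ∘ₗ T.1, E.functional_comp_compact φ.2 T.2⟩ : E.functionals))
    (fun T φ ψ => Subtype.ext (LinearMap.sub_comp _ _ _))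
    (fun S T => ⟨S + T - S * T, fun φ => Subtype.ext (by
      ext ξ
      change φ.1 (S.1 ξ + T.1 ξ - S.1 (T.1 ξ)) = φ.1 (S.1 ξ) + φ.1 (T.1 ξ) - φ.1 (S.1 (T.1 ξ))
      simp)⟩)
    (fun φ => by
      obtain ⟨T, hT, h⟩ := h.right φ.1 φ.2
      exact ⟨⟨T, hT⟩, Subtype.ext h⟩) s
  exact ⟨T.1, T.2, fun φ hφ => congrArg Subtype.val (hT φ hφ)⟩

theorem LocallyUnital.mem_closure {E : FunctionalModule A} {T : Module.End ℂ E}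
    (hT : T ∈ E.compactSubalgebra) (ζ : E) : T ζ ∈ AddSubmonoid.closure
      {x : E | ∃ ξ : E, ∃ φ : E.functionals, ∃ η : E, x = E.rmul ξ (φ.1 η)} := by
  induction hT using compact_induction with
  | h0 => exact AddSubmonoid.zero_mem _
  | hadd S T _ _ hS hT => exact AddSubmonoid.add_mem _ hS hT
  | htheta η φ hφ => exact AddSubmonoid.subset_closure ⟨η, ⟨φ, hφ⟩, ζ, rfl⟩

theorem LocallyUnital.cofull {E : FunctionalModule A} (h : E.LocallyUnital) : E.Cofull := by
  intro ζ
  obtain ⟨T, hT, hζ⟩ := h.left ζ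
  rw [← hζ]
  exact LocallyUnital.mem_closure hT ζ

/-- Write ψ = ψ ∘ T and expand T into elementary operators; ψ ∘ θ_{η,φ} = ψ(η) φ has the required
form. -/
theorem LocallyUnital.dualCofull {E : FunctionalModule A} (h : E.LocallyUnital) :
    E.DualCofull := by
  intro ψ
  obtain ⟨T, hT, hψ⟩ := h.right ψ.1 ψ.2
  have key : (⟨ψ.1 ∘ₗ T, E.functional_comp_compact ψ.2 hT⟩ : E.functionals) ∈
      AddSubmonoid.closure {x : E.functionals | ∃ φ : E.functionals, ∃ ξ : E,
        ∃ τ : E.functionals, x = E.lmul (φ.1 ξ) τ} := by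
    clear hψ
    suffices H : ∃ χ ∈ AddSubmonoid.closure {x : E.functionals | ∃ φ : E.functionals, ∃ ξ : E,
        ∃ τ : E.functionals, x = E.lmul (φ.1 ξ) τ}, χ.1 = ψ.1 ∘ₗ T by
      obtain ⟨χ, hχ, e⟩ := H
      rwa [show (⟨ψ.1 ∘ₗ T, E.functional_comp_compact ψ.2 hT⟩ : E.functionals) = χ from
        Subtype.ext e.symm]
    induction hT using compact_induction with
    | h0 => exact ⟨0, AddSubmonoid.zero_mem _, by simp⟩
    | hadd S T _ _ hS hT =>
      obtain ⟨χ, hχ, e⟩ := hS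
      obtain ⟨χ', hχ', e'⟩ := hT
      exact ⟨χ + χ', AddSubmonoid.add_mem _ hχ hχ', by simp [e, e', LinearMap.comp_add]⟩
    | htheta η φ hφ =>
      refine ⟨_, AddSubmonoid.subset_closure ⟨ψ, η, ⟨φ, hφ⟩, rfl⟩, ?_⟩
      ext ξ
      simp [lmul, theta, E.functional_rmul ψ.1 ψ.2]
  rwa [show (⟨ψ.1 ∘ₗ T, E.functional_comp_compact ψ.2 hT⟩ : E.functionals) = ψ from
    Subtype.ext hψ] at key

/-- T θ_{η,φ} = θ_{Tη,φ} and θ_{η,φ} T = θ_{η,φ∘T}: a compact operator S involves finitely many η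
and φ, and fixing these gives one-sided units for S. -/
theorem LocallyUnital.compact_approxUnit {E : FunctionalModule A} (h : E.LocallyUnital) :
    E.compact.HasApproxUnit := by
  classical
  refine GAlgebra.HasApproxUnit.of_local (A := E.compact) ?_ ?_
  · rintro ⟨S, hS⟩
    have : ∃ s : Finset E, ∀ T ∈ E.compactSubalgebra, (∀ ξ ∈ s, T ξ = ξ) → T * S = S := by
      induction hS using compact_induction with
      | h0 => exact ⟨∅, fun T _ _ => mul_zero T⟩
      | hadd S S' _ _ hS hS' =>
        obtain ⟨s, hs⟩ := hS
        obtain ⟨s', hs'⟩ := hS'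
        exact ⟨s ∪ s', fun T hT hfix => by
          rw [mul_add, hs T hT fun ξ hξ => hfix ξ (Finset.mem_union_left _ hξ),
            hs' T hT fun ξ hξ => hfix ξ (Finset.mem_union_right _ hξ)]⟩
      | htheta η φ hφ =>
        exact ⟨{η}, fun T hT hfix => by
          rw [E.theta_comp_compact hT, hfix η (Finset.mem_singleton_self η)]⟩
    obtain ⟨s, hs⟩ := this
    obtain ⟨T, hT, hfix⟩ := h.exists_left_finset s
    exact ⟨(⟨T, hT⟩ : E.compactSubalgebra), Subtype.ext (hs T hT hfix)⟩
  · rintro ⟨S, hS⟩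
    have : ∃ s : Finset E.functionals, ∀ T ∈ E.compactSubalgebra,
        (∀ φ ∈ s, φ.1 ∘ₗ T = φ.1) → S * T = S := by
      induction hS using compact_induction with
      | h0 => exact ⟨∅, fun T _ _ => zero_mul T⟩
      | hadd S S' _ _ hS hS' =>
        obtain ⟨s, hs⟩ := hS
        obtain ⟨s', hs'⟩ := hS'
        exact ⟨s ∪ s', fun T hT hfix => by
          rw [add_mul, hs T hT fun ξ hξ => hfix ξ (Finset.mem_union_left _ hξ),
            hs' T hT fun ξ hξ => hfix ξ (Finset.mem_union_right _ hξ)]⟩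
      | htheta η φ hφ =>
        exact ⟨{⟨φ, hφ⟩}, fun T hT hfix =>
          congrArg (E.rmul η ∘ₗ ·) (hfix ⟨φ, hφ⟩ (Finset.mem_singleton_self _))⟩
    obtain ⟨s, hs⟩ := this
    obtain ⟨T, hT, hfix⟩ := h.exists_right_finset s
    exact ⟨(⟨T, hT⟩ : E.compactSubalgebra), Subtype.ext (hs T hT hfix)⟩

/-- The approximate unit of the compact operators eventually absorbs θ_{ξ,φ} from both sides. By
cofullness vectors are sums of θ_{ξ,φ}(η), and by dual cofullness functionals are sums of φ ∘
θ_{ξ,τ}. -/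
theorem InClassC.locallyUnital {E : FunctionalModule A} (h : E.InClassC) : E.LocallyUnital := by
  obtain ⟨I, _, _, _, x, hx⟩ := h.compact_approxUnit
  constructor
  · intro ξ
    -- Being fixed eventually, as opposed to by one member, passes to sums.
    suffices H : ∃ j, ∀ i, j ≤ i → (x i).1 ξ = ξ by
      obtain ⟨j, hj⟩ := H
      exact ⟨_, (x j).2, hj j le_rfl⟩
    have hξ := h.cofull ξ
    induction hξ using AddSubmonoid.closure_induction with
    | zero => exact ⟨Classical.arbitrary I, fun _ _ => map_zero _⟩
    | add ξ η _ _ h₁ h₂ =>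
      obtain ⟨j, hj⟩ := h₁
      obtain ⟨k, hk⟩ := h₂
      obtain ⟨l, h1, h2⟩ := exists_ge_ge j k
      exact ⟨l, fun i hi => by rw [map_add, hj i (h1.trans hi), hk i (h2.trans hi)]⟩
    | mem ζ hζ =>
      obtain ⟨ξ, φ, η, rfl⟩ := hζ
      obtain ⟨j, hj⟩ := hx (⟨E.theta ξ φ.1, E.theta_mem_compact ξ φ.1 φ.2⟩ : E.compactSubalgebra)
      exact ⟨j, fun i hi => LinearMap.congr_fun (congrArg Subtype.val (hj i hi).1) η⟩
  · intro φ hφ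
    suffices H : ∃ j, ∀ i, j ≤ i → φ ∘ₗ (x i).1 = φ by
      obtain ⟨j, hj⟩ := H
      exact ⟨_, (x j).2, hj j le_rfl⟩
    suffices H : ∀ φ : E.functionals, ∃ j, ∀ i, j ≤ i → φ.1 ∘ₗ (x i).1 = φ.1 from H ⟨φ, hφ⟩
    intro φ
    have hφ' := h.dualCofull φ
    induction hφ' using AddSubmonoid.closure_induction with
    | zero => exact ⟨Classical.arbitrary I, fun _ _ => LinearMap.zero_comp _⟩
    | add ξ η _ _ h₁ h₂ =>
      obtain ⟨j, hj⟩ := h₁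
      obtain ⟨k, hk⟩ := h₂
      obtain ⟨l, h1, h2⟩ := exists_ge_ge j k
      refine ⟨l, fun i hi => ?_⟩
      change (ξ.1 + η.1) ∘ₗ _ = ξ.1 + η.1
      rw [LinearMap.add_comp, hj i (h1.trans hi), hk i (h2.trans hi)]
    | mem ζ hζ =>
      obtain ⟨φ, ξ, τ, rfl⟩ := hζ
      obtain ⟨j, hj⟩ := hx (⟨E.theta ξ τ.1, E.theta_mem_compact ξ τ.1 τ.2⟩ : E.compactSubalgebra)
      refine ⟨j, fun i hi => LinearMap.ext fun η => ?_⟩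
      have := congrArg φ.1 (LinearMap.congr_fun (congrArg Subtype.val (hj i hi).2) η)
      change φ.1 (E.rmul ξ (τ.1 ((x i).1 η))) = φ.1 (E.rmul ξ (τ.1 η)) at this
      rwa [E.functional_rmul φ.1 φ.2, E.functional_rmul φ.1 φ.2] at this

/-! ### Extensions into plain modules, in coordinates -/

theorem row_single_right (n : Type u) (b : n →₀ A) (i : n) (x : A) :
    row A n b (Finsupp.single i x) = b i * x := by
  classical
  induction b using Finsupp.induction_linear with
  | zero => simp
  | add b c hb hc => simp only [map_add, LinearMap.add_apply, hb, hc, Finsupp.add_apply, add_mul]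
  | single k c =>
    rw [row_single, Finsupp.single_apply, Finsupp.single_apply]
    by_cases h : k = i
    · simp [h]
    · simp [h, Ne.symm h]

theorem row_freeMul (n : Type u) (b ξ : n →₀ A) (a : A) :
    row A n b (freeMul A n ξ a) = row A n b ξ * a := by
  induction b using Finsupp.induction_linear with
  | zero => simp
  | add b c hb hc => simp only [map_add, LinearMap.add_apply, hb, hc, add_mul]
  | single i b => simp [row_single, mul_assoc]

theorem eq_of_mul_right_eq (hA : A.HasApproxUnit) {b c : A} (h : ∀ x : A, b * x = c * x) :
    b = c := by
  obtain ⟨e, hb, hc⟩ := hA.exists_unit b c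
  rw [← hb.2, h, hc.2]

/-- Evaluating at x in coordinate i gives b_i x, and a local unit x common to two coefficients
recovers them. -/
theorem row_injective (hA : A.HasApproxUnit) (n : Type u) : Function.Injective (row A n) := by
  intro b c h
  ext i
  refine eq_of_mul_right_eq hA fun x => ?_
  rw [← row_single_right, ← row_single_right, h]

/-- A functional extension of `E` into `(A ⊗ ℂ^n, α ⊗ μ)` in coordinates: the functional `φ` is
sent to the row `coeff φ`. Injectivity is not part of the data. -/
structure RowExtension (E : FunctionalModule A) (n : Type u)
    (μ : Representation ℂ G (n →₀ ℂ)) where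
  toFun : E →ₗ[ℂ] n →₀ A
  map_rmul : ∀ ξ a, toFun (E.rmul ξ a) = freeMul A n (toFun ξ) a
  map_act : ∀ g ξ, toFun (E.act g ξ) = tensorAct A μ g (toFun ξ)
  coeff : E.functionals →ₗ[ℂ] n →₀ A
  pairing : ∀ φ ξ, row A n (coeff φ) (toFun ξ) = φ.1 ξ
  coeff_act : ∀ g φ x,
    row A n (coeff (E.dualAct g φ)) x = A.act g (row A n (coeff φ) (tensorAct A μ g⁻¹ x))
  approx : ∀ (s : Finset E.functionals) (η : n →₀ A),
    ∃ ξ : E, ∀ φ ∈ s, row A n (coeff φ) η = φ.1 ξ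

/-- The coefficients of a row functional after the action of `g`. -/
theorem RowExtension.coeff_act_apply (hA : A.HasApproxUnit) {E : FunctionalModule A} {n : Type u}
    {μ : Representation ℂ G (n →₀ ℂ)} (U : RowExtension E n μ) (g : G) (φ : E.functionals)
    (j : n) : U.coeff (E.dualAct g φ) j
      = (U.coeff φ).sum fun i x => μ g⁻¹ (Finsupp.single j 1) i • A.act g x := by
  refine eq_of_mul_right_eq hA fun x => ?_
  rw [← row_single_right, U.coeff_act]
  generalize U.coeff φ = b
  have key : ∀ b : n →₀ A, A.act g (row A n b (tensorAct A μ g⁻¹ (Finsupp.single j x)))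
      = (b.sum fun i x => μ g⁻¹ (Finsupp.single j 1) i • A.act g x) * x := by
    intro b
    induction b using Finsupp.induction_linear with
    | zero => simp
    | add b c hb hc =>
      rw [Finsupp.sum_add_index' (by simp) (by simp), add_mul, ← hb, ← hc]
      simp
    | single i b =>
      rw [Finsupp.sum_single_index (by simp), row_single, tensorAct_single, A.act_mul, map_smul,
        ← Module.End.mul_apply, ← map_mul]
      simp [mul_smul_comm, smul_mul_assoc]
  exact key b

/-- If Uξ = 0, the pairing makes every functional vanish at ξ, so every compact operator kills ξ;
but one of them fixes it. -/
theorem RowExtension.injective {E : FunctionalModule A} {n : Type u}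
    {μ : Representation ℂ G (n →₀ ℂ)} (U : RowExtension E n μ) (hE : E.LocallyUnital) :
    Function.Injective U.toFun := by
  refine (injective_iff_map_eq_zero _).2 fun ξ hξ => ?_
  have h : ∀ φ ∈ E.functionals, φ ξ = 0 := fun φ hφ => by
    rw [← U.pairing ⟨φ, hφ⟩ ξ, hξ, map_zero]
  obtain ⟨T, hT, hTξ⟩ := hE.left ξ
  rw [← hTξ]
  clear hTξ
  induction hT using compact_induction with
  | h0 => rfl
  | hadd S T _ _ hS hT => rw [LinearMap.add_apply, hS, hT, add_zero]
  | htheta η φ hφ => rw [theta_apply, h φ hφ, map_zero]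

/-- A-linearity of the dual map is not part of a `RowExtension`. Approximating η for φ and aφ by the
same ξ gives U^*(aφ)(η) = a φ(ξ) = a U^*(φ)(η). -/
theorem InClassC.of_rowExtension {E : FunctionalModule A} (hA : A.HasApproxUnit)
    (hE : E.LocallyUnital) {n : Type u} {μ : Representation ℂ G (n →₀ ℂ)} (hμ : RowFinite μ)
    (U : RowExtension E n μ) : E.InClassC where
  approxUnit := hA
  cofull := hE.cofull
  dualCofull := hE.dualCofull
  compact_approxUnit := hE.compact_approxUnit
  exists_extension := by
    refine ⟨n, μ, hμ, ⟨U.toFun, U.map_rmul, U.map_act, LinearMap.codRestrict _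
      (row A n ∘ₗ U.coeff) fun φ => ⟨U.coeff φ, rfl⟩, ?_, ?_, U.pairing⟩, U.injective hE,
      U.approx⟩
    · intro a φ
      refine Subtype.ext (LinearMap.ext fun η => ?_)
      obtain ⟨ξ, hξ⟩ := by classical exact U.approx {φ, E.lmul a φ} η
      have h1 := hξ φ (by simp)
      have h2 := hξ (E.lmul a φ) (by simp)
      change row A n (U.coeff (E.lmul a φ)) η = a * row A n (U.coeff φ) η
      rw [h1, h2]
      rfl
    · intro g φ
      exact Subtype.ext (LinearMap.ext fun η => U.coeff_act g φ η)

theorem InClassC.exists_rowExtension {E : FunctionalModule A} (h : E.InClassC) :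
    ∃ (n : Type u) (μ : Representation ℂ G (n →₀ ℂ)), RowFinite μ ∧
      Nonempty (RowExtension E n μ) := by
  obtain ⟨n, μ, hμ, U, -, hU⟩ := h.exists_extension
  let e := LinearEquiv.ofInjective (row A n) (row_injective h.approxUnit n)
  let c : E.functionals →ₗ[ℂ] n →₀ A := e.symm.toLinearMap ∘ₗ U.dual
  have hc : ∀ φ, row A n (c φ) = (U.dual φ).1 := fun φ =>
    congrArg Subtype.val (e.apply_symm_apply (U.dual φ))
  refine ⟨n, μ, hμ, ⟨⟨U.toFun, U.map_rmul, U.map_act, c, fun φ ξ => ?_, fun g φ x => ?_,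
    fun s η => ?_⟩⟩⟩
  · rw [hc]; exact U.pairing φ ξ
  · rw [hc, hc, U.dual_act]; rfl
  · obtain ⟨ξ, hξ⟩ := hU s η
    exact ⟨ξ, fun φ hφ => by rw [hc]; exact hξ φ hφ⟩

/-- The elements `single i x`, `x` in a spanning set of `A`, span `A^n`. -/
theorem span_single_eq_top (n : Type u) {X : Set A} (hX : ∀ a, a ∈ Submodule.span ℂ X)
    (η : n →₀ A) : η ∈ Submodule.span ℂ {y : n →₀ A | ∃ i, ∃ x ∈ X, y = Finsupp.single i x} := by
  induction η using Finsupp.induction_linear with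
  | zero => exact Submodule.zero_mem _
  | add b c hb hc => exact Submodule.add_mem _ hb hc
  | single i b =>
    have h : Submodule.span ℂ X ≤ (Submodule.span ℂ
        {y : n →₀ A | ∃ i, ∃ x ∈ X, y = Finsupp.single i x}).comap (Finsupp.lsingle i) :=
      Submodule.span_le.2 fun x hx => Submodule.subset_span ⟨i, x, hx, rfl⟩
    exact h (hX b)

/-- Construction of an extension from rows `q j` for a family of functionals `p j` spanning the
functional space. The approximation property makes the dual map well defined. -/
theorem RowExtension.exists_of_family (hA : A.HasApproxUnit) {E : FunctionalModule A} {n : Type u}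
    {μ : Representation ℂ G (n →₀ ℂ)} (U : E →ₗ[ℂ] n →₀ A)
    (map_rmul : ∀ ξ a, U (E.rmul ξ a) = freeMul A n (U ξ) a)
    (map_act : ∀ g ξ, U (E.act g ξ) = tensorAct A μ g (U ξ))
    {J : Type*} (p : J → E →ₗ[ℂ] A) (q : J → n →₀ A)
    (hp : E.functionals = Submodule.span ℂ (Set.range p))
    (pairing : ∀ j ξ, row A n (q j) (U ξ) = p j ξ)
    (hact : ∀ g j, ∃ k, (∀ ξ, p k ξ = A.act g (p j (E.act g⁻¹ ξ))) ∧
      ∀ x, row A n (q k) x = A.act g (row A n (q j) (tensorAct A μ g⁻¹ x)))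
    {X : Set A} (hX : ∀ a, a ∈ Submodule.span ℂ X)
    (approx : ∀ (s : Finset J) (i : n), ∀ x ∈ X, ∃ ξ, ∀ j ∈ s, q j i * x = p j ξ) :
    Nonempty (RowExtension E n μ) := by
  classical
  -- For fixed s, the vectors η that can be approximated form a subspace, so spanning vectors
  -- suffice.
  have approx' : ∀ (s : Finset J) (η : n →₀ A), ∃ ξ, ∀ j ∈ s, row A n (q j) η = p j ξ := by
    intro s η
    have hη := span_single_eq_top n hX η
    induction hη using Submodule.span_induction with
    | zero => exact ⟨0, by simp⟩
    | add x y _ _ hx hy =>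
      obtain ⟨ξ, hξ⟩ := hx
      obtain ⟨ζ, hζ⟩ := hy
      exact ⟨ξ + ζ, fun j hj => by rw [map_add, map_add, hξ j hj, hζ j hj]⟩
    | smul c x _ hx =>
      obtain ⟨ξ, hξ⟩ := hx
      exact ⟨c • ξ, fun j hj => by rw [map_smul, map_smul, hξ j hj]⟩
    | mem x hx =>
      obtain ⟨i, x, hx, rfl⟩ := hx
      obtain ⟨ξ, hξ⟩ := approx s i x hx
      exact ⟨ξ, fun j hj => by rw [row_single_right, hξ j hj]⟩
  let P : (J →₀ ℂ) →ₗ[ℂ] E →ₗ[ℂ] A := Finsupp.linearCombination ℂ p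
  let Q : (J →₀ ℂ) →ₗ[ℂ] n →₀ A := Finsupp.linearCombination ℂ q
  have hPQ : ∀ (c : J →₀ ℂ) (s : Finset J), c.support ⊆ s → ∀ η ξ,
      (∀ j ∈ s, row A n (q j) η = p j ξ) → row A n (Q c) η = P c ξ := by
    intro c s hc η ξ h
    simp only [P, Q, Finsupp.linearCombination_apply, Finsupp.sum, map_sum, map_smul,
      LinearMap.sum_apply, LinearMap.smul_apply]
    exact Finset.sum_congr rfl fun j hj => by rw [h j (hc hj)]
  -- A relation ∑ c_j p_j = 0 holds for the rows too: tested on any η, the combined row equals ∑ c_j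
  -- p_j(ξ) = 0 for an approximating ξ, and rows are faithful.
  have hker : LinearMap.ker P ≤ LinearMap.ker Q := by
    intro c hc
    refine row_injective hA n (LinearMap.ext fun η => ?_)
    obtain ⟨ξ, hξ⟩ := approx' c.support η
    rw [hPQ c c.support subset_rfl η ξ hξ, LinearMap.mem_ker.1 hc]
    simp
  have hrange : LinearMap.range P = E.functionals := by
    rw [hp]; exact Finsupp.range_linearCombination ℂ
  -- w is an arbitrary section of P and need not be linear; Q ∘ w is nevertheless linear because Q c
  -- depends only on P c.
  choose! w hw using fun φ : E.functionals =>
    LinearMap.mem_range.1 (show φ.1 ∈ LinearMap.range P from by rw [hrange]; exact φ.2)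
  have hQ : ∀ c d, P c = P d → Q c = Q d := fun c d h => by
    have : c - d ∈ LinearMap.ker P := by simp [h]
    exact sub_eq_zero.1 (by simpa using hker this)
  refine ⟨⟨U, map_rmul, map_act,
    { toFun := fun φ => Q (w φ)
      map_add' := fun φ ψ => by
        rw [← map_add]
        exact hQ _ _ (by rw [hw, map_add, hw, hw]; rfl)
      map_smul' := fun t φ => by
        rw [← map_smul]
        exact hQ _ _ (by rw [hw, map_smul, hw]; rfl) }, fun φ ξ => ?_, fun g φ x => ?_,
    fun s η => ?_⟩⟩
  · change row A n (Q (w φ)) (U ξ) = φ.1 ξ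
    rw [hPQ _ _ subset_rfl _ ξ fun j _ => pairing j ξ, hw]
  · change row A n (Q (w (E.dualAct g φ))) x = A.act g (row A n (Q (w φ)) (tensorAct A μ g⁻¹ x))
    -- The family is only stable under G member by member, so g is lifted to formal linear
    -- combinations; the lift d may differ from the chosen w(gφ), but P, and hence Q, agrees on the
    -- two.
    have H : ∀ c : J →₀ ℂ, ∃ d, (∀ ξ, P d ξ = A.act g (P c (E.act g⁻¹ ξ))) ∧
        ∀ x, row A n (Q d) x = A.act g (row A n (Q c) (tensorAct A μ g⁻¹ x)) := by
      intro c
      induction c using Finsupp.induction_linear with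
      | zero => exact ⟨0, by simp, by simp⟩
      | add c c' h h' =>
        obtain ⟨d, h1, h2⟩ := h
        obtain ⟨d', h1', h2'⟩ := h'
        exact ⟨d + d', fun ξ => by simp [h1, h1'], fun x => by simp [h2, h2']⟩
      | single j t =>
        obtain ⟨k, h1, h2⟩ := hact g j
        exact ⟨Finsupp.single k t, fun ξ => by simp [P, h1], fun x => by simp [Q, h2]⟩
    obtain ⟨d, h1, h2⟩ := H (w φ)
    rw [← h2, hQ (w (E.dualAct g φ)) d]
    refine LinearMap.ext fun ξ => ?_
    rw [hw, h1, hw]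
    rfl
  · obtain ⟨ξ, hξ⟩ := approx' (s.biUnion fun φ => (w φ).support) η
    refine ⟨ξ, fun φ hφ => ?_⟩
    change row A n (Q (w φ)) η = φ.1 ξ
    rw [hPQ (w φ) _ (Finset.subset_biUnion_of_mem (fun φ => (w φ).support) hφ) η ξ hξ, hw]

/-! ### Plain modules and actions of finite groups -/

section Free

variable {n : Type u} {S : Representation ℂ G (n →₀ A)}
  (hS : ∀ g ξ a, S g (freeMul A n ξ a) = freeMul A n (S g ξ) (A.act g a))
  (hrow : ∀ g, ∀ φ ∈ LinearMap.range (row A n), A.act g ∘ₗ φ ∘ₗ S g⁻¹ ∈ LinearMap.range (row A n))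

/-- The cut-off to s is ∑_{i∈s} θ with vector and functional both equal to e in coordinate i. Each
contributes one factor e, as A need not have a unit. -/
theorem exists_compact_free [DecidableEq n] (s : Finset n) (e : A) :
    ∃ T ∈ (free A n S hS hrow).compactSubalgebra, ∀ (ξ : n →₀ A) (i : n),
      (show n →₀ A from T ξ) i = if i ∈ s then e * (e * ξ i) else 0 := by
  induction s using Finset.induction_on with
  | empty => exact ⟨0, zero_mem _, by intro ξ i; rfl⟩
  | insert j s hj ih =>
    obtain ⟨T, hT, h⟩ := ih
    refine ⟨(free A n S hS hrow).theta (Finsupp.single j e) (row A n (Finsupp.single j e)) + T,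
      add_mem (theta_mem_compact _ _ _ ⟨_, rfl⟩) hT, fun ξ i => ?_⟩
    change freeMul A n (Finsupp.single j e) (row A n (Finsupp.single j e) ξ) i
      + (show n →₀ A from T ξ) i = _
    rw [h, freeMul_apply, row_single, Finsupp.single_apply]
    by_cases hi : j = i
    · subst hi
      simp [hj]
    · simp [hi, Ne.symm hi]

theorem free_locallyUnital (hA : A.HasApproxUnit) : (free A n S hS hrow).LocallyUnital := by
  classical
  constructor
  · intro ξ
    change n →₀ A at ξ
    obtain ⟨e, he⟩ := hA.exists_unit_finset (ξ.support.image ξ)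
    obtain ⟨T, hT, h⟩ := exists_compact_free hS hrow ξ.support e
    refine ⟨T, hT, Finsupp.ext fun i => (h ξ i).trans ?_⟩
    split_ifs with hi
    · have := (he (ξ i) (Finset.mem_image_of_mem _ hi)).1
      rw [this, this]
    · exact (Finsupp.notMem_support_iff.1 hi).symm
  · rintro _ ⟨b, rfl⟩
    obtain ⟨e, he⟩ := hA.exists_unit_finset (b.support.image b)
    obtain ⟨T, hT, h⟩ := exists_compact_free hS hrow b.support e
    refine ⟨T, hT, LinearMap.ext fun ξ => ?_⟩
    change row A n b (show n →₀ A from T ξ) = row A n b ξ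
    change n →₀ A at ξ
    have hsum : ∀ η : n →₀ A, row A n b η = ∑ i ∈ b.support, b i * η i := by
      intro η
      simp [row, Finsupp.sum]
    rw [hsum, hsum]
    refine Finset.sum_congr rfl fun i hi => ?_
    have := (he (b i) (Finset.mem_image_of_mem _ hi)).2
    rw [h, if_pos hi, ← mul_assoc, ← mul_assoc, this, this]

end Free

theorem functionals_free {n : Type u} {S : Representation ℂ G (n →₀ A)}
    (hS : ∀ g ξ a, S g (freeMul A n ξ a) = freeMul A n (S g ξ) (A.act g a))
    (hrow : ∀ g, ∀ φ ∈ LinearMap.range (row A n),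
      A.act g ∘ₗ φ ∘ₗ S g⁻¹ ∈ LinearMap.range (row A n)) :
    (free A n S hS hrow).functionals = Submodule.span ℂ (Set.range (row A n)) := by
  rw [← LinearMap.coe_range, Submodule.span_eq]
  rfl

theorem plain_inClassC (hA : A.HasApproxUnit) (n : Type u) (μ : Representation ℂ G (n →₀ ℂ))
    (hμ : RowFinite μ) : (plain A n μ hμ).InClassC := by
  obtain ⟨U⟩ := RowExtension.exists_of_family (E := plain A n μ hμ) (μ := μ) hA LinearMap.id
    (fun _ _ => rfl) (fun _ _ => rfl) (row A n) id (functionals_free _ _) (fun _ _ => rfl)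
    (fun g b => by
      obtain ⟨c, hc⟩ := tensorAct_row μ hμ g (row A n b) ⟨b, rfl⟩
      exact ⟨c, LinearMap.congr_fun hc, LinearMap.congr_fun hc⟩)
    (X := Set.univ) (by simp)
    (fun s i x _ => ⟨Finsupp.single i x, fun b _ => (row_single_right n b i x).symm⟩)
  exact .of_rowExtension hA (free_locallyUnital _ _ hA) hμ U

/-- The linear representation on `ℂ^n` of a permutation action on `n`. -/
noncomputable def permRep {n : Type u} (σ : G →* Equiv.Perm n) : Representation ℂ G (n →₀ ℂ) where
  toFun g := Finsupp.lmapDomain ℂ ℂ (σ g)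
  map_one' := by ext; simp
  map_mul' g h := by ext; simp

theorem permRep_rowFinite {n : Type u} (σ : G →* Equiv.Perm n) : RowFinite (permRep σ) := by
  classical
  intro g i
  refine (Set.finite_singleton ((σ g).symm i)).subset fun j hj => ?_
  by_contra h
  refine hj ?_
  have : σ g j ≠ i := fun e => h (by simp [← e])
  simp [permRep, this]

theorem tensorAct_permRep {n : Type u} (σ : G →* Equiv.Perm n) (g : G) (x : n →₀ A) (i : n) :
    tensorAct A (permRep σ) g x i = A.act g (x (σ g⁻¹ i)) := by
  classical
  induction x using Finsupp.induction_linear with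
  | zero => simp
  | add x y hx hy => simp [hx, hy]
  | single j a =>
    have : σ g j = i ↔ j = σ g⁻¹ i := by
      rw [map_inv, Equiv.Perm.inv_def, Equiv.eq_symm_apply]
    rw [tensorAct_single, Finsupp.single_apply, if_congr this.symm rfl rfl]
    by_cases h : σ g j = i
    · simp [permRep, h]
    · simp [permRep, h]

/-- The translation action of `G` on `n × J` for `J` in bijection with `G`. -/
def translation (n : Type u) {J : Type} (e : G ≃ J) : G →* Equiv.Perm (n × J) where
  toFun g := (Equiv.refl n).prodCongr (e.permCongr (Equiv.mulLeft g))
  map_one' := by ext x <;> simp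
  map_mul' g h := by ext x <;> simp

theorem translation_apply (n : Type u) {J : Type} (e : G ≃ J) (g : G) (i : n) (t : J) :
    translation n e g (i, t) = (i, e (g * e.symm t)) := by
  simp [translation]

/-- Restriction to the slice `n × {t}`. -/
noncomputable def slice (A : GAlgebra.{u, v} G) (n : Type u) {J : Type} (t : J) :
    (n × J →₀ A) →ₗ[ℂ] (n →₀ A) :=
  Finsupp.lcomapDomain (fun i => (i, t)) fun _ _ h => congrArg Prod.fst h

theorem slice_apply {n : Type u} {J : Type} (t : J) (x : n × J →₀ A) (i : n) :
    slice A n t x i = x (i, t) := rfl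

theorem row_slice {n : Type u} {J : Type} (t : J) (b : n →₀ A) (x : n × J →₀ A) :
    row A (n × J) (Finsupp.mapDomain (fun i => (i, t)) b) x = row A n b (slice A n t x) := by
  induction b using Finsupp.induction_linear with
  | zero => simp
  | add b c hb hc => simp only [map_add, LinearMap.add_apply, Finsupp.mapDomain_add, hb, hc]
  | single i b => rw [Finsupp.mapDomain_single, row_single, row_single, slice_apply]

/-! ### Arbitrary actions of a finite group: orbit map and averaging. -/

section FiniteGroup

variable {n : Type u} {J : Type} [Fintype J] (e : G ≃ J) (S : Representation ℂ G (n →₀ A))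

/-- The embedding `ξ ↦ ∑ h, (α_h ⊗ 1) S_{h⁻¹} ξ ⊗ δ_h`. -/
noncomputable def orbitEmb : (n →₀ A) →ₗ[ℂ] (n × J →₀ A) :=
  ∑ t, Finsupp.lmapDomain A ℂ (fun i => (i, t)) ∘ₗ
    Finsupp.mapRange.linearMap (A.act (e.symm t)) ∘ₗ S (e.symm t)⁻¹

/-- The averaged left inverse of `orbitEmb`. -/
noncomputable def orbitAvg : (n × J →₀ A) →ₗ[ℂ] (n →₀ A) :=
  (Fintype.card J : ℂ)⁻¹ • ∑ t, S (e.symm t) ∘ₗ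
    Finsupp.mapRange.linearMap (A.act (e.symm t)⁻¹) ∘ₗ slice A n t

theorem orbitEmb_apply (ξ : n →₀ A) (i : n) (t : J) :
    orbitEmb e S ξ (i, t) = A.act (e.symm t) (S (e.symm t)⁻¹ ξ i) := by
  classical
  rw [orbitEmb, LinearMap.sum_apply, Finsupp.finsetSum_apply, Finset.sum_eq_single t]
  · have : Function.Injective fun i : n => (i, t) := fun _ _ h => congrArg Prod.fst h
    simp [Finsupp.mapDomain_apply this]
  · intro s _ hs
    simp only [LinearMap.comp_apply, Finsupp.lmapDomain_apply]
    rw [Finsupp.mapDomain_of_notMem_range]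
    rintro ⟨k, hk⟩
    exact hs (congrArg Prod.snd hk)
  · simp

theorem rep_inv_apply {V : Type*} [AddCommGroup V] [Module ℂ V] (ρ : Representation ℂ G V) (g : G)
    (x : V) : ρ g (ρ g⁻¹ x) = x := by
  rw [← Module.End.mul_apply, ← map_mul]; simp

theorem rep_inv_apply' {V : Type*} [AddCommGroup V] [Module ℂ V] (ρ : Representation ℂ G V)
    (g : G) (x : V) : ρ g⁻¹ (ρ g x) = x := by
  rw [← Module.End.mul_apply, ← map_mul]; simp

/-- In each slice h, the operators S_h and α_{h⁻¹} undo S_{h⁻¹} and α_h, so the average is taken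
over |G| copies of ξ. -/
theorem orbitAvg_orbitEmb (ξ : n →₀ A) : orbitAvg e S (orbitEmb e S ξ) = ξ := by
  have h : ∀ t, Finsupp.mapRange.linearMap (A.act (e.symm t)⁻¹)
      (slice A n t (orbitEmb e S ξ)) = S (e.symm t)⁻¹ ξ := by
    intro t
    ext i
    rw [Finsupp.mapRange.linearMap_apply, Finsupp.mapRange_apply, slice_apply, orbitEmb_apply,
      rep_inv_apply']
  have : Nonempty J := ⟨e 1⟩
  simp only [orbitAvg, LinearMap.smul_apply, LinearMap.sum_apply, LinearMap.comp_apply, h,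
    rep_inv_apply, Finset.sum_const, Finset.card_univ]
  rw [← Nat.cast_smul_eq_nsmul ℂ, smul_smul, inv_mul_cancel₀ (by simp), one_smul]

theorem orbitAvg_act (g : G) (x : n × J →₀ A) :
    orbitAvg e S (tensorAct A (permRep (translation n e)) g x) = S g (orbitAvg e S x) := by
  simp only [orbitAvg, LinearMap.smul_apply, LinearMap.sum_apply, LinearMap.comp_apply, map_smul,
    map_sum]
  congr 1
  -- Reindex the average by h ↦ gh, so that the slice gh of the translated vector is matched with
  -- the slice h of x.
  refine (Equiv.sum_comp (e.permCongr (Equiv.mulLeft g)) _).symm.trans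
    (Finset.sum_congr rfl fun t _ => ?_)
  have h1 : e.symm (e.permCongr (Equiv.mulLeft g) t) = g * e.symm t := by simp
  rw [h1, map_mul, Module.End.mul_apply]
  congr 2
  ext i
  simp only [Finsupp.mapRange.linearMap_apply, Finsupp.mapRange_apply, slice_apply,
    tensorAct_permRep, translation_apply, h1]
  rw [← Module.End.mul_apply, ← map_mul]
  simp

/-- α_h S_{h⁻¹} S_g = α_g α_{g⁻¹h} S_{(g⁻¹h)⁻¹}, which is translation of the index combined with α_g
on coefficients. -/
theorem orbitEmb_act (g : G) (ξ : n →₀ A) :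
    orbitEmb e S (S g ξ) = tensorAct A (permRep (translation n e)) g (orbitEmb e S ξ) := by
  ext ⟨i, t⟩
  rw [orbitEmb_apply, tensorAct_permRep, translation_apply, orbitEmb_apply,
    ← Module.End.mul_apply (A.act g), ← map_mul, ← Module.End.mul_apply (S _) (S g), ← map_mul]
  simp

/-- S_{h⁻¹} twists the scalar a to α_{h⁻¹}(a), and α_h untwists it; S_{h⁻¹} alone would not give an
A-linear map. -/
theorem orbitEmb_freeMul
    (hS : ∀ g ξ a, S g (freeMul A n ξ a) = freeMul A n (S g ξ) (A.act g a)) (ξ : n →₀ A) (a : A) :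
    orbitEmb e S (freeMul A n ξ a) = freeMul A (n × J) (orbitEmb e S ξ) a := by
  ext ⟨i, t⟩
  rw [freeMul_apply, orbitEmb_apply, orbitEmb_apply, hS, freeMul_apply, A.act_mul, rep_inv_apply]

theorem row_mapRange_act (g : G) (b x : n →₀ A) :
    row A n (Finsupp.mapRange.linearMap (A.act g) b) x
      = A.act g (row A n b (Finsupp.mapRange.linearMap (A.act g⁻¹) x)) := by
  induction b using Finsupp.induction_linear with
  | zero => simp
  | add b c hb hc => simp only [map_add, LinearMap.add_apply, hb, hc]
  | single i b =>
    rw [Finsupp.mapRange.linearMap_apply, Finsupp.mapRange_single, row_single, row_single,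
      A.act_mul, Finsupp.mapRange.linearMap_apply, Finsupp.mapRange_apply, rep_inv_apply]

theorem row_comp_orbitAvg (hrow : ∀ g, ∀ φ ∈ LinearMap.range (row A n),
      A.act g ∘ₗ φ ∘ₗ S g⁻¹ ∈ LinearMap.range (row A n)) (b : n →₀ A) :
    row A n b ∘ₗ orbitAvg e S ∈ LinearMap.range (row A (n × J)) := by
  rw [orbitAvg, LinearMap.comp_smul, ← LinearMap.compRight_apply ℂ, map_sum]
  refine Submodule.smul_mem _ _ (Submodule.sum_mem _ fun t _ => ?_)
  -- Invariance at h⁻¹ makes α_{h⁻¹} ∘ row b ∘ S_h a row c. Hence row b ∘ S_h ∘ α_{h⁻¹} = α_h ∘ row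
  -- c ∘ α_{h⁻¹}, the row with entries α_h(c_i), placed in slice h.
  obtain ⟨c, hc⟩ := hrow (e.symm t)⁻¹ (row A n b) ⟨b, rfl⟩
  refine ⟨Finsupp.mapDomain (fun i => (i, t))
    (Finsupp.mapRange.linearMap (A.act (e.symm t)) c), LinearMap.ext fun x => ?_⟩
  rw [row_slice, row_mapRange_act, hc]
  simp

/-- With U^*(φ) = φ ∘ `orbitAvg`, the pairing is the left-inverse identity, and the averaged vector
approximates η for all functionals at once. -/
theorem free_inClassC [Finite G] (hA : A.HasApproxUnit)
    (hS : ∀ g ξ a, S g (freeMul A n ξ a) = freeMul A n (S g ξ) (A.act g a))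
    (hrow : ∀ g, ∀ φ ∈ LinearMap.range (row A n),
      A.act g ∘ₗ φ ∘ₗ S g⁻¹ ∈ LinearMap.range (row A n)) :
    (free A n S hS hrow).InClassC := by
  -- Replacing G by `Fin k` keeps the index set n × J in the universe of n.
  obtain ⟨k, ⟨e⟩⟩ := Finite.exists_equiv_fin G
  choose q hq using fun b => row_comp_orbitAvg e S hrow b
  obtain ⟨U⟩ := RowExtension.exists_of_family (E := free A n S hS hrow)
    (μ := permRep (translation n e)) hA (orbitEmb e S)
    (orbitEmb_freeMul e S hS)
    (orbitEmb_act e S) (row A n) q (functionals_free _ _)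
    (fun b ξ => (LinearMap.congr_fun (hq b) _).trans
      (congrArg (row A n b) (orbitAvg_orbitEmb e S ξ)))
    (fun g b => by
      obtain ⟨c, hc⟩ := hrow g (row A n b) ⟨b, rfl⟩
      refine ⟨c, LinearMap.congr_fun hc, fun x => ?_⟩
      rw [hq, hq, LinearMap.comp_apply, LinearMap.comp_apply, orbitAvg_act, hc]
      rfl)
    (X := Set.univ) (by simp)
    (fun s i x _ => ⟨orbitAvg e S (Finsupp.single i x), fun b _ => by
      rw [← row_single_right, hq]; rfl⟩)
  exact .of_rowExtension hA (free_locallyUnital _ _ hA) (permRep_rowFinite _) U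

end FiniteGroup

/-! ### Direct sums -/

section DirectSum

variable {I : Type u} (E : I → FunctionalModule A)

theorem comp_lapply_mem_directSum (i : I) (φ : E i →ₗ[ℂ] A) (hφ : φ ∈ (E i).functionals) :
    (show directSum E →ₗ[ℂ] A from φ ∘ₗ DFinsupp.lapply (R := ℂ) (M := fun i => E i) i)
      ∈ (directSum E).functionals :=
  Submodule.mem_iSup_of_mem (p := fun i =>
    (E i).functionals.map (LinearMap.lcomp ℂ A (DFinsupp.lapply (R := ℂ) (M := fun i => E i) i)))
    i ⟨φ, hφ, rfl⟩

/-- The functional on `⨁ i, E i` given by a functional on one summand. -/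
noncomputable def summandFunctional (j : Σ i, (E i).functionals) : (Π₀ i, E i) →ₗ[ℂ] A :=
  j.2.1 ∘ₗ DFinsupp.lapply (R := ℂ) (M := fun i => E i) j.1

theorem iSup_eq_span_summandFunctional :
    (⨆ i, (E i).functionals.map (LinearMap.lcomp ℂ A (DFinsupp.lapply i)) :
      Submodule ℂ ((Π₀ i, E i) →ₗ[ℂ] A)) = Submodule.span ℂ (Set.range (summandFunctional E)) := by
  refine le_antisymm (iSup_le ?_) (Submodule.span_le.2 ?_)
  · rintro i _ ⟨φ, hφ, rfl⟩
    exact Submodule.subset_span ⟨⟨i, φ, hφ⟩, rfl⟩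
  · rintro _ ⟨⟨i, φ⟩, rfl⟩
    exact comp_lapply_mem_directSum E i φ.1 φ.2

theorem directSum_functionals :
    (directSum E).functionals = Submodule.span ℂ (Set.range (summandFunctional E)) :=
  iSup_eq_span_summandFunctional E

variable [DecidableEq I]

/-- A finite block-diagonal operator is a sum of single blocks, and the block of θ_{η,φ} is the
elementary operator of the included η and the functional φ composed with the projection. -/
theorem exists_compact_directSum (T : ∀ i, Module.End ℂ (E i))
    (hT : ∀ i, T i ∈ (E i).compactSubalgebra) (s : Finset I) :
    ∃ T' ∈ (directSum E).compactSubalgebra, ∀ ξ : Π₀ i, E i, ∀ i,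
      (show Π₀ i, E i from T' ξ) i = if i ∈ s then T i (ξ i) else 0 := by
  induction s using Finset.induction_on with
  | empty => exact ⟨0, zero_mem _, by intro ξ i; rfl⟩
  | insert j s hj ih =>
    obtain ⟨T', hT', h⟩ := ih
    obtain ⟨T'', hT'', h'⟩ : ∃ T'' ∈ (directSum E).compactSubalgebra, ∀ ξ : Π₀ i, E i,
        (show Π₀ i, E i from T'' ξ) = DFinsupp.single j (T j (ξ j)) := by
      have hj := hT j
      generalize T j = R at hj
      induction hj using compact_induction with
      | h0 => exact ⟨0, zero_mem _, fun ξ => by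
          rw [LinearMap.zero_apply, DFinsupp.single_zero]; rfl⟩
      | hadd R R' _ _ hR hR' =>
        obtain ⟨S, hS, e⟩ := hR
        obtain ⟨S', hS', e'⟩ := hR'
        refine ⟨S + S', add_mem hS hS', fun ξ => ?_⟩
        rw [LinearMap.add_apply, DFinsupp.single_add, ← e, ← e']
        rfl
      | htheta η φ hφ =>
        refine ⟨_, theta_mem_compact (directSum E) (DFinsupp.single (β := fun i => E i) j η) _
          (comp_lapply_mem_directSum E j φ hφ), fun ξ => ?_⟩
        change DFinsupp.mapRange.linearMap (fun i => (E i).rmul.flip (φ (ξ j)))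
          (DFinsupp.single j η) = _
        rw [DFinsupp.mapRange.linearMap_apply, DFinsupp.mapRange_single]
        rfl
    refine ⟨T'' + T', add_mem hT'' hT', fun ξ i => ?_⟩
    change (show Π₀ i, E i from T'' ξ) i + (show Π₀ i, E i from T' ξ) i = _
    rw [h, h']
    by_cases hi : i = j
    · subst hi
      simp [hj]
    · rw [DFinsupp.single_eq_of_ne hi]
      simp [hi]

theorem directSum_locallyUnital (hE : ∀ i, (E i).LocallyUnital) :
    (directSum E).LocallyUnital := by
  classical
  constructor
  · intro ξ
    change Π₀ i, E i at ξ
    choose T hT h using fun i => (hE i).left (ξ i)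
    obtain ⟨T', hT', h'⟩ := exists_compact_directSum E T hT ξ.support
    refine ⟨T', hT', DFinsupp.ext fun i => (h' ξ i).trans ?_⟩
    split_ifs with hi
    · exact h i
    · exact (DFinsupp.notMem_support_iff.1 hi).symm
  · rw [directSum_functionals]
    intro (φ : (Π₀ i, E i) →ₗ[ℂ] A) hφ
    -- A functional on the sum consists of functionals on the summands, almost all zero; a block
    -- operator on the finite set s then suffices to fix it.
    have key : (∀ i, φ ∘ₗ DFinsupp.lsingle (R := ℂ) (M := fun i => E i) i ∈ (E i).functionals) ∧
        ∃ s : Finset I, ∀ i ∉ s, φ ∘ₗ DFinsupp.lsingle (R := ℂ) (M := fun i => E i) i = 0 := by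
      change φ ∈ Submodule.span ℂ (Set.range (summandFunctional E)) at hφ
      induction hφ using Submodule.closure_induction with
      | zero => exact ⟨fun i => Submodule.zero_mem _, ∅, fun _ _ => rfl⟩
      | add φ ψ _ _ h h' =>
        obtain ⟨h1, s, h2⟩ := h
        obtain ⟨h1', s', h2'⟩ := h'
        refine ⟨fun i => Submodule.add_mem _ (h1 i) (h1' i), s ∪ s', fun i hi => ?_⟩
        rw [Finset.mem_union, not_or] at hi
        rw [LinearMap.add_comp, h2 i hi.1, h2' i hi.2, add_zero]
      | smul_mem c φ hφ =>
        obtain ⟨⟨j, φ, hφ⟩, rfl⟩ := hφ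
        have h0 : ∀ i, i ≠ j → (c • summandFunctional E ⟨j, φ, hφ⟩) ∘ₗ
            DFinsupp.lsingle (R := ℂ) (M := fun i => E i) i = 0 := fun i hi =>
          LinearMap.ext fun x => by simp [summandFunctional, DFinsupp.single_eq_of_ne hi.symm]
        refine ⟨fun i => ?_, {j}, fun i hi => h0 i (by simpa using hi)⟩
        by_cases hi : i = j
        · subst hi
          rw [show (c • summandFunctional E ⟨i, φ, hφ⟩) ∘ₗ
            DFinsupp.lsingle (R := ℂ) (M := fun i => E i) i = c • φ from
            LinearMap.ext fun x => by simp [summandFunctional]]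
          exact Submodule.smul_mem _ _ hφ
        · exact (h0 i hi).symm ▸ Submodule.zero_mem _
    obtain ⟨h1, s, h2⟩ := key
    choose T hT h using fun i => (hE i).right _ (h1 i)
    obtain ⟨T', hT', h'⟩ := exists_compact_directSum E T hT s
    refine ⟨T', hT', DFinsupp.lhom_ext fun i x => ?_⟩
    have hx : (show Π₀ i, E i from T' (DFinsupp.single i x))
        = DFinsupp.single i (if i ∈ s then T i x else 0) := by
      refine DFinsupp.ext fun j => (h' _ j).trans ?_
      by_cases hj : j = i
      · subst hj; simp
      · rw [DFinsupp.single_eq_of_ne hj, DFinsupp.single_eq_of_ne hj]; simp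
    change φ (show Π₀ i, E i from T' (DFinsupp.single i x)) = φ (DFinsupp.single i x)
    rw [hx]
    split_ifs with hi
    · exact LinearMap.congr_fun (h i) x
    · rw [DFinsupp.single_zero]
      exact (map_zero φ).trans (LinearMap.congr_fun (h2 i hi) x).symm

end DirectSum

/-! ### Block-diagonal representations and coordinate maps. -/

section SigmaRep

variable {I : Type u} {n : I → Type u}

/-- The restriction of a family on `Σ i, n i` to the `i`-th summand. -/
noncomputable def sigmaSplit (X : Type*) [AddCommGroup X] [Module ℂ X] (n : I → Type u) (i : I) :
    ((Σ i, n i) →₀ X) →ₗ[ℂ] (n i →₀ X) :=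
  Finsupp.lcomapDomain (Sigma.mk i) sigma_mk_injective

/-- The direct sum of linear representations on finitely supported functions. -/
noncomputable def sigmaRep (μ : ∀ i, Representation ℂ G (n i →₀ ℂ)) :
    Representation ℂ G ((Σ i, n i) →₀ ℂ) where
  toFun g := (sigmaFinsuppLequivDFinsupp ℂ).symm.toLinearMap ∘ₗ
    DFinsupp.mapRange.linearMap (fun i => μ i g) ∘ₗ (sigmaFinsuppLequivDFinsupp ℂ).toLinearMap
  map_one' := by
    refine LinearMap.ext fun x => Finsupp.ext fun ⟨i, k⟩ => ?_
    change μ i 1 (sigmaSplit ℂ n i x) k = x ⟨i, k⟩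
    rw [map_one]
    rfl
  map_mul' g h := by
    ext1 k
    refine LinearMap.ext fun c => ?_
    simp only [map_mul]
    simp
    exact DFinsupp.ext fun i => rfl

theorem sigmaRep_apply (μ : ∀ i, Representation ℂ G (n i →₀ ℂ)) (g : G)
    (x : (Σ i, n i) →₀ ℂ) (i : I) (k : n i) :
    sigmaRep μ g x ⟨i, k⟩ = μ i g (sigmaSplit ℂ n i x) k := rfl

theorem sigmaSplit_single_self (X : Type*) [AddCommGroup X] [Module ℂ X] (i : I) (k : n i)
    (x : X) : sigmaSplit X n i (Finsupp.single ⟨i, k⟩ x) = Finsupp.single k x := by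
  classical
  ext l
  change Finsupp.single (⟨i, k⟩ : Σ i, n i) x ⟨i, l⟩ = _
  simp [Finsupp.single_apply]

theorem sigmaSplit_single_of_ne (X : Type*) [AddCommGroup X] [Module ℂ X] {i j : I} (h : j ≠ i)
    (k : n j) (x : X) : sigmaSplit X n i (Finsupp.single ⟨j, k⟩ x) = 0 := by
  classical
  ext l
  change Finsupp.single (⟨j, k⟩ : Σ i, n i) x ⟨i, l⟩ = _
  rw [Finsupp.single_apply, if_neg fun e => h (congrArg Sigma.fst e)]
  rfl

theorem sigmaRep_rowFinite {μ : ∀ i, Representation ℂ G (n i →₀ ℂ)} (hμ : ∀ i, RowFinite (μ i)) :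
    RowFinite (sigmaRep μ) := by
  rintro g ⟨i, k⟩
  refine ((hμ i g k).image (Sigma.mk i)).subset ?_
  rintro ⟨j, l⟩ h
  by_cases hj : j = i
  · subst hj
    refine ⟨l, ?_, rfl⟩
    rwa [Set.mem_ofPred_eq, sigmaRep_apply, sigmaSplit_single_self] at h
  · refine absurd ?_ h
    rw [sigmaRep_apply, sigmaSplit_single_of_ne _ hj, map_zero]
    rfl

theorem sigmaSplit_tensorAct (μ : ∀ i, Representation ℂ G (n i →₀ ℂ)) (g : G)
    (x : (Σ i, n i) →₀ A) (i : I) : sigmaSplit A n i (tensorAct A (sigmaRep μ) g x)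
      = tensorAct A (μ i) g (sigmaSplit A n i x) := by
  induction x using Finsupp.induction_linear with
  | zero => simp
  | add x y hx hy => simp only [map_add, hx, hy]
  | single j a =>
    obtain ⟨j, l⟩ := j
    ext k
    change tensorAct A (sigmaRep μ) g (Finsupp.single ⟨j, l⟩ a) ⟨i, k⟩ = _
    rw [tensorAct_single, sigmaRep_apply]
    by_cases hj : j = i
    · subst hj
      rw [sigmaSplit_single_self, sigmaSplit_single_self, tensorAct_single]
    · rw [sigmaSplit_single_of_ne _ hj, sigmaSplit_single_of_ne _ hj]
      simp

theorem row_mapDomain_sigma (i : I) (b : n i →₀ A) (x : (Σ i, n i) →₀ A) :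
    row A (Σ i, n i) (Finsupp.mapDomain (Sigma.mk i) b) x = row A (n i) b (sigmaSplit A n i x) := by
  induction b using Finsupp.induction_linear with
  | zero => simp
  | add b c hb hc => simp only [map_add, LinearMap.add_apply, Finsupp.mapDomain_add, hb, hc]
  | single i b => rw [Finsupp.mapDomain_single, row_single, row_single]; rfl

theorem sigmaSplit_freeMul (i : I) (x : (Σ i, n i) →₀ A) (a : A) :
    sigmaSplit A n i (freeMul A (Σ i, n i) x a) = freeMul A (n i) (sigmaSplit A n i x) a := by
  ext k
  rw [freeMul_apply]
  exact freeMul_apply _ _ _ _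

theorem sigmaSplit_ext {x y : (Σ i, n i) →₀ A} (h : ∀ i, sigmaSplit A n i x = sigmaSplit A n i y) :
    x = y :=
  Finsupp.ext fun ⟨i, k⟩ => DFunLike.congr_fun (h i) k

/-- The map from a direct sum into finitely supported functions on `Σ i, n i` assembled from maps
of the summands. -/
noncomputable def sigmaMap {E : I → FunctionalModule A} (f : ∀ i, E i →ₗ[ℂ] (n i →₀ A)) :
    (Π₀ i, E i) →ₗ[ℂ] ((Σ i, n i) →₀ A) :=
  (sigmaFinsuppLequivDFinsupp ℂ).symm.toLinearMap ∘ₗ DFinsupp.mapRange.linearMap f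

theorem sigmaSplit_sigmaMap {E : I → FunctionalModule A} (f : ∀ i, E i →ₗ[ℂ] (n i →₀ A))
    (ξ : Π₀ i, E i) (i : I) : sigmaSplit A n i (sigmaMap f ξ) = f i (ξ i) :=
  Finsupp.ext fun _ => rfl

theorem sigmaMap_rmul {E : I → FunctionalModule A} (f : ∀ i, E i →ₗ[ℂ] (n i →₀ A))
    (hf : ∀ i ξ a, f i ((E i).rmul ξ a) = freeMul A (n i) (f i ξ) a) (ξ : directSum E) (a : A) :
    sigmaMap f ((directSum E).rmul ξ a) = freeMul A (Σ i, n i) (sigmaMap f ξ) a := by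
  refine sigmaSplit_ext fun i => ((sigmaSplit_sigmaMap f _ i).trans ?_).trans
    (sigmaSplit_freeMul i _ a).symm
  exact (hf i _ a).trans (congrArg (freeMul A (n i) · a) (sigmaSplit_sigmaMap f _ i).symm)

theorem sigmaMap_act {E : I → FunctionalModule A} (f : ∀ i, E i →ₗ[ℂ] (n i →₀ A))
    (μ : ∀ i, Representation ℂ G (n i →₀ ℂ))
    (hf : ∀ i g ξ, f i ((E i).act g ξ) = tensorAct A (μ i) g (f i ξ)) (g : G) (ξ : directSum E) :
    sigmaMap f ((directSum E).act g ξ) = tensorAct A (sigmaRep μ) g (sigmaMap f ξ) := by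
  refine sigmaSplit_ext fun i => ((sigmaSplit_sigmaMap f _ i).trans ?_).trans
    (sigmaSplit_tensorAct μ g _ i).symm
  exact (hf i g _).trans (congrArg (tensorAct A (μ i) g) (sigmaSplit_sigmaMap f _ i).symm)

end SigmaRep

theorem directSum_inClassC (hA : A.HasApproxUnit) {I : Type u} (E : I → FunctionalModule A)
    (hE : ∀ i, (E i).InClassC) : (directSum E).InClassC := by
  classical
  choose n μ hμ hU using fun i => (hE i).exists_rowExtension
  have U := fun i => (hU i).some
  obtain ⟨W⟩ := RowExtension.exists_of_family (E := directSum E) (μ := sigmaRep μ) hA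
    (sigmaMap fun i => (U i).toFun) (sigmaMap_rmul _ fun i => (U i).map_rmul)
    (sigmaMap_act _ μ fun i => (U i).map_act)
    (summandFunctional E)
    (fun j => Finsupp.mapDomain (Sigma.mk j.1) ((U j.1).coeff j.2))
    (directSum_functionals E)
    (fun j ξ => ((row_mapDomain_sigma j.1 _ _).trans
      (congrArg _ (sigmaSplit_sigmaMap _ ξ j.1))).trans ((U j.1).pairing j.2 _))
    (fun g j => ⟨⟨j.1, (E j.1).dualAct g j.2⟩, fun ξ => rfl, fun x => by
      rw [row_mapDomain_sigma, row_mapDomain_sigma, (U j.1).coeff_act, sigmaSplit_tensorAct]⟩)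
    (X := Set.univ) (by simp)
    (fun s ⟨i, k⟩ x _ => by
      -- Only the functionals of s living on summand i see a vector in block i; the other rows, and
      -- the other functionals on the included ξ, give 0.
      obtain ⟨ξ, hξ⟩ := (U i).approx (s.preimage (fun φ => (⟨i, φ⟩ : Σ i, (E i).functionals))
          (sigma_mk_injective (β := fun i => (E i).functionals)).injOn) (Finsupp.single k x)
      refine ⟨DFinsupp.single (β := fun i => E i) i ξ, fun ⟨j, φ⟩ hj => ?_⟩
      rw [← row_single_right, row_mapDomain_sigma]
      change _ = φ.1 (DFinsupp.single (β := fun i => E i) i ξ j)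
      by_cases h : i = j
      · subst h
        rw [sigmaSplit_single_self, hξ φ (by simpa using hj), DFinsupp.single_eq_same]
      · rw [sigmaSplit_single_of_ne _ h, DFinsupp.single_eq_of_ne (Ne.symm h), map_zero, map_zero])
  exact .of_rowExtension hA (directSum_locallyUnital E fun i => (hE i).locallyUnital)
    (sigmaRep_rowFinite hμ) W

/-! ### Change of the coefficient algebra -/

section Change

variable {B : GAlgebra.{u, v} G} (π : A.Hom B) (E : FunctionalModule A)

theorem changeMk_add_left (ξ η : E) (b : B) :
    changeMk π E (ξ + η) b = changeMk π E ξ b + changeMk π E η b := by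
  simp [changeMk, TensorProduct.add_tmul]

theorem changeMk_zero_left (b : B) : changeMk π E 0 b = 0 := by
  simp [changeMk]

theorem changeMk_rmul (ξ : E) (a : A) (b : B) :
    changeMk π E (E.rmul ξ a) b = changeMk π E ξ (π.toFun a * b) :=
  (Submodule.Quotient.eq _).2 (Submodule.subset_span ⟨ξ, a, b, rfl⟩)

theorem changeFunctional_mem (φ : E.functionals) (c : B) :
    (show change π E →ₗ[ℂ] B from changeFunctional π E φ c) ∈ (change π E).functionals := by
  have h : changeFunctional π E φ c ∈
      Submodule.span ℂ {χ | ∃ φ c, χ = changeFunctional π E φ c} :=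
    Submodule.subset_span ⟨φ, c, rfl⟩
  exact h

theorem theta_change_apply (η ξ : E) (d b c : B) (φ : E.functionals) :
    (change π E).theta (changeMk π E η d) (changeFunctional π E φ c) (changeMk π E ξ b)
      = changeMk π E η (d * (c * π.toFun (φ.1 ξ) * b)) := by
  refine Eq.trans ?_ (changeMul_mk π E η d _)
  rw [← changeFunctional_mk]
  rfl

/-- T ⊗ 1 is imitated on finitely many ξ only. For T = θ_{η,φ} take a unit e of the elements
π(φ(ξ)): the operator of η ⊗ e and φ ⊗ e sends ξ ⊗ b to η ⊗ e e π(φ(ξ)) b = η φ(ξ) ⊗ b. -/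
theorem exists_compact_change_left (hB : B.HasApproxUnit) {T : Module.End ℂ E}
    (hT : T ∈ E.compactSubalgebra) (s : Finset E) : ∃ S ∈ (change π E).compactSubalgebra,
      ∀ ξ ∈ s, ∀ b, S (changeMk π E ξ b) = changeMk π E (T ξ) b := by
  classical
  induction hT using compact_induction with
  | h0 => exact ⟨0, zero_mem _, fun ξ _ b => (changeMk_zero_left π E b).symm⟩
  | hadd T T' _ _ h h' =>
    obtain ⟨S, hS, h⟩ := h
    obtain ⟨S', hS', h'⟩ := h'
    exact ⟨S + S', add_mem hS hS', fun ξ hξ b => (congrArg₂ (· + ·) (h ξ hξ b) (h' ξ hξ b)).trans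
      (changeMk_add_left π E _ _ b).symm⟩
  | htheta η φ hφ =>
    obtain ⟨e, he⟩ := hB.exists_unit_finset (s.image fun ξ => π.toFun (φ ξ))
    refine ⟨_, theta_mem_compact (change π E) (changeMk π E η e) _
      (changeFunctional_mem π E ⟨φ, hφ⟩ e), fun ξ hξ b => ?_⟩
    have := (he _ (Finset.mem_image_of_mem _ hξ)).1
    rw [theta_change_apply, ← mul_assoc, ← mul_assoc, mul_assoc e e, this, this, theta_apply,
      changeMk_rmul]

/-- Dually, the inserted e is a right unit of the elements π(φ(η)), φ ∈ s, so it disappears after φ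
⊗ c is applied. -/
theorem exists_compact_change_right (hB : B.HasApproxUnit) {T : Module.End ℂ E}
    (hT : T ∈ E.compactSubalgebra) (s : Finset E.functionals) :
    ∃ S ∈ (change π E).compactSubalgebra, ∀ φ ∈ s, ∀ c ξ b,
      changeFunctional π E φ c (S (changeMk π E ξ b)) = c * π.toFun (φ.1 (T ξ)) * b := by
  classical
  induction hT using compact_induction with
  | h0 =>
    refine ⟨0, zero_mem _, fun φ _ c ξ b => (map_zero (changeFunctional π E φ c)).trans ?_⟩
    simp
  | hadd T T' _ _ h h' =>
    obtain ⟨S, hS, h⟩ := h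
    obtain ⟨S', hS', h'⟩ := h'
    refine ⟨S + S', add_mem hS hS', fun φ hφ c ξ b =>
      (map_add (changeFunctional π E φ c) _ _).trans ?_⟩
    rw [h φ hφ, h' φ hφ]
    simp [mul_add, add_mul]
  | htheta η ψ hψ =>
    obtain ⟨e, he⟩ := hB.exists_unit_finset (s.image fun φ => π.toFun (φ.1 η))
    refine ⟨_, theta_mem_compact (change π E) (changeMk π E η e) _
      (changeFunctional_mem π E ⟨ψ, hψ⟩ e), fun φ hφ c ξ b => ?_⟩
    have := (he _ (Finset.mem_image_of_mem _ hφ)).2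
    rw [theta_change_apply, changeFunctional_mk, theta_apply, E.functional_rmul φ.1 φ.2, map_mul]
    calc c * π.toFun (φ.1 η) * (e * (e * π.toFun (ψ ξ) * b))
        = c * (π.toFun (φ.1 η) * e * e) * π.toFun (ψ ξ) * b := by simp only [mul_assoc]
      _ = _ := by rw [this, this]; simp only [mul_assoc]

theorem change_hom_ext {M : Type*} [AddCommGroup M] [Module ℂ M]
    {f h : ((E ⊗[ℂ] B) ⧸ changeRel π E) →ₗ[ℂ] M}
    (H : ∀ ξ b, f (changeMk π E ξ b) = h (changeMk π E ξ b)) : f = h := by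
  refine LinearMap.ext fun x => ?_
  induction x using change_induction with
  | h0 => simp
  | hadd x y hx hy => rw [map_add, hx, hy, map_add]
  | hmk ξ b => exact H ξ b

theorem change_locallyUnital (hB : B.HasApproxUnit) (hE : E.LocallyUnital) :
    (change π E).LocallyUnital := by
  classical
  refine LocallyUnital.of_span (X := {x | ∃ ξ b, x = changeMk π E ξ b}) (fun x => ?_) le_rfl
    (fun s hs => ?_) (fun s hs => ?_)
  · induction x using change_induction with
    | h0 => exact Submodule.zero_mem _
    | hadd x y hx hy => exact Submodule.add_mem _ hx hy
    | hmk ξ b => exact Submodule.subset_span ⟨ξ, b, rfl⟩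
  · choose! ξ b h using hs
    obtain ⟨T, hT, hfix⟩ := hE.exists_left_finset (s.image ξ)
    obtain ⟨S, hS, hST⟩ := exists_compact_change_left π E hB hT (s.image ξ)
    refine ⟨S, hS, fun x hx => ?_⟩
    have hξ := Finset.mem_image_of_mem ξ hx
    rw [h hx, hST _ hξ, hfix _ hξ]
  · choose! φ c h using hs
    obtain ⟨T, hT, hfix⟩ := hE.exists_right_finset (s.image φ)
    obtain ⟨S, hS, hST⟩ := exists_compact_change_right π E hB hT (s.image φ)
    refine ⟨S, hS, fun χ hχ => change_hom_ext π E fun ξ b => ?_⟩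
    have hφ := Finset.mem_image_of_mem φ hχ
    rw [h hχ]
    refine (hST _ hφ _ _ _).trans ?_
    rw [changeFunctional_mk, ← LinearMap.comp_apply, hfix _ hφ]

variable {E}

/-- Coordinatewise application of `π`. -/
noncomputable def mapCoeff (n : Type u) : (n →₀ A) →ₗ[ℂ] (n →₀ B) :=
  Finsupp.mapRange.linearMap (π.toFun : A →ₗ[ℂ] B)

theorem mapCoeff_apply (n : Type u) (x : n →₀ A) (i : n) : mapCoeff π n x i = π.toFun (x i) := by
  simp [mapCoeff]

theorem mapCoeff_single (n : Type u) (i : n) (a : A) :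
    mapCoeff π n (Finsupp.single i a) = Finsupp.single i (π.toFun a) := by
  simp [mapCoeff]

theorem mapCoeff_tensorAct {n : Type u} (μ : Representation ℂ G (n →₀ ℂ)) (g : G) (x : n →₀ A) :
    mapCoeff π n (tensorAct A μ g x) = tensorAct B μ g (mapCoeff π n x) := by
  induction x using Finsupp.induction_linear with
  | zero => simp
  | add x y hx hy => simp only [map_add, hx, hy]
  | single j a =>
    ext i
    rw [mapCoeff_apply, mapCoeff_single, tensorAct_single, tensorAct_single, map_smul, π.map_act]

theorem row_mapCoeff (n : Type u) (b x : n →₀ A) :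
    row B n (mapCoeff π n b) (mapCoeff π n x) = π.toFun (row A n b x) := by
  induction b using Finsupp.induction_linear with
  | zero => simp
  | add x y hx hy => simp only [map_add, LinearMap.add_apply, hx, hy]
  | single j a => rw [mapCoeff_single, row_single, row_single, mapCoeff_apply, map_mul]

/-- Coordinatewise left multiplication. -/
noncomputable def freeLmul (A : GAlgebra.{u, v} G) (n : Type u) (c : A) :
    (n →₀ A) →ₗ[ℂ] (n →₀ A) :=
  Finsupp.mapRange.linearMap (LinearMap.mulLeft ℂ c)

theorem freeLmul_apply (n : Type u) (c : A) (x : n →₀ A) (i : n) :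
    freeLmul A n c x i = c * x i := by
  simp [freeLmul]

theorem row_freeLmul (n : Type u) (c : A) (b x : n →₀ A) :
    row A n (freeLmul A n c b) x = c * row A n b x := by
  induction b using Finsupp.induction_linear with
  | zero => simp
  | add x y hx hy => simp only [map_add, LinearMap.add_apply, hx, hy, mul_add]
  | single j a =>
    rw [freeLmul, Finsupp.mapRange.linearMap_apply, Finsupp.mapRange_single, row_single,
      row_single, LinearMap.mulLeft_apply, mul_assoc]

/-- The map `ξ ⊗ b ↦ π(U ξ) b` from `E ⊗_π B` to `B^n`. -/
noncomputable def changeMap {n : Type u} (U : E →ₗ[ℂ] n →₀ A)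
    (hU : ∀ ξ a, U (E.rmul ξ a) = freeMul A n (U ξ) a) :
    ((E ⊗[ℂ] B) ⧸ changeRel π E) →ₗ[ℂ] (n →₀ B) :=
  (changeRel π E).liftQ (TensorProduct.lift (freeMul B n ∘ₗ mapCoeff π n ∘ₗ U)) (by
    refine Submodule.span_le.2 ?_
    rintro _ ⟨ξ, a, b, rfl⟩
    change TensorProduct.lift (freeMul B n ∘ₗ mapCoeff π n ∘ₗ U) _ = 0
    rw [map_sub, TensorProduct.lift.tmul, TensorProduct.lift.tmul, sub_eq_zero]
    ext i
    simp [hU, mapCoeff_apply, mul_assoc])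

theorem changeMap_mk {n : Type u} (U : E →ₗ[ℂ] n →₀ A)
    (hU : ∀ ξ a, U (E.rmul ξ a) = freeMul A n (U ξ) a) (ξ : E) (b : B) :
    changeMap π U hU (changeMk π E ξ b) = freeMul B n (mapCoeff π n (U ξ)) b := by
  simp only [changeMap, changeMk, Submodule.mkQ_apply]
  rfl

theorem changeMap_rmul {n : Type u} (U : E →ₗ[ℂ] n →₀ A)
    (hU : ∀ ξ a, U (E.rmul ξ a) = freeMul A n (U ξ) a) (x : (E ⊗[ℂ] B) ⧸ changeRel π E) (c : B) :
    changeMap π U hU (changeMul π E x c) = freeMul B n (changeMap π U hU x) c := by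
  induction x using change_induction with
  | h0 => simp
  | hadd x y hx hy => simp only [map_add, LinearMap.add_apply, hx, hy]
  | hmk ξ b =>
    rw [changeMul_mk, changeMap_mk, changeMap_mk]
    ext i
    simp [mul_assoc]

theorem changeMap_act {n : Type u} {μ : Representation ℂ G (n →₀ ℂ)} (U : E →ₗ[ℂ] n →₀ A)
    (hU : ∀ ξ a, U (E.rmul ξ a) = freeMul A n (U ξ) a)
    (hact : ∀ g ξ, U (E.act g ξ) = tensorAct A μ g (U ξ))
    (g : G) (x : (E ⊗[ℂ] B) ⧸ changeRel π E) :
    changeMap π U hU (changeAct π E g x) = tensorAct B μ g (changeMap π U hU x) := by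
  induction x using change_induction with
  | h0 => simp
  | hadd x y hx hy => simp only [map_add, hx, hy]
  | hmk ξ b =>
    rw [changeAct_mk, changeMap_mk, changeMap_mk, hact, mapCoeff_tensorAct, tensorAct_freeMul]

theorem changeMap_pairing {n : Type u} {μ : Representation ℂ G (n →₀ ℂ)} (U : RowExtension E n μ)
    (φ : E.functionals) (c : B) (x : (E ⊗[ℂ] B) ⧸ changeRel π E) :
    row B n (freeLmul B n c (mapCoeff π n (U.coeff φ))) (changeMap π U.toFun U.map_rmul x)
      = changeFunctional π E φ c x := by
  induction x using change_induction with
  | h0 => simp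
  | hadd x y hx hy => simp only [map_add, hx, hy]
  | hmk ξ b =>
    rw [changeFunctional_mk, changeMap_mk, row_freeLmul, row_freeMul, row_mapCoeff, U.pairing,
      mul_assoc]

/-- The extension sends ξ ⊗ b to π(Uξ) b coordinatewise, and φ ⊗ c to the row c π(b_i), where b is
the row of φ. -/
theorem change_inClassC (hB : B.HasApproxUnit) (hE : E.InClassC) : (change π E).InClassC := by
  classical
  obtain ⟨n, μ, hμ, ⟨U⟩⟩ := hE.exists_rowExtension
  have hA := hE.approxUnit
  obtain ⟨W⟩ := RowExtension.exists_of_family (E := change π E) (μ := μ) hB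
    (changeMap π U.toFun U.map_rmul) (changeMap_rmul π _ _) (changeMap_act π _ _ U.map_act)
    (fun j : E.functionals × B => changeFunctional π E j.1 j.2)
    (fun j => freeLmul B n j.2 (mapCoeff π n (U.coeff j.1)))
    (by
      refine congrArg (Submodule.span ℂ) (Set.ext fun χ => ⟨?_, ?_⟩)
      · rintro ⟨φ, c, rfl⟩
        exact ⟨(φ, c), rfl⟩
      · rintro ⟨⟨φ, c⟩, rfl⟩
        exact ⟨φ, c, rfl⟩)
    (fun j x => changeMap_pairing π U j.1 j.2 x)
    (fun g ⟨φ, c⟩ => by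
      refine ⟨⟨E.dualAct g φ, B.act g c⟩, fun x => ?_, fun x => ?_⟩
      · change changeFunctional π E _ _ x = B.act g (changeFunctional π E φ c (changeAct π E g⁻¹ x))
        induction x using change_induction with
        | h0 => simp
        | hadd x y hx hy => simp only [map_add, hx, hy]
        | hmk ξ b =>
          rw [changeAct_mk, changeFunctional_mk, changeFunctional_mk, B.act_mul, B.act_mul,
            rep_inv_apply, ← π.map_act]
          rfl
      · simp only [row_freeLmul]
        rw [B.act_mul]
        congr 1
        induction x using Finsupp.induction_linear with
        | zero => simp
        | add x y hx hy => simp only [map_add, hx, hy]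
        | single j d =>
          -- Vectors of B^n need not come from A^n, so equivariance over A cannot simply be pushed
          -- forward by π; the explicit formula for the transformed coefficients can.
          rw [row_single_right, mapCoeff_apply, U.coeff_act_apply hA]
          generalize U.coeff φ = b
          induction b using Finsupp.induction_linear with
          | zero => simp
          | add x y hx hy =>
            rw [Finsupp.sum_add_index' (by simp) (by simp), map_add, add_mul, hx, hy]
            simp
          | single i b =>
            rw [Finsupp.sum_single_index (by simp), mapCoeff_single, row_single, tensorAct_single,
              B.act_mul, map_smul, map_smul, rep_inv_apply, π.map_act, mul_smul_comm,
              smul_mul_assoc])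
    (X := Set.univ) (by simp)
    (fun s i x _ => by
      -- Approximating e in coordinate i by ξ yields φ(ξ) = b_i e = b_i for the relevant rows b, so
      -- ξ ⊗ x reproduces c π(b_i) x.
      obtain ⟨e, he⟩ := hA.exists_unit_finset (s.image fun j => U.coeff j.1 i)
      obtain ⟨ξ, hξ⟩ := U.approx (s.image Prod.fst) (Finsupp.single i e)
      refine ⟨changeMk π E ξ x, fun ⟨φ, c⟩ hj => Eq.trans ?_
        (changeFunctional_mk π E φ c ξ x).symm⟩
      rw [ ← hξ φ (Finset.mem_image_of_mem _ hj), row_single_right,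
        (he _ (Finset.mem_image_of_mem _ hj)).2, freeLmul_apply, mapCoeff_apply])
  exact .of_rowExtension hB (change_locallyUnital π E hB hE.locallyUnital) hμ W

end Change

end FunctionalModule

/-! ### Tensor products of coefficient algebras. -/

namespace GAlgebra

variable {G : Type v} [Group G] {A B : GAlgebra.{u, v} G}

/-- The bilinear map `(a, b) ↦ a ⊗ b`. -/
noncomputable def tmul (A B : GAlgebra.{u, v} G) : A →ₗ[ℂ] B →ₗ[ℂ] A.tensor B :=
  TensorProduct.mk ℂ A B

theorem tmul_mul_tmul (a a' : A) (b b' : B) :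
    tmul A B a b * tmul A B a' b' = tmul A B (a * a') (b * b') :=
  Algebra.TensorProduct.tmul_mul_tmul a a' b b'

theorem act_tmul (g : G) (a : A) (b : B) :
    (A.tensor B).act g (tmul A B a b) = tmul A B (A.act g a) (B.act g b) := rfl

theorem mem_span_tmul (x : A.tensor B) :
    x ∈ Submodule.span ℂ {x : A.tensor B | ∃ a b, x = tmul A B a b} := by
  induction (show A ⊗[ℂ] B from x) with
  | zero => exact Submodule.zero_mem _
  | add x y hx hy => exact Submodule.add_mem _ hx hy
  | tmul a b => exact Submodule.subset_span ⟨a, b, rfl⟩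

theorem tensor_induction {p : A.tensor B → Prop} (x : A.tensor B) (h0 : p 0)
    (hadd : ∀ x y, p x → p y → p (x + y)) (hmk : ∀ a b, p (tmul A B a b)) : p x :=
  TensorProduct.induction_on (motive := p) x h0 hmk hadd

/-- Finitely many elementary tensors have a common unit e ⊗ f, and elementary tensors span. -/
theorem HasApproxUnit.tensor (hA : A.HasApproxUnit) (hB : B.HasApproxUnit) :
    (A.tensor B).HasApproxUnit := by
  classical
  have key : ∀ s : Finset (A.tensor B), (↑s ⊆ {x : A.tensor B | ∃ a b, x = tmul A B a b}) →
      ∃ e : A.tensor B, ∀ x ∈ s, e * x = x ∧ x * e = x := by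
    intro s hs
    choose! a b h using hs
    obtain ⟨e, he⟩ := hA.exists_unit_finset (s.image a)
    obtain ⟨f, hf⟩ := hB.exists_unit_finset (s.image b)
    refine ⟨tmul A B e f, fun x hx => ?_⟩
    have h1 := he _ (Finset.mem_image_of_mem a hx)
    have h2 := hf _ (Finset.mem_image_of_mem b hx)
    rw [h hx, tmul_mul_tmul, tmul_mul_tmul, h1.1, h1.2, h2.1, h2.2]
    exact ⟨rfl, rfl⟩
  refine HasApproxUnit.of_local (fun x => ?_) (fun x => ?_)
  · exact exists_fixed_of_span (fun e : A.tensor B => LinearMap.mulLeft ℂ e)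
      (fun s hs => (key s hs).imp fun e he x hx => (he x hx).1) (mem_span_tmul x)
  · exact exists_fixed_of_span (fun e : A.tensor B => LinearMap.mulRight ℂ e)
      (fun s hs => (key s hs).imp fun e he x hx => (he x hx).2) (mem_span_tmul x)

end GAlgebra

namespace FunctionalModule

variable {G : Type v} [Group G] {A B : GAlgebra.{u, v} G}

/-! ### External tensor products -/

section Tensor

variable (E : FunctionalModule A) (F : FunctionalModule B)

/-- The bilinear map `(ξ, η) ↦ ξ ⊗ η`. -/
noncomputable def tmul : E →ₗ[ℂ] F →ₗ[ℂ] E.tensor F := TensorProduct.mk ℂ E F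

theorem rmul_tmul (ξ : E) (η : F) (a : A) (b : B) : (E.tensor F).rmul (tmul E F ξ η)
    (GAlgebra.tmul A B a b) = tmul E F (E.rmul ξ a) (F.rmul η b) := rfl

theorem act_tmul (g : G) (ξ : E) (η : F) :
    (E.tensor F).act g (tmul E F ξ η) = tmul E F (E.act g ξ) (F.act g η) := rfl

variable {E F} in
theorem tensor_induction {p : E.tensor F → Prop} (x : E.tensor F) (h0 : p 0)
    (hadd : ∀ x y, p x → p y → p (x + y)) (hmk : ∀ ξ η, p (tmul E F ξ η)) : p x :=
  TensorProduct.induction_on (motive := p) x h0 hmk hadd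

variable {E F} in
theorem tensor_hom_ext {M : Type*} [AddCommGroup M] [Module ℂ M] {f h : E.tensor F →ₗ[ℂ] M}
    (H : ∀ ξ η, f (tmul E F ξ η) = h (tmul E F ξ η)) : f = h := by
  refine LinearMap.ext fun x => ?_
  induction x using tensor_induction with
  | h0 => simp
  | hadd x y hx hy => rw [map_add, hx, hy, map_add]
  | hmk ξ η => exact H ξ η

variable {E F} in
/-- The operator `S ⊗ T` on `E ⊗ F`. -/
noncomputable def mapEnd (S : Module.End ℂ E) (T : Module.End ℂ F) : Module.End ℂ (E.tensor F) :=
  TensorProduct.map S T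

variable {E F} in
theorem mapEnd_tmul (S : Module.End ℂ E) (T : Module.End ℂ F) (ξ : E) (η : F) :
    mapEnd S T (tmul E F ξ η) = tmul E F (S ξ) (T η) := rfl

variable {E F} in
/-- The functional `φ ⊗ ψ` on `E ⊗ F`. -/
noncomputable def mapFunctional (φ : E →ₗ[ℂ] A) (ψ : F →ₗ[ℂ] B) : E.tensor F →ₗ[ℂ] A.tensor B :=
  TensorProduct.map φ ψ

variable {E F} in
theorem mapFunctional_tmul (φ : E →ₗ[ℂ] A) (ψ : F →ₗ[ℂ] B) (ξ : E) (η : F) :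
    mapFunctional φ ψ (tmul E F ξ η) = GAlgebra.tmul A B (φ ξ) (ψ η) := rfl

theorem mapFunctional_mem {φ : E →ₗ[ℂ] A} (hφ : φ ∈ E.functionals) {ψ : F →ₗ[ℂ] B}
    (hψ : ψ ∈ F.functionals) : mapFunctional φ ψ ∈ (E.tensor F).functionals := by
  have h : TensorProduct.map φ ψ ∈ Submodule.span ℂ
      {χ | ∃ φ ∈ E.functionals, ∃ ψ ∈ F.functionals, χ = TensorProduct.map φ ψ} :=
    Submodule.subset_span ⟨φ, hφ, ψ, hψ, rfl⟩
  exact h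

/-- θ_{η,φ} ⊗ θ_{ζ,ψ} = θ_{η⊗ζ, φ⊗ψ}. -/
theorem mapEnd_mem_compact {S : Module.End ℂ E} (hS : S ∈ E.compactSubalgebra)
    {T : Module.End ℂ F} (hT : T ∈ F.compactSubalgebra) :
    mapEnd S T ∈ (E.tensor F).compactSubalgebra := by
  induction hS using compact_induction with
  | h0 =>
    rw [show mapEnd (0 : Module.End ℂ E) T = 0 from tensor_hom_ext fun ξ η => by
      rw [mapEnd_tmul]; simp]
    exact zero_mem _
  | hadd S S' _ _ hS hS' =>
    rw [show mapEnd (S + S') T = mapEnd S T + mapEnd S' T from tensor_hom_ext fun ξ η => by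
      rw [LinearMap.add_apply, mapEnd_tmul, mapEnd_tmul, mapEnd_tmul]; simp]
    exact add_mem hS hS'
  | htheta η φ hφ =>
    induction hT using compact_induction with
    | h0 =>
      rw [show mapEnd (E.theta η φ) (0 : Module.End ℂ F) = 0 from tensor_hom_ext fun ξ η => by
        rw [mapEnd_tmul]; simp]
      exact zero_mem _
    | hadd T T' _ _ hT hT' =>
      rw [show mapEnd (E.theta η φ) (T + T') = mapEnd (E.theta η φ) T + mapEnd (E.theta η φ) T' from
        tensor_hom_ext fun ξ η => by
          rw [LinearMap.add_apply, mapEnd_tmul, mapEnd_tmul, mapEnd_tmul]; simp]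
      exact add_mem hT hT'
    | htheta ζ ψ hψ =>
      rw [show mapEnd (E.theta η φ) (F.theta ζ ψ)
        = (E.tensor F).theta (tmul E F η ζ) (mapFunctional φ ψ) from tensor_hom_ext fun _ _ => rfl]
      exact theta_mem_compact _ _ _ (mapFunctional_mem E F hφ hψ)

theorem tensor_locallyUnital (hE : E.LocallyUnital) (hF : F.LocallyUnital) :
    (E.tensor F).LocallyUnital := by
  classical
  refine LocallyUnital.of_span (X := {x | ∃ ξ η, x = tmul E F ξ η})
    (Y := {χ | ∃ φ ∈ E.functionals, ∃ ψ ∈ F.functionals, χ = mapFunctional φ ψ})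
    (fun x => ?_) le_rfl (fun s hs => ?_) (fun s hs => ?_)
  · induction x using tensor_induction with
    | h0 => exact Submodule.zero_mem _
    | hadd x y hx hy => exact Submodule.add_mem _ hx hy
    | hmk ξ η => exact Submodule.subset_span ⟨ξ, η, rfl⟩
  · choose! ξ η h using hs
    obtain ⟨S, hS, hξ⟩ := hE.exists_left_finset (s.image ξ)
    obtain ⟨T, hT, hη⟩ := hF.exists_left_finset (s.image η)
    refine ⟨mapEnd S T, mapEnd_mem_compact E F hS hT, fun x hx => ?_⟩
    rw [h hx, mapEnd_tmul, hξ _ (Finset.mem_image_of_mem _ hx),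
      hη _ (Finset.mem_image_of_mem _ hx)]
  · have hs' : ∀ χ ∈ s, ∃ (φ : E.functionals) (ψ : F.functionals),
        χ = mapFunctional φ.1 ψ.1 := fun χ hχ => by
      obtain ⟨φ, hφ, ψ, hψ, e⟩ := hs hχ
      exact ⟨⟨φ, hφ⟩, ⟨ψ, hψ⟩, e⟩
    choose! φ ψ h using hs'
    obtain ⟨S, hS, hφ⟩ := hE.exists_right_finset (s.image φ)
    obtain ⟨T, hT, hψ⟩ := hF.exists_right_finset (s.image ψ)
    refine ⟨mapEnd S T, mapEnd_mem_compact E F hS hT, fun χ hχ => tensor_hom_ext fun ξ η => ?_⟩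
    rw [LinearMap.comp_apply, h χ hχ, mapEnd_tmul, mapFunctional_tmul, mapFunctional_tmul]
    exact congrArg₂ (GAlgebra.tmul A B · ·)
      (LinearMap.congr_fun (hφ _ (Finset.mem_image_of_mem _ hχ)) ξ)
      (LinearMap.congr_fun (hψ _ (Finset.mem_image_of_mem _ hχ)) η)

end Tensor

/-! ### Tensor products of coordinate spaces and representations. -/

section ProdRep

variable {n m : Type u}

/-- The tensor product of linear representations on finitely supported functions. -/
noncomputable def prodRep (μ : Representation ℂ G (n →₀ ℂ)) (ν : Representation ℂ G (m →₀ ℂ)) :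
    Representation ℂ G (n × m →₀ ℂ) where
  toFun g := (finsuppTensorFinsupp' ℂ n m).toLinearMap ∘ₗ TensorProduct.map (μ g) (ν g) ∘ₗ
    (finsuppTensorFinsupp' ℂ n m).symm.toLinearMap
  map_one' := by
    ext1 x
    refine LinearMap.ext fun c => ?_
    simp
  map_mul' g h := by
    ext1 x
    refine LinearMap.ext fun c => ?_
    simp [TensorProduct.map_mul]

theorem prodRep_single (μ : Representation ℂ G (n →₀ ℂ)) (ν : Representation ℂ G (m →₀ ℂ)) (g : G)
    (j i : n) (l k : m) : prodRep μ ν g (Finsupp.single (j, l) 1) (i, k)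
      = μ g (Finsupp.single j 1) i * ν g (Finsupp.single l 1) k := by
  have : (finsuppTensorFinsupp' ℂ n m).symm (Finsupp.single (j, l) 1)
      = Finsupp.single j 1 ⊗ₜ Finsupp.single l 1 := by
    rw [LinearEquiv.symm_apply_eq, finsuppTensorFinsupp'_single_tmul_single, mul_one]
  simp [prodRep, this]

theorem prodRep_rowFinite {μ : Representation ℂ G (n →₀ ℂ)} {ν : Representation ℂ G (m →₀ ℂ)}
    (hμ : RowFinite μ) (hν : RowFinite ν) : RowFinite (prodRep μ ν) := by
  rintro g ⟨i, k⟩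
  refine ((hμ g i).prod (hν g k)).subset ?_
  rintro ⟨j, l⟩ h
  rw [Set.mem_ofPred_eq, prodRep_single] at h
  exact ⟨left_ne_zero_of_mul h, right_ne_zero_of_mul h⟩

/-- The tensor product of coordinate vectors. -/
noncomputable def coeffTmul (A B : GAlgebra.{u, v} G) (n m : Type u) :
    (n →₀ A) →ₗ[ℂ] (m →₀ B) →ₗ[ℂ] (n × m →₀ A.tensor B) :=
  (TensorProduct.mk ℂ (n →₀ A) (m →₀ B)).compr₂ (finsuppTensorFinsupp ℂ ℂ A B n m).toLinearMap

theorem coeffTmul_apply (x : n →₀ A) (y : m →₀ B) (i : n) (k : m) :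
    coeffTmul A B n m x y (i, k) = GAlgebra.tmul A B (x i) (y k) :=
  finsuppTensorFinsupp_apply ℂ ℂ A B n m x y i k

theorem coeffTmul_single (i : n) (k : m) (a : A) (b : B) :
    coeffTmul A B n m (Finsupp.single i a) (Finsupp.single k b)
      = Finsupp.single (i, k) (GAlgebra.tmul A B a b) :=
  finsuppTensorFinsupp_single ℂ ℂ A B n m i a k b

theorem coeffTmul_freeMul (x : n →₀ A) (y : m →₀ B) (a : A) (b : B) :
    freeMul (A.tensor B) (n × m) (coeffTmul A B n m x y) (GAlgebra.tmul A B a b)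
      = coeffTmul A B n m (freeMul A n x a) (freeMul B m y b) := by
  ext ⟨i, k⟩
  rw [freeMul_apply, coeffTmul_apply, coeffTmul_apply, freeMul_apply, freeMul_apply,
    GAlgebra.tmul_mul_tmul]

theorem coeffTmul_tensorAct (μ : Representation ℂ G (n →₀ ℂ)) (ν : Representation ℂ G (m →₀ ℂ))
    (g : G) (x : n →₀ A) (y : m →₀ B) :
    tensorAct (A.tensor B) (prodRep μ ν) g (coeffTmul A B n m x y)
      = coeffTmul A B n m (tensorAct A μ g x) (tensorAct B ν g y) := by
  induction x using Finsupp.induction_linear with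
  | zero => simp
  | add x x' h h' => simp only [map_add, LinearMap.add_apply, h, h']
  | single j a =>
    induction y using Finsupp.induction_linear with
    | zero => simp
    | add x x' h h' => simp only [map_add, h, h']
    | single l b =>
      ext ⟨i, k⟩
      rw [coeffTmul_single, tensorAct_single, coeffTmul_apply, tensorAct_single, tensorAct_single,
        prodRep_single, GAlgebra.act_tmul, map_smul, map_smul, LinearMap.smul_apply, smul_smul,
        mul_comm]

theorem row_coeffTmul (b x : n →₀ A) (c y : m →₀ B) :
    row (A.tensor B) (n × m) (coeffTmul A B n m b c) (coeffTmul A B n m x y)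
      = GAlgebra.tmul A B (row A n b x) (row B m c y) := by
  induction b using Finsupp.induction_linear with
  | zero => simp
  | add b b' h h' => simp only [map_add, LinearMap.add_apply, h, h']
  | single i b =>
    induction c using Finsupp.induction_linear with
    | zero => simp
    | add c c' h h' => simp only [map_add, LinearMap.add_apply, h, h']
    | single k c =>
      rw [coeffTmul_single, row_single, row_single, row_single, coeffTmul_apply,
        GAlgebra.tmul_mul_tmul]

/-- Vectors with one nonzero coordinate a ⊗ b are tensor products of such vectors, so additive
identities on (A ⊗ B)^{n × m} can be tested on tensor products of coordinate vectors. -/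
theorem coeffTmul_induction {p : (n × m →₀ A.tensor B) → Prop} (x : n × m →₀ A.tensor B) (h0 : p 0)
    (hadd : ∀ x y, p x → p y → p (x + y)) (hmk : ∀ x y, p (coeffTmul A B n m x y)) : p x := by
  induction x using Finsupp.induction_linear with
  | zero => exact h0
  | add x y hx hy => exact hadd _ _ hx hy
  | single i a =>
    obtain ⟨i, k⟩ := i
    induction a using GAlgebra.tensor_induction with
    | h0 => rw [Finsupp.single_zero]; exact h0
    | hadd a b ha hb => rw [Finsupp.single_add]; exact hadd _ _ ha hb
    | hmk a b => rw [← coeffTmul_single]; exact hmk _ _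

end ProdRep

/-! ### The extension of an external tensor product. -/

section TensorExtension

variable {E : FunctionalModule A} {F : FunctionalModule B} {n m : Type u}

/-- The tensor product of two coordinate maps. -/
noncomputable def tensorMap (U : E →ₗ[ℂ] n →₀ A) (V : F →ₗ[ℂ] m →₀ B) :
    E.tensor F →ₗ[ℂ] (n × m →₀ A.tensor B) :=
  TensorProduct.lift ((coeffTmul A B n m).compl₁₂ U V)

theorem tensorMap_tmul (U : E →ₗ[ℂ] n →₀ A) (V : F →ₗ[ℂ] m →₀ B) (ξ : E) (η : F) :
    tensorMap U V (tmul E F ξ η) = coeffTmul A B n m (U ξ) (V η) := rfl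

theorem tensor_inClassC (hE : E.InClassC) (hF : F.InClassC) : (E.tensor F).InClassC := by
  classical
  obtain ⟨n, μ, hμ, ⟨U⟩⟩ := hE.exists_rowExtension
  obtain ⟨m, ν, hν, ⟨V⟩⟩ := hF.exists_rowExtension
  have hAB := hE.approxUnit.tensor hF.approxUnit
  obtain ⟨W⟩ := RowExtension.exists_of_family (E := E.tensor F) (μ := prodRep μ ν) hAB
    (tensorMap U.toFun V.toFun)
    (fun x a => by
      induction x using tensor_induction with
      | h0 => simp
      | hadd x y hx hy => simp only [map_add, LinearMap.add_apply, hx, hy]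
      | hmk ξ η =>
        induction a using GAlgebra.tensor_induction with
        | h0 => simp
        | hadd x y hx hy => simp only [map_add, hx, hy]
        | hmk a b =>
          rw [rmul_tmul, tensorMap_tmul, tensorMap_tmul, U.map_rmul, V.map_rmul,
            coeffTmul_freeMul])
    (fun g x => by
      induction x using tensor_induction with
      | h0 => simp
      | hadd x y hx hy => simp only [map_add, hx, hy]
      | hmk ξ η =>
        rw [act_tmul, tensorMap_tmul, tensorMap_tmul, U.map_act, V.map_act, coeffTmul_tensorAct])
    (fun j : E.functionals × F.functionals => mapFunctional j.1.1 j.2.1)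
    (fun j => coeffTmul A B n m (U.coeff j.1) (V.coeff j.2))
    (by
      refine congrArg (Submodule.span ℂ) (Set.ext fun χ => ⟨?_, ?_⟩)
      · rintro ⟨φ, hφ, ψ, hψ, rfl⟩
        exact ⟨(⟨φ, hφ⟩, ⟨ψ, hψ⟩), rfl⟩
      · rintro ⟨⟨φ, ψ⟩, rfl⟩
        exact ⟨φ.1, φ.2, ψ.1, ψ.2, rfl⟩)
    (fun ⟨φ, ψ⟩ x => by
      induction x using tensor_induction with
      | h0 => simp
      | hadd x y hx hy => simp only [map_add, hx, hy]
      | hmk ξ η => rw [tensorMap_tmul, row_coeffTmul, U.pairing, V.pairing, mapFunctional_tmul])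
    (fun g ⟨φ, ψ⟩ => by
      refine ⟨⟨E.dualAct g φ, F.dualAct g ψ⟩, fun x => ?_, fun x => ?_⟩
      · induction x using tensor_induction with
        | h0 => simp
        | hadd x y hx hy => simp only [map_add, hx, hy]
        | hmk ξ η => rfl
      · induction x using coeffTmul_induction with
        | h0 => simp
        | hadd x y hx hy => simp only [map_add, hx, hy]
        | hmk x y =>
          rw [row_coeffTmul, coeffTmul_tensorAct, row_coeffTmul, GAlgebra.act_tmul, U.coeff_act,
            V.coeff_act])
    -- Approximation is checked only for coordinates a ⊗ b: approximating a by ξ and b by η, the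
    -- vector ξ ⊗ η works for all the φ ⊗ ψ in s, since each such functional multiplies the two
    -- approximations.
    GAlgebra.mem_span_tmul
    (fun s ⟨i, k⟩ x hx => by
      obtain ⟨a, b, rfl⟩ := hx
      obtain ⟨ξ, hξ⟩ := U.approx (s.image Prod.fst) (Finsupp.single i a)
      obtain ⟨η, hη⟩ := V.approx (s.image Prod.snd) (Finsupp.single k b)
      refine ⟨tmul E F ξ η, fun ⟨φ, ψ⟩ hj => ?_⟩
      rw [mapFunctional_tmul, ← hξ φ (Finset.mem_image_of_mem Prod.fst hj),
        ← hη ψ (Finset.mem_image_of_mem Prod.snd hj), row_single_right, row_single_right,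
        coeffTmul_apply, GAlgebra.tmul_mul_tmul])
  exact .of_rowExtension hAB (tensor_locallyUnital E F hE.locallyUnital hF.locallyUnital)
    (prodRep_rowFinite hμ hν) W

end TensorExtension

/-! ### Extensions of `E ⊕ A` -/

section Prod

variable {n m : Type u}

/-- The direct sum of two linear representations on finitely supported functions. -/
noncomputable def sumRep (μ : Representation ℂ G (n →₀ ℂ)) (ν : Representation ℂ G (m →₀ ℂ)) :
    Representation ℂ G (n ⊕ m →₀ ℂ) where
  toFun g := (Finsupp.sumFinsuppLEquivProdFinsupp ℂ).symm.toLinearMap ∘ₗ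
    (μ g).prodMap (ν g) ∘ₗ (Finsupp.sumFinsuppLEquivProdFinsupp ℂ).toLinearMap
  map_one' := by
    ext1 x
    refine LinearMap.ext fun c => ?_
    simp
  map_mul' g h := by
    ext1 x
    refine LinearMap.ext fun c => ?_
    simp

/-- The combination of two coordinate vectors. -/
noncomputable def sumCoeff (X : Type*) [AddCommGroup X] [Module ℂ X] (n m : Type u) :
    ((n →₀ X) × (m →₀ X)) ≃ₗ[ℂ] (n ⊕ m →₀ X) :=
  (Finsupp.sumFinsuppLEquivProdFinsupp ℂ).symm

theorem sumCoeff_inl {X : Type*} [AddCommGroup X] [Module ℂ X] (x : n →₀ X) (y : m →₀ X) (i : n) :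
    sumCoeff X n m (x, y) (Sum.inl i) = x i :=
  Finsupp.sumFinsuppLEquivProdFinsupp_symm_inl ℂ (x, y) i

theorem sumCoeff_inr {X : Type*} [AddCommGroup X] [Module ℂ X] (x : n →₀ X) (y : m →₀ X) (i : m) :
    sumCoeff X n m (x, y) (Sum.inr i) = y i :=
  Finsupp.sumFinsuppLEquivProdFinsupp_symm_inr ℂ (x, y) i

theorem sumCoeff_single_inl {X : Type*} [AddCommGroup X] [Module ℂ X] (i : n) (x : X) :
    sumCoeff X n m (Finsupp.single i x, 0) = Finsupp.single (Sum.inl i) x := by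
  classical
  ext (j | j)
  · rw [sumCoeff_inl, Finsupp.single_apply, Finsupp.single_apply]
    simp
  · rw [sumCoeff_inr]
    simp

theorem sumCoeff_single_inr {X : Type*} [AddCommGroup X] [Module ℂ X] (i : m) (x : X) :
    sumCoeff X n m (0, Finsupp.single i x) = Finsupp.single (Sum.inr i) x := by
  classical
  ext (j | j)
  · rw [sumCoeff_inl]
    simp
  · rw [sumCoeff_inr, Finsupp.single_apply, Finsupp.single_apply]
    simp

theorem sumCoeff_induction {X : Type*} [AddCommGroup X] [Module ℂ X] {p : (n ⊕ m →₀ X) → Prop}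
    (z : n ⊕ m →₀ X) (h : ∀ x y, p (sumCoeff X n m (x, y))) : p z := by
  rw [← (sumCoeff X n m).apply_symm_apply z]
  exact h _ _

theorem sumRep_sumCoeff (μ : Representation ℂ G (n →₀ ℂ)) (ν : Representation ℂ G (m →₀ ℂ)) (g : G)
    (x : n →₀ ℂ) (y : m →₀ ℂ) :
    sumRep μ ν g (sumCoeff ℂ n m (x, y)) = sumCoeff ℂ n m (μ g x, ν g y) := by
  simp [sumRep, sumCoeff]

theorem sumRep_rowFinite {μ : Representation ℂ G (n →₀ ℂ)} {ν : Representation ℂ G (m →₀ ℂ)}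
    (hμ : RowFinite μ) (hν : RowFinite ν) : RowFinite (sumRep μ ν) := by
  rintro g (i | i)
  · refine ((hμ g i).image Sum.inl).subset ?_
    rintro (j | j) h
    · rw [Set.mem_ofPred_eq, ← sumCoeff_single_inl, sumRep_sumCoeff, sumCoeff_inl] at h
      exact ⟨j, h, rfl⟩
    · rw [Set.mem_ofPred_eq, ← sumCoeff_single_inr, sumRep_sumCoeff, sumCoeff_inl] at h
      simp at h
  · refine ((hν g i).image Sum.inr).subset ?_
    rintro (j | j) h
    · rw [Set.mem_ofPred_eq, ← sumCoeff_single_inl, sumRep_sumCoeff, sumCoeff_inr] at h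
      simp at h
    · rw [Set.mem_ofPred_eq, ← sumCoeff_single_inr, sumRep_sumCoeff, sumCoeff_inr] at h
      exact ⟨j, h, rfl⟩

theorem tensorAct_sumCoeff (μ : Representation ℂ G (n →₀ ℂ)) (ν : Representation ℂ G (m →₀ ℂ))
    (g : G) (x : n →₀ A) (y : m →₀ A) : tensorAct A (sumRep μ ν) g (sumCoeff A n m (x, y))
      = sumCoeff A n m (tensorAct A μ g x, tensorAct A ν g y) := by
  have hx : tensorAct A (sumRep μ ν) g (sumCoeff A n m (x, 0))
      = sumCoeff A n m (tensorAct A μ g x, 0) := by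
    induction x using Finsupp.induction_linear with
    | zero => simp only [map_zero, Prod.mk_zero_zero]
    | add x x' h h' =>
      have e : ∀ z z' : n →₀ A, ((z + z', 0) : (n →₀ A) × (m →₀ A)) = (z, 0) + (z', 0) := by simp
      rw [map_add, e, e, map_add, map_add, map_add, h, h']
    | single j a =>
      ext (i | i)
      · rw [sumCoeff_inl, sumCoeff_single_inl, tensorAct_single, ← sumCoeff_single_inl,
          sumRep_sumCoeff, sumCoeff_inl, tensorAct_single]
      · rw [sumCoeff_inr, sumCoeff_single_inl, tensorAct_single, ← sumCoeff_single_inl,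
          sumRep_sumCoeff, sumCoeff_inr]
        simp
  have hy : tensorAct A (sumRep μ ν) g (sumCoeff A n m (0, y))
      = sumCoeff A n m (0, tensorAct A ν g y) := by
    induction y using Finsupp.induction_linear with
    | zero => simp only [map_zero, Prod.mk_zero_zero]
    | add x x' h h' =>
      have e : ∀ z z' : m →₀ A, ((0, z + z') : (n →₀ A) × (m →₀ A)) = (0, z) + (0, z') := by simp
      rw [map_add, e, e, map_add, map_add, map_add, h, h']
    | single j a =>
      ext (i | i)
      · rw [sumCoeff_inl, sumCoeff_single_inr, tensorAct_single, ← sumCoeff_single_inr,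
          sumRep_sumCoeff, sumCoeff_inl]
        simp
      · rw [sumCoeff_inr, sumCoeff_single_inr, tensorAct_single, ← sumCoeff_single_inr,
          sumRep_sumCoeff, sumCoeff_inr, tensorAct_single]
  have e : ∀ (z : n →₀ A) (z' : m →₀ A), ((z, z') : (n →₀ A) × (m →₀ A)) = (z, 0) + (0, z') := by
    simp
  rw [e, map_add, map_add, hx, hy, ← map_add, ← e]

theorem row_sumCoeff (b x : n →₀ A) (c y : m →₀ A) :
    row A (n ⊕ m) (sumCoeff A n m (b, c)) (sumCoeff A n m (x, y)) = row A n b x + row A m c y := by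
  have hb : row A (n ⊕ m) (sumCoeff A n m (b, 0)) (sumCoeff A n m (x, y)) = row A n b x := by
    induction b using Finsupp.induction_linear with
    | zero => simp only [Prod.mk_zero_zero, map_zero, LinearMap.zero_apply]
    | add z z' h h' =>
      rw [show ((z + z', 0) : (n →₀ A) × (m →₀ A)) = (z, 0) + (z', 0) by simp, map_add, map_add,
        map_add, LinearMap.add_apply, h, h', LinearMap.add_apply]
    | single i a => rw [sumCoeff_single_inl, row_single, row_single, sumCoeff_inl]
  have hc : row A (n ⊕ m) (sumCoeff A n m (0, c)) (sumCoeff A n m (x, y)) = row A m c y := by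
    induction c using Finsupp.induction_linear with
    | zero => simp only [Prod.mk_zero_zero, map_zero, LinearMap.zero_apply]
    | add z z' h h' =>
      rw [show ((0, z + z') : (n →₀ A) × (m →₀ A)) = (0, z) + (0, z') by simp, map_add, map_add,
        map_add, LinearMap.add_apply, h, h', LinearMap.add_apply]
    | single i a => rw [sumCoeff_single_inr, row_single, row_single, sumCoeff_inr]
  rw [show ((b, c) : (n →₀ A) × (m →₀ A)) = (b, 0) + (0, c) by simp, map_add, map_add,
    LinearMap.add_apply, hb, hc]

/-- The functional on `E ⊕ F` given by a functional on one summand. -/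
def prodFunctional (E F : FunctionalModule A) : E.functionals ⊕ F.functionals → (E × F →ₗ[ℂ] A)
  | .inl φ => φ.1 ∘ₗ LinearMap.fst ℂ E F
  | .inr ψ => ψ.1 ∘ₗ LinearMap.snd ℂ E F

theorem sup_eq_span_prodFunctional (E F : FunctionalModule A) :
    E.functionals.map (LinearMap.lcomp ℂ A (LinearMap.fst ℂ E F)) ⊔
      F.functionals.map (LinearMap.lcomp ℂ A (LinearMap.snd ℂ E F))
      = Submodule.span ℂ (Set.range (prodFunctional E F)) := by
  refine le_antisymm (sup_le ?_ ?_) (Submodule.span_le.2 ?_)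
  · rintro _ ⟨φ, hφ, rfl⟩
    exact Submodule.subset_span ⟨.inl ⟨φ, hφ⟩, rfl⟩
  · rintro _ ⟨φ, hφ, rfl⟩
    exact Submodule.subset_span ⟨.inr ⟨φ, hφ⟩, rfl⟩
  · rintro _ ⟨φ | φ, rfl⟩
    · exact Submodule.mem_sup_left ⟨φ.1, φ.2, rfl⟩
    · exact Submodule.mem_sup_right ⟨φ.1, φ.2, rfl⟩

theorem RowExtension.prod (hA : A.HasApproxUnit) {E F : FunctionalModule A}
    {μ : Representation ℂ G (n →₀ ℂ)} {ν : Representation ℂ G (m →₀ ℂ)} (U : RowExtension E n μ)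
    (V : RowExtension F m ν) : Nonempty (RowExtension (E.prod F) (n ⊕ m) (sumRep μ ν)) := by
  classical
  refine RowExtension.exists_of_family (E := E.prod F) hA
    ((sumCoeff A n m).toLinearMap ∘ₗ U.toFun.prodMap V.toFun)
    (fun ξ a => ?_) (fun g ξ => ?_) (prodFunctional E F)
    (Sum.elim (fun φ => sumCoeff A n m (U.coeff φ, 0)) fun ψ => sumCoeff A n m (0, V.coeff ψ))
    (sup_eq_span_prodFunctional E F) ?_ (fun g j => ?_) (X := Set.univ) (by simp) ?_
  · obtain ⟨ξ, η⟩ := ξ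
    change sumCoeff A n m (U.toFun (E.rmul ξ a), V.toFun (F.rmul η a))
      = freeMul A (n ⊕ m) (sumCoeff A n m (U.toFun ξ, V.toFun η)) a
    rw [U.map_rmul, V.map_rmul]
    ext (i | i)
    · rw [freeMul_apply, sumCoeff_inl, sumCoeff_inl, freeMul_apply]
    · rw [freeMul_apply, sumCoeff_inr, sumCoeff_inr, freeMul_apply]
  · obtain ⟨ξ, η⟩ := ξ
    change sumCoeff A n m (U.toFun (E.act g ξ), V.toFun (F.act g η))
      = tensorAct A (sumRep μ ν) g (sumCoeff A n m (U.toFun ξ, V.toFun η))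
    rw [U.map_act, V.map_act, tensorAct_sumCoeff]
  · rintro (φ | ψ) ⟨ξ, η⟩
    · change row A _ (sumCoeff A n m (U.coeff φ, 0)) (sumCoeff A n m (U.toFun ξ, V.toFun η))
        = φ.1 ξ
      rw [row_sumCoeff, U.pairing]
      simp
    · change row A _ (sumCoeff A n m (0, V.coeff ψ)) (sumCoeff A n m (U.toFun ξ, V.toFun η))
        = ψ.1 η
      rw [row_sumCoeff, V.pairing]
      simp
  · obtain φ | ψ := j
    · refine ⟨.inl (E.dualAct g φ), fun ξ => rfl, fun x => ?_⟩
      induction x using sumCoeff_induction with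
      | h x y =>
        simp only [Sum.elim_inl]
        rw [tensorAct_sumCoeff, row_sumCoeff, row_sumCoeff, U.coeff_act]
        simp
    · refine ⟨.inr (F.dualAct g ψ), fun ξ => rfl, fun x => ?_⟩
      induction x using sumCoeff_induction with
      | h x y =>
        simp only [Sum.elim_inr]
        rw [tensorAct_sumCoeff, row_sumCoeff, row_sumCoeff, V.coeff_act]
        simp
  · rintro s (i | i) x -
    · obtain ⟨ξ, hξ⟩ := U.approx (s.preimage Sum.inl Sum.inl_injective.injOn) (Finsupp.single i x)
      refine ⟨((ξ, 0) : E × F), ?_⟩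
      rintro (φ | ψ) h
      · rw [Sum.elim_inl, sumCoeff_inl, ← row_single_right, hξ φ (by simpa using h)]
        rfl
      · rw [Sum.elim_inr, sumCoeff_inl]
        exact (zero_mul x).trans (map_zero ψ.1).symm
    · obtain ⟨η, hη⟩ := V.approx (s.preimage Sum.inr Sum.inr_injective.injOn) (Finsupp.single i x)
      refine ⟨((0, η) : E × F), ?_⟩
      rintro (φ | ψ) h
      · rw [Sum.elim_inl, sumCoeff_inr]
        exact (zero_mul x).trans (map_zero φ.1).symm
      · rw [Sum.elim_inr, sumCoeff_inr, ← row_single_right, hη ψ (by simpa using h)]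
        rfl

theorem tensorAct_one (g : G) (x : n →₀ A) :
    tensorAct A (1 : Representation ℂ G (n →₀ ℂ)) g x = Finsupp.mapRange.linearMap (A.act g) x := by
  classical
  induction x using Finsupp.induction_linear with
  | zero => simp
  | add x y hx hy => simp only [map_add, hx, hy]
  | single j a =>
    ext i
    rw [tensorAct_single, Finsupp.mapRange.linearMap_apply, Finsupp.mapRange_single,
      Finsupp.single_apply]
    simp [Finsupp.single_apply]

theorem rowFinite_one : RowFinite (1 : Representation ℂ G (n →₀ ℂ)) := by
  classical
  intro g i
  refine (Set.finite_singleton i).subset fun j hj => ?_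
  by_contra h
  exact hj (by simpa [Finsupp.single_apply] using h)

theorem RowExtension.self (hA : A.HasApproxUnit) :
    Nonempty (RowExtension (self A) PUnit.{u + 1} 1) := by
  have hmul : ∀ ξ a : A, Finsupp.single PUnit.unit (ξ * a)
      = freeMul A PUnit.{u + 1} (Finsupp.single PUnit.unit ξ) a := fun ξ a =>
    Finsupp.ext fun i => by rw [freeMul_apply]; simp
  have hact : ∀ (g : G) (ξ : A), Finsupp.single PUnit.unit (A.act g ξ)
      = tensorAct A (1 : Representation ℂ G (PUnit.{u + 1} →₀ ℂ)) g
        (Finsupp.single PUnit.unit ξ) := fun g ξ => by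
    rw [tensorAct_one]
    simp
  have hspan : LinearMap.range (LinearMap.mul ℂ A)
      = Submodule.span ℂ (Set.range (LinearMap.mul ℂ A)) := by
    rw [← LinearMap.coe_range, Submodule.span_eq]
  refine RowExtension.exists_of_family (E := FunctionalModule.self A) hA
    (Finsupp.lsingle (R := ℂ) (M := A) PUnit.unit) hmul hact
    (LinearMap.mul ℂ A) (Finsupp.single PUnit.unit) hspan
    (fun b ξ => (row_single _ _ _ _).trans (congrArg (b * ·) (Finsupp.single_eq_same (b := ξ))))
    (fun g b => ⟨A.act g b, fun (ξ : A) => ?_, fun x => ?_⟩) (X := Set.univ) (by simp)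
    (fun s i x _ => ⟨x, fun b _ => congrArg (· * x) (Finsupp.single_eq_same (b := b))⟩)
  · change A.act g b * ξ = A.act g (b * A.act g⁻¹ ξ)
    rw [A.act_mul, rep_inv_apply]
  · rw [row_single, row_single, tensorAct_one, A.act_mul, Finsupp.mapRange.linearMap_apply,
      Finsupp.mapRange_apply, rep_inv_apply]

end Prod

/-! ### Corner modules of the linking algebra -/

section Linking

variable (hA : A.HasApproxUnit) {E : FunctionalModule A} (hE : E.LocallyUnital)

theorem exists_rmul_eq (hA : A.HasApproxUnit) {E : FunctionalModule A} (hE : E.LocallyUnital)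
    (x : E.prod (self A)) : ∃ e : A, (E.prod (self A)).rmul x e = x := by
  classical
  obtain ⟨ξ, b⟩ := x
  change A at b
  have h : ∀ T ∈ E.compactSubalgebra, ∃ s : Finset A, ∀ e : A, (∀ a ∈ s, a * e = a) →
      E.rmul (T ξ) e = T ξ := by
    intro T hT
    induction hT using compact_induction with
    | h0 => exact ⟨∅, by simp⟩
    | hadd T T' _ _ h h' =>
      obtain ⟨s, hs⟩ := h
      obtain ⟨s', hs'⟩ := h'
      refine ⟨s ∪ s', fun e he => ?_⟩
      rw [LinearMap.add_apply, map_add, LinearMap.add_apply,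
        hs e fun a ha => he a (Finset.mem_union_left _ ha),
        hs' e fun a ha => he a (Finset.mem_union_right _ ha)]
    | htheta η φ hφ =>
      exact ⟨{φ ξ}, fun e he => by rw [theta_apply, ← E.rmul_mul, he _ (by simp)]⟩
  obtain ⟨T, hT, hξ⟩ := hE.left ξ
  obtain ⟨s, hs⟩ := h T hT
  obtain ⟨e, he⟩ := hA.exists_unit_finset (insert b s)
  refine ⟨e, Prod.ext ?_ (he b (Finset.mem_insert_self b s)).2⟩
  have := hs e fun a ha => (he a (Finset.mem_insert_of_mem ha)).2
  rwa [hξ] at this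

theorem theta_toAlg_mem (hA : A.HasApproxUnit) {E : FunctionalModule A} (hE : E.LocallyUnital)
    (x : E.prod (self A)) :
    (E.prod (self A)).theta x (toAlg E) ∈ (E.prod (self A)).compactSubalgebra := by
  obtain ⟨e, he⟩ := exists_rmul_eq hA hE x
  refine Submodule.subset_span ⟨x, LinearMap.mul ℂ A e ∘ₗ toAlg E, ?_, ?_⟩
  · have h : LinearMap.mul ℂ A e ∈ (self A).functionals := ⟨e, rfl⟩
    exact snd_mem_prod E (self A) _ h
  · refine LinearMap.ext fun y => ?_
    rw [theta_apply, theta_apply, LinearMap.comp_apply, LinearMap.mul_apply',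
      (E.prod (self A)).rmul_mul, he]

/-- The embedding `x ↦ (y ↦ x · toAlg y)` of `E ⊕ A` into `𝒦_A(E ⊕ A)`. -/
noncomputable def linkEmb : E.prod (self A) →ₗ[ℂ] (E.prod (self A)).compact where
  toFun x := (⟨(E.prod (self A)).theta x (toAlg E), theta_toAlg_mem hA hE x⟩ :
    (E.prod (self A)).compactSubalgebra)
  map_add' x x' := Subtype.ext <| LinearMap.ext fun y => by
    change (E.prod (self A)).rmul (x + x') (toAlg E y)
      = (E.prod (self A)).rmul x (toAlg E y) + (E.prod (self A)).rmul x' (toAlg E y)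
    rw [map_add, LinearMap.add_apply]
  map_smul' c x := Subtype.ext <| LinearMap.ext fun y => by
    change (E.prod (self A)).rmul (c • x) (toAlg E y) = c • (E.prod (self A)).rmul x (toAlg E y)
    rw [map_smul, LinearMap.smul_apply]

theorem linkEmb_injective : Function.Injective (linkEmb hA hE) := by
  intro x y h
  have key : ∀ e : A, (E.prod (self A)).rmul x e = (E.prod (self A)).rmul y e := fun e =>
    congrArg (fun T : (E.prod (self A)).compactSubalgebra => T.1 (ofAlg E e)) h
  have key' : ∀ e : A, (E.prod (self A)).rmul (x - y) e = 0 := fun e => by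
    rw [map_sub, LinearMap.sub_apply, key, sub_self]
  obtain ⟨e, he⟩ := exists_rmul_eq hA hE (x - y)
  exact sub_eq_zero.1 (he.symm.trans (key' e))

theorem linkEmb_act (g : G) (x : E.prod (self A)) :
    (E.prod (self A)).compact.act g (linkEmb hA hE x)
      = linkEmb hA hE ((E.prod (self A)).act g x) :=
  Subtype.ext <| LinearMap.ext fun y => by
    change (E.prod (self A)).act g ((E.prod (self A)).rmul x
      (toAlg E ((E.prod (self A)).act g⁻¹ y))) = (E.prod (self A)).rmul _ (toAlg E y)
    rw [act_rmul, toAlg_act, rep_inv_apply]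

theorem linkEmb_mul_cornerEmb (x : E.prod (self A)) (a : A) :
    linkEmb hA hE x * cornerEmb hA E a = linkEmb hA hE ((E.prod (self A)).rmul x a) :=
  Subtype.ext <| LinearMap.ext fun y => by
    change (E.prod (self A)).rmul x (toAlg E (ofAlg E (a * toAlg E y)))
      = (E.prod (self A)).rmul ((E.prod (self A)).rmul x a) (toAlg E y)
    rw [toAlg_ofAlg, rmul_mul]

theorem mul_cornerEmb (k : (E.prod (self A)).compact) (a : A) :
    k * cornerEmb hA E a = linkEmb hA hE (k.1 (ofAlg E a)) :=
  Subtype.ext <| LinearMap.ext fun y => by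
    change k.1 (ofAlg E (a * toAlg E y))
      = (E.prod (self A)).rmul (k.1 (ofAlg E a)) (toAlg E y)
    rw [ofAlg_mul, compact_rmul _ k.1 k.2]

theorem mul_linkEmb (k : (E.prod (self A)).compact) (x : E.prod (self A)) :
    k * linkEmb hA hE x = linkEmb hA hE (k.1 x) :=
  Subtype.ext <| LinearMap.ext fun y => compact_rmul _ k.1 k.2 x (toAlg E y)

theorem cornerEmb_mul_linkEmb (b : A) (x : E.prod (self A)) :
    cornerEmb hA E b * linkEmb hA hE x = cornerEmb hA E (b * toAlg E x) :=
  Subtype.ext <| LinearMap.ext fun y => by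
    change ofAlg E (b * toAlg E ((E.prod (self A)).rmul x (toAlg E y)))
      = ofAlg E (b * toAlg E x * toAlg E y)
    rw [toAlg_rmul, mul_assoc]

/-- `𝒦_A(E ⊕ A)` is generated by `M_A` as a two-sided ideal. -/
theorem theta_eq_linkEmb_mul (η : E.prod (self A)) (τ : E.prod (self A) →ₗ[ℂ] A)
    (hτ : τ ∈ (E.prod (self A)).functionals) (e : A) (he : (E.prod (self A)).rmul η e = η) :
    (show (E.prod (self A)).compact from
      (⟨_, theta_mem_compact _ η τ hτ⟩ : (E.prod (self A)).compactSubalgebra))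
      = linkEmb hA hE η * cornerEmb hA E e * (cornerEmb hA E e *
        (show (E.prod (self A)).compact from
          (⟨_, theta_mem_compact _ (ofAlg E e) τ hτ⟩ : (E.prod (self A)).compactSubalgebra))) :=
  Subtype.ext <| LinearMap.ext fun y => by
    change (E.prod (self A)).rmul η (τ y) = (E.prod (self A)).rmul η (toAlg E (ofAlg E (e *
      toAlg E (ofAlg E (e * toAlg E ((E.prod (self A)).rmul (ofAlg E e) (τ y)))))))
    rw [toAlg_ofAlg, toAlg_ofAlg, toAlg_rmul, toAlg_ofAlg, rmul_mul, rmul_mul, rmul_mul, he, he, he]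

/-- The functional `y ↦ b · toAlg (k y)` on `E ⊕ A`. -/
noncomputable def pairFunctional (E : FunctionalModule A) (b : A) :
    (E.prod (self A)).compact →ₗ[ℂ] (E.prod (self A)).functionals where
  toFun k := ⟨(LinearMap.mul ℂ A b ∘ₗ toAlg E) ∘ₗ k.1, functional_comp_compact _
    (snd_mem_prod E (self A) _ (show LinearMap.mul ℂ A b ∈ (self A).functionals from ⟨b, rfl⟩)) k.2⟩
  map_add' _ _ := Subtype.ext (LinearMap.comp_add _ _ _)
  map_smul' _ _ := Subtype.ext (LinearMap.comp_smul _ _ _)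

theorem pairFunctional_apply (E : FunctionalModule A) (b : A) (k : (E.prod (self A)).compact)
    (y : E.prod (self A)) : (pairFunctional E b k).1 y = b * toAlg E (k.1 y) := rfl

theorem dualAct_pairFunctional (E : FunctionalModule A) (g : G) (b : A)
    (k : (E.prod (self A)).compact) : (E.prod (self A)).dualAct g (pairFunctional E b k)
      = pairFunctional E (A.act g b) ((E.prod (self A)).compact.act g k) :=
  Subtype.ext <| LinearMap.ext fun y => by
    change A.act g (b * toAlg E (k.1 ((E.prod (self A)).act g⁻¹ y)))
      = A.act g b * toAlg E ((E.prod (self A)).act g (k.1 ((E.prod (self A)).act g⁻¹ y)))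
    rw [A.act_mul, toAlg_act]

end Linking

section Corner

variable (hA : A.HasApproxUnit) {E : FunctionalModule A}
  {F : FunctionalModule (E.prod (self A)).compact}

theorem cornerFunctional_mem (b : A) (φ : F.functionals) :
    (show corner hA E F →ₗ[ℂ] A from cornerFunctional hA E F b φ) ∈ (corner hA E F).functionals := by
  have h : cornerFunctional hA E F b φ ∈
      Submodule.span ℂ {χ | ∃ b φ, χ = cornerFunctional hA E F b φ} :=
    Submodule.subset_span ⟨b, φ, rfl⟩
  exact h

theorem cornerFunctional_congr (b : A) {φ : F.functionals} {ζ ζ' : cornerCarrier hA E F}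
    (h : φ.1 ζ.1 = φ.1 ζ'.1) :
    cornerFunctional hA E F b φ ζ = cornerFunctional hA E F b φ ζ' := by
  apply cornerEmb_injective hA E
  rw [cornerFunctional_spec, cornerFunctional_spec, h]

/-- The compact operator `ζ ↦ ξ k φ(ζ)` on `F` restricts to a compact operator on the corner. -/
theorem exists_compact_corner (hE : E.LocallyUnital)
    (ξ : F) (φ : F.functionals) (k : (E.prod (self A)).compact) :
    ∃ S ∈ (corner hA E F).compactSubalgebra, ∀ ζ : cornerCarrier hA E F,
      (show cornerCarrier hA E F from S ζ).1 = F.rmul ξ (k * φ.1 ζ.1) := by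
  obtain ⟨k, hk⟩ := k
  induction hk using compact_induction with
  | h0 =>
    refine ⟨0, zero_mem _, fun ζ => ?_⟩
    change (0 : F) = F.rmul ξ (0 * φ.1 ζ.1)
    rw [zero_mul, map_zero]
  | hadd k k' hk hk' h h' =>
    obtain ⟨S, hS, h⟩ := h
    obtain ⟨S', hS', h'⟩ := h'
    refine ⟨S + S', add_mem hS hS', fun ζ => (congrArg₂ (· + ·) (h ζ) (h' ζ)).trans ?_⟩
    rw [← map_add]
    exact congrArg (F.rmul ξ) (add_mul (show (E.prod (self A)).compact from ⟨k, hk⟩)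
      (show (E.prod (self A)).compact from ⟨k', hk'⟩) (φ.1 ζ.1)).symm
  | htheta η τ hτ =>
    obtain ⟨e, he⟩ := exists_rmul_eq hA hE η
    have hk := theta_eq_linkEmb_mul hA hE η τ hτ e he
    set κ : (E.prod (self A)).compact :=
      (⟨_, theta_mem_compact _ (ofAlg E e) τ hτ⟩ : (E.prod (self A)).compactSubalgebra)
    let v : cornerCarrier hA E F :=
      ⟨F.rmul (F.rmul ξ (linkEmb hA hE η)) (cornerEmb hA E e), rmul_mem_corner hA E F _ e⟩
    refine ⟨(corner hA E F).theta v _, theta_mem_compact _ _ _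
      (cornerFunctional_mem hA e (F.lmul κ φ)), fun ζ => ?_⟩
    change F.rmul (F.rmul (F.rmul ξ (linkEmb hA hE η)) (cornerEmb hA E e))
      (cornerEmb hA E (cornerFunctional hA E F e (F.lmul κ φ) ζ)) = _
    rw [cornerFunctional_spec, ← F.rmul_mul, ← F.rmul_mul]
    refine congrArg (F.rmul ξ) ?_
    change _ * (_ * (_ * (κ * φ.1 ζ.1))) = _
    refine Eq.trans ?_ (congrArg (· * φ.1 ζ.1) hk).symm
    simp only [mul_assoc]

theorem exists_compact_corner_left (hE : E.LocallyUnital)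
    (hK : (E.prod (self A)).compact.HasApproxUnit)
    {T : Module.End ℂ F} (hT : T ∈ F.compactSubalgebra) (s : Finset (cornerCarrier hA E F)) :
    ∃ S ∈ (corner hA E F).compactSubalgebra, ∀ ζ ∈ s,
      (show cornerCarrier hA E F from S ζ).1 = T ζ.1 := by
  classical
  induction hT using compact_induction with
  | h0 => exact ⟨0, zero_mem _, fun ζ _ => rfl⟩
  | hadd T T' _ _ h h' =>
    obtain ⟨S, hS, h⟩ := h
    obtain ⟨S', hS', h'⟩ := h'
    exact ⟨S + S', add_mem hS hS', fun ζ hζ => congrArg₂ (· + ·) (h ζ hζ) (h' ζ hζ)⟩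
  | htheta η φ hφ =>
    obtain ⟨k, hk⟩ := hK.exists_unit_finset (s.image fun ζ => φ ζ.1)
    obtain ⟨S, hS, h⟩ := exists_compact_corner hA hE η ⟨φ, hφ⟩ k
    exact ⟨S, hS, fun ζ hζ => by
      rw [h, (hk _ (Finset.mem_image_of_mem _ hζ)).1, theta_apply]⟩

theorem exists_compact_corner_right (hE : E.LocallyUnital)
    (hK : (E.prod (self A)).compact.HasApproxUnit)
    {T : Module.End ℂ F} (hT : T ∈ F.compactSubalgebra) (s : Finset F.functionals) :
    ∃ S ∈ (corner hA E F).compactSubalgebra, ∀ φ ∈ s, ∀ ζ : cornerCarrier hA E F,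
      φ.1 (show cornerCarrier hA E F from S ζ).1 = φ.1 (T ζ.1) := by
  classical
  induction hT using compact_induction with
  | h0 => exact ⟨0, zero_mem _, fun φ _ ζ => rfl⟩
  | hadd T T' _ _ h h' =>
    obtain ⟨S, hS, h⟩ := h
    obtain ⟨S', hS', h'⟩ := h'
    refine ⟨S + S', add_mem hS hS', fun φ hφ ζ => (map_add φ.1 _ _).trans ?_⟩
    rw [LinearMap.add_apply, map_add, ← h φ hφ, ← h' φ hφ]
  | htheta η ψ hψ =>
    obtain ⟨k, hk⟩ := hK.exists_unit_finset (s.image fun φ => φ.1 η)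
    obtain ⟨S, hS, h⟩ := exists_compact_corner hA hE η ⟨ψ, hψ⟩ k
    exact ⟨S, hS, fun φ hφ ζ => by
      rw [h, theta_apply, F.functional_rmul φ.1 φ.2, F.functional_rmul φ.1 φ.2, ← mul_assoc,
        (hk _ (Finset.mem_image_of_mem _ hφ)).2]⟩

theorem corner_locallyUnital (hE : E.LocallyUnital)
    (hK : (E.prod (self A)).compact.HasApproxUnit)
    (hF : F.LocallyUnital) : (corner hA E F).LocallyUnital := by
  classical
  refine LocallyUnital.of_span (X := Set.univ) (by simp) le_rfl (fun s _ => ?_) (fun s hs => ?_)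
  · obtain ⟨T, hT, hfix⟩ := hF.exists_left_finset (s.image fun ζ => ζ.1)
    obtain ⟨S, hS, h⟩ := exists_compact_corner_left hA hE hK hT s
    exact ⟨S, hS, fun ζ hζ =>
      Subtype.ext ((h ζ hζ).trans (hfix _ (Finset.mem_image_of_mem _ hζ)))⟩
  · choose! b φ h using hs
    obtain ⟨T, hT, hfix⟩ := hF.exists_right_finset (s.image φ)
    obtain ⟨S, hS, hST⟩ := exists_compact_corner_right hA hE hK hT (s.image φ)
    refine ⟨S, hS, fun χ hχ => LinearMap.ext fun ζ => ?_⟩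
    have hφ := Finset.mem_image_of_mem φ hχ
    have e := h hχ
    refine (LinearMap.congr_fun e (S ζ)).trans (Eq.trans ?_ (LinearMap.congr_fun e ζ).symm)
    exact cornerFunctional_congr hA _ ((hST _ hφ ζ).trans (LinearMap.congr_fun (hfix _ hφ) _))

end Corner

section Uncurry

variable {n m : Type u}

/-- Families indexed by `n` of coordinate vectors indexed by `m`, as coordinate vectors indexed by
`n × m`. -/
noncomputable def uncurry (A : GAlgebra.{u, v} G) (n m : Type u) :
    (n →₀ m →₀ A) →ₗ[ℂ] (n × m →₀ A) :=
  (Finsupp.curryLinearEquiv ℂ).symm.toLinearMap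

theorem uncurry_apply (y : n →₀ m →₀ A) (i : n) (k : m) : uncurry A n m y (i, k) = y i k := rfl

theorem uncurry_single_single (i : n) (k : m) (a : A) :
    uncurry A n m (Finsupp.single i (Finsupp.single k a)) = Finsupp.single (i, k) a := by
  classical
  ext ⟨j, l⟩
  rw [uncurry_apply, Finsupp.single_apply, Finsupp.single_apply]
  by_cases hi : i = j
  · by_cases hk : k = l
    · simp [hi, hk]
    · simp [hi, hk]
  · simp [hi]

theorem row_eq_sum (b x : n →₀ A) : row A n b x = b.sum fun i c => c * x i := by
  simp [row, Finsupp.sum]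

theorem tensorAct_eq_sum (μ : Representation ℂ G (n →₀ ℂ)) (g : G) (x : n →₀ A) (i : n) :
    tensorAct A μ g x i = x.sum fun j a => μ g (Finsupp.single j 1) i • A.act g a := by
  induction x using Finsupp.induction_linear with
  | zero => simp
  | add x y hx hy =>
    rw [Finsupp.sum_add_index' (by simp) (by simp), map_add, Finsupp.add_apply, hx, hy]
  | single j a => rw [Finsupp.sum_single_index (by simp), tensorAct_single]

theorem tensorAct_uncurry (ν : Representation ℂ G (n →₀ ℂ)) (μ : Representation ℂ G (m →₀ ℂ))
    (g : G) (y : n →₀ m →₀ A) (i : n) (k : m) :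
    tensorAct A (prodRep ν μ) g (uncurry A n m y) (i, k)
      = y.sum fun j w => ν g (Finsupp.single j 1) i • tensorAct A μ g w k := by
  induction y using Finsupp.induction_linear with
  | zero => simp
  | add x y hx hy =>
    rw [Finsupp.sum_add_index' (by simp) (by simp), map_add, map_add, Finsupp.add_apply, hx, hy]
  | single j w =>
    rw [Finsupp.sum_single_index (by simp)]
    induction w using Finsupp.induction_linear with
    | zero => simp
    | add x y hx hy =>
      rw [Finsupp.single_add, map_add, map_add, Finsupp.add_apply, hx, hy, map_add,
        Finsupp.add_apply, smul_add]
    | single l a =>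
      rw [uncurry_single_single, tensorAct_single, tensorAct_single, prodRep_single, mul_smul]

theorem row_uncurry (c : n →₀ m →₀ A) (y : n × m →₀ A) :
    row A (n × m) (uncurry A n m c) y = c.sum fun i d => row A m d (y.curry i) := by
  induction c using Finsupp.induction_linear with
  | zero => simp
  | add x y hx hy =>
    rw [Finsupp.sum_add_index' (by simp) (by simp), map_add, map_add, LinearMap.add_apply, hx, hy]
  | single j w =>
    rw [Finsupp.sum_single_index (by simp)]
    induction w using Finsupp.induction_linear with
    | zero => simp
    | add x y hx hy => rw [Finsupp.single_add, map_add, map_add, map_add, LinearMap.add_apply, hx,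
        hy, LinearMap.add_apply]
    | single l a => rw [uncurry_single_single, row_single, row_single, Finsupp.curry_apply]

end Uncurry

section CornerExtension

variable (hA : A.HasApproxUnit) {E : FunctionalModule A}
  {F : FunctionalModule (E.prod (self A)).compact} {n m : Type u}
  {ν : Representation ℂ G (n →₀ ℂ)} {μ : Representation ℂ G (m →₀ ℂ)}

/-- The coordinates of elements of `F · M_A` lie in `𝒦_A(E ⊕ A) M_A ≅ E ⊕ A`. -/
theorem exists_linkEmb_eq (hE : E.LocallyUnital) (U : RowExtension F n ν) {ζ : F}
    (hζ : ζ ∈ cornerCarrier hA E F) :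
    ∃ x : n → E.prod (self A), ∀ i, U.toFun ζ i = linkEmb hA hE (x i) := by
  suffices H : ∀ i, ∃ x : E.prod (self A), U.toFun ζ i = linkEmb hA hE x by
    choose x hx using H
    exact ⟨x, hx⟩
  intro i
  induction hζ using Submodule.span_induction with
  | zero => exact ⟨0, by simp⟩
  | add ζ ζ' _ _ h h' =>
    obtain ⟨x, hx⟩ := h
    obtain ⟨y, hy⟩ := h'
    exact ⟨x + y, by rw [map_add, map_add, Finsupp.add_apply, hx, hy]⟩
  | smul c ζ _ h =>
    obtain ⟨x, hx⟩ := h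
    exact ⟨c • x, by rw [map_smul, map_smul, Finsupp.smul_apply, hx]⟩
  | mem ζ hζ =>
    obtain ⟨ζ, a, rfl⟩ := hζ
    exact ⟨_, by rw [U.map_rmul, freeMul_apply, mul_cornerEmb hA hE]⟩

variable {hA} in
/-- The coordinates of the corner module, for a map `q` on `𝒦_A(E ⊕ A)`. -/
noncomputable def cornerMap (U : F →ₗ[ℂ] n →₀ (E.prod (self A)).compact)
    (q : (E.prod (self A)).compact →ₗ[ℂ] m →₀ A) : cornerCarrier hA E F →ₗ[ℂ] (n × m →₀ A) :=
  uncurry A n m ∘ₗ Finsupp.mapRange.linearMap q ∘ₗ U ∘ₗ (cornerCarrier hA E F).subtype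

variable {hA} in
theorem cornerMap_eq (U : F →ₗ[ℂ] n →₀ (E.prod (self A)).compact)
    (q : (E.prod (self A)).compact →ₗ[ℂ] m →₀ A) (ζ : cornerCarrier hA E F) :
    cornerMap U q ζ = uncurry A n m (Finsupp.mapRange.linearMap q (U ζ.1)) := rfl

variable {hA} in
theorem cornerMap_apply (U : F →ₗ[ℂ] n →₀ (E.prod (self A)).compact)
    (q : (E.prod (self A)).compact →ₗ[ℂ] m →₀ A) (ζ : cornerCarrier hA E F) (i : n) (k : m) :
    cornerMap U q ζ (i, k) = q (U ζ.1 i) k := rfl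

/-- The row of the functional `m_b φ` on the corner module. -/
noncomputable def cornerRow (V : RowExtension (E.prod (self A)) m μ) (n : Type u) (b : A) :
    (n →₀ (E.prod (self A)).compact) →ₗ[ℂ] (n × m →₀ A) :=
  uncurry A n m ∘ₗ Finsupp.mapRange.linearMap (V.coeff ∘ₗ pairFunctional E b)

theorem cornerRow_apply (V : RowExtension (E.prod (self A)) m μ) (b : A)
    (κ : n →₀ (E.prod (self A)).compact) (i : n) (k : m) :
    cornerRow V n b κ (i, k) = V.coeff (pairFunctional E b (κ i)) k := rfl

theorem row_cornerRow (V : RowExtension (E.prod (self A)) m μ) (b : A)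
    (κ : n →₀ (E.prod (self A)).compact) (y : n × m →₀ A) :
    row A (n × m) (cornerRow V n b κ) y
      = κ.sum fun i k => row A m (V.coeff (pairFunctional E b k)) (y.curry i) := by
  rw [cornerRow, LinearMap.comp_apply, row_uncurry, Finsupp.mapRange.linearMap_apply,
    Finsupp.sum_mapRange_index (by simp)]
  rfl

theorem cornerMap_pairing (hE : E.LocallyUnital) (U : RowExtension F n ν)
    (V : RowExtension (E.prod (self A)) m μ)
    {q : (E.prod (self A)).compact →ₗ[ℂ] m →₀ A} (hq : ∀ x, q (linkEmb hA hE x) = V.toFun x)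
    (b : A) (φ : F.functionals) (ζ : cornerCarrier hA E F) :
    row A (n × m) (cornerRow V n b (U.coeff φ)) (cornerMap U.toFun q ζ)
      = cornerFunctional hA E F b φ ζ := by
  obtain ⟨x, hx⟩ := exists_linkEmb_eq hA hE U ζ.2
  apply cornerEmb_injective hA E
  rw [cornerFunctional_spec, ← U.pairing, row_cornerRow, row_eq_sum, Finsupp.sum, Finsupp.sum,
    map_sum, Finset.mul_sum]
  refine Finset.sum_congr rfl fun i _ => ?_
  rw [hx, mul_linkEmb, cornerEmb_mul_linkEmb, ← pairFunctional_apply, ← V.pairing, ← hq, ← hx]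
  have : (cornerMap U.toFun q ζ).curry i = q (U.toFun ζ.1 i) := Finsupp.ext fun _ => rfl
  rw [this]

theorem cornerMap_rmul (hE : E.LocallyUnital) (U : RowExtension F n ν)
    (V : RowExtension (E.prod (self A)) m μ)
    {q : (E.prod (self A)).compact →ₗ[ℂ] m →₀ A} (hq : ∀ x, q (linkEmb hA hE x) = V.toFun x)
    (ζ : cornerCarrier hA E F) (a : A) :
    cornerMap U.toFun q ⟨F.rmul ζ.1 (cornerEmb hA E a), rmul_mem_corner hA E F ζ.1 a⟩
      = freeMul A (n × m) (cornerMap U.toFun q ζ) a := by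
  obtain ⟨x, hx⟩ := exists_linkEmb_eq hA hE U ζ.2
  ext ⟨i, k⟩
  rw [freeMul_apply, cornerMap_apply, cornerMap_apply, U.map_rmul, freeMul_apply, hx,
    linkEmb_mul_cornerEmb, hq, hq, V.map_rmul, freeMul_apply]

theorem cornerMap_act (hE : E.LocallyUnital) (U : RowExtension F n ν)
    (V : RowExtension (E.prod (self A)) m μ)
    {q : (E.prod (self A)).compact →ₗ[ℂ] m →₀ A} (hq : ∀ x, q (linkEmb hA hE x) = V.toFun x)
    (g : G) (ζ : cornerCarrier hA E F) :
    cornerMap U.toFun q ⟨F.act g ζ.1, act_mem_corner hA E F g ζ.1 ζ.2⟩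
      = tensorAct A (prodRep ν μ) g (cornerMap U.toFun q ζ) := by
  obtain ⟨x, hx⟩ := exists_linkEmb_eq hA hE U ζ.2
  ext ⟨i, k⟩
  rw [cornerMap_apply, cornerMap_eq, tensorAct_uncurry, U.map_act, tensorAct_eq_sum,
    Finsupp.mapRange.linearMap_apply, Finsupp.sum_mapRange_index (by simp), Finsupp.sum,
    Finsupp.sum, map_sum, Finsupp.finsetSum_apply]
  refine Finset.sum_congr rfl fun j _ => ?_
  rw [map_smul, Finsupp.smul_apply, hx, linkEmb_act, hq, hq, V.map_act]

theorem cornerRow_act (U : RowExtension F n ν)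
    (V : RowExtension (E.prod (self A)) m μ)
    (hK : (E.prod (self A)).compact.HasApproxUnit) (g : G) (b : A) (φ : F.functionals)
    (x : n × m →₀ A) : row A (n × m) (cornerRow V n (A.act g b) (U.coeff (F.dualAct g φ))) x
      = A.act g (row A (n × m) (cornerRow V n b (U.coeff φ))
        (tensorAct A (prodRep ν μ) g⁻¹ x)) := by
  induction x using Finsupp.induction_linear with
  | zero => simp
  | add x y hx hy => simp only [map_add, hx, hy]
  | single j a =>
    obtain ⟨j, l⟩ := j
    rw [row_single_right, cornerRow_apply, U.coeff_act_apply hK]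
    generalize U.coeff φ = κ
    induction κ using Finsupp.induction_linear with
    | zero => simp
    | add κ κ' h h' =>
      rw [Finsupp.sum_add_index' (by simp) (by simp)]
      simp only [map_add, LinearMap.add_apply, Finsupp.add_apply, add_mul, h, h']
    | single i k =>
      rw [Finsupp.sum_single_index (by simp), row_cornerRow, Finsupp.sum_single_index (by simp),
        map_smul, map_smul, Finsupp.smul_apply, ← dualAct_pairFunctional, smul_mul_assoc,
        ← row_single_right, V.coeff_act, ← map_smul, ← map_smul]
      congr 2
      ext r
      rw [Finsupp.curry_apply, ← uncurry_single_single, tensorAct_uncurry,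
        Finsupp.sum_single_index (by simp), Finsupp.smul_apply]

theorem cornerFunctional_act (g : G) (b : A) (φ : F.functionals) (ζ : cornerCarrier hA E F) :
    cornerFunctional hA E F (A.act g b) (F.dualAct g φ) ζ
      = A.act g (cornerFunctional hA E F b φ
        ⟨F.act g⁻¹ ζ.1, act_mem_corner hA E F g⁻¹ ζ.1 ζ.2⟩) := by
  apply cornerEmb_injective hA E
  rw [cornerFunctional_spec, ← cornerEmb_act, ← cornerEmb_act, cornerFunctional_spec,
    GAlgebra.act_mul]
  rfl

theorem corner_approx (hE : E.LocallyUnital) (U : RowExtension F n ν)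
    (V : RowExtension (E.prod (self A)) m μ)
    (s : Finset (A × F.functionals)) (i : n) (k : m) (a : A) : ∃ ζ : cornerCarrier hA E F,
      ∀ j ∈ s, cornerRow V n j.1 (U.coeff j.2) (i, k) * a = cornerFunctional hA E F j.1 j.2 ζ := by
  classical
  obtain ⟨x, hx⟩ := V.approx (s.image fun j => pairFunctional E j.1 (U.coeff j.2 i))
    (Finsupp.single k a)
  obtain ⟨ζ, hζ⟩ := U.approx (s.image Prod.snd) (Finsupp.single i (linkEmb hA hE x))
  obtain ⟨e, he⟩ := exists_rmul_eq hA hE x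
  refine ⟨⟨F.rmul ζ (cornerEmb hA E e), rmul_mem_corner hA E F ζ e⟩, fun j hj => ?_⟩
  apply cornerEmb_injective hA E
  rw [cornerFunctional_spec, F.functional_rmul j.2.1 j.2.2,
    ← hζ _ (Finset.mem_image_of_mem _ hj), row_single_right, mul_assoc, linkEmb_mul_cornerEmb, he,
    mul_linkEmb, cornerEmb_mul_linkEmb, ← pairFunctional_apply,
    ← hx _ (Finset.mem_image_of_mem _ hj), row_single_right, cornerRow_apply]

end CornerExtension

theorem corner_inClassC {E : FunctionalModule A}
    {F : FunctionalModule (E.prod (self A)).compact} (hE : E.InClassC) (hF : F.InClassC) :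
    (corner hE.approxUnit E F).InClassC := by
  have hA := hE.approxUnit
  have hK := hF.approxUnit
  have hE' := hE.locallyUnital
  obtain ⟨n, ν, hν, ⟨U⟩⟩ := hF.exists_rowExtension
  obtain ⟨m, μ, hμ, ⟨V₀⟩⟩ := hE.exists_rowExtension
  obtain ⟨V₁⟩ := RowExtension.self hA
  obtain ⟨V⟩ := V₀.prod hA V₁
  obtain ⟨p, hp⟩ := (linkEmb hA hE').exists_leftInverse_of_injective
    (LinearMap.ker_eq_bot.2 (linkEmb_injective hA hE'))
  have hq : ∀ x, (V.toFun ∘ₗ p) (linkEmb hA hE' x) = V.toFun x := fun x =>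
    congrArg V.toFun (LinearMap.congr_fun hp x)
  obtain ⟨W⟩ := RowExtension.exists_of_family (E := corner hA E F)
    (μ := prodRep ν (sumRep μ 1)) hA (cornerMap U.toFun (V.toFun ∘ₗ p))
    (cornerMap_rmul hA hE' U V hq) (cornerMap_act hA hE' U V hq)
    (fun j : A × F.functionals => cornerFunctional hA E F j.1 j.2)
    (fun j => cornerRow V n j.1 (U.coeff j.2))
    (by
      refine congrArg (Submodule.span ℂ) (Set.ext fun χ => ⟨?_, ?_⟩)
      · rintro ⟨b, φ, rfl⟩
        exact ⟨(b, φ), rfl⟩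
      · rintro ⟨⟨b, φ⟩, rfl⟩
        exact ⟨b, φ, rfl⟩)
    (fun j ζ => cornerMap_pairing hA hE' U V hq j.1 j.2 ζ)
    (fun g j => ⟨(A.act g j.1, F.dualAct g j.2), cornerFunctional_act hA g j.1 j.2,
      cornerRow_act U V hK g j.1 j.2⟩)
    (X := Set.univ) (by simp)
    (fun s i a _ => corner_approx hA hE' U V s i.1 i.2 a)
  exact .of_rowExtension hA (corner_locallyUnital hA hE' hK hF.locallyUnital)
    (prodRep_rowFinite hν (sumRep_rowFinite hμ rowFinite_one)) W

end FunctionalModule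

theorem theorem6 {G : Type v} [Group G] :
    -- plain modules
    (∀ (A : GAlgebra.{u, v} G), A.HasApproxUnit →
      ∀ (n : Type u) (μ : Representation ℂ G (n →₀ ℂ)) (hμ : FunctionalModule.RowFinite μ),
        (FunctionalModule.plain A n μ hμ).InClassC) ∧
    -- plain modules with arbitrary actions of a finite group
    (Finite G → ∀ (A : GAlgebra.{u, v} G) (hA : A.HasApproxUnit) (n : Type u)
      (γ : G →* AddMonoid.End (n →₀ A))
      (hγ : ∀ g ξ a, γ g (FunctionalModule.freeMul A n ξ a)
        = FunctionalModule.freeMul A n (γ g ξ) (A.act g a))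
      (hrow : ∀ g, ∀ φ ∈ LinearMap.range (FunctionalModule.row A n),
        A.act g ∘ₗ φ ∘ₗ FunctionalModule.linearAction hA γ hγ g⁻¹
          ∈ LinearMap.range (FunctionalModule.row A n)),
        (FunctionalModule.free A n (FunctionalModule.linearAction hA γ hγ) hγ hrow).InClassC) ∧
    -- direct sums
    (∀ (A : GAlgebra.{u, v} G), A.HasApproxUnit →
      ∀ (I : Type u) (E : I → FunctionalModule A),
        (∀ i, (E i).InClassC) → (FunctionalModule.directSum E).InClassC) ∧
    -- change of coefficient algebra
    (∀ (A B : GAlgebra.{u, v} G) (π : A.Hom B) (E : FunctionalModule A),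
      B.HasApproxUnit → E.InClassC → (E.change π).InClassC) ∧
    -- external tensor products
    (∀ (A B : GAlgebra.{u, v} G) (E : FunctionalModule A) (F : FunctionalModule B),
      E.InClassC → F.InClassC → (E.tensor F).InClassC) ∧
    -- corner modules
    (∀ (A : GAlgebra.{u, v} G) (E : FunctionalModule A)
      (F : FunctionalModule (E.prod (FunctionalModule.self A)).compact)
      (hE : E.InClassC), F.InClassC →
        (FunctionalModule.corner hE.approxUnit E F).InClassC) :=
  ⟨fun _ hA n μ hμ => FunctionalModule.plain_inClassC hA n μ hμ,
    fun _ _ hA _ _ hγ hrow => FunctionalModule.free_inClassC _ hA hγ hrow,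
    fun _ hA _ E hE => FunctionalModule.directSum_inClassC hA E hE,
    fun _ _ π _ hB hE => FunctionalModule.change_inClassC π hB hE,
    fun _ _ _ _ hE hF => FunctionalModule.tensor_inClassC hE hF,
    fun _ _ _ hE hF => FunctionalModule.corner_inClassC hE hF⟩
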